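/- Let $d\ge 0$ and let $\mathcal T$ be a locally finite face-to-face tiling of $\mathbb E^d$ by convex $d$-polytopes. Embed $\mathbb E^d$ in $\mathbb E^{d+1}$ as the hyperplane $x_{d+1}=0$, and put $\mathbf n_0=(0,\dots,0,-1)$. Two cells are adjacent if they share a $(d-1)$-face, and for adjacent cells $P,Q$ let $\mathbf n_{P,Q}\in\mathbb E^d$ be the unit normal to $P\cap Q$ directed from $P$ to $Q$. For a real function $s$ on the $(d-1)$-faces of $\mathcal T$, the torsion of $s$ around a $(d-2)$-face $R$ is $\sum_{F\supset R}s(F)\mathbf n_F$, the sum being over the $(d-1)$-faces $F$ that contain $R$, with unit normals $\mathbf n_F$ all directed consistently with one direction of rotation around $R$. A canonical scaling is a positive $s$ whose torsion around every $(d-2)$-face is $0$. A lift of a polytope $P\subset\mathbb E^d$ is a polytope $\widetilde P\subset\mathbb E^{d+1}$ of the same dimension whose orthogonal projection is $P$. Given a canonical scaling $s$ and an initial cell $P_0$, for each chain $P_0,P_1,\dots,P_k$ of successively adjacent cells define $L[P_0]=P_0$ with normal $\mathbf n_0$, and let $L[P_0,\dots,P_k]$ be the lift of $P_k$ that meets $L[P_0,\dots,P_{k-1}]$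 in a common face which projects onto $P_{k-1}\cap P_k$, and whose normal is the normal of $L[P_0,\dots,P_{k-1}]$ plus $s(P_{k-1}\cap P_k)\,\mathbf n_{P_{k-1},P_k}$. Let $\mathcal G_{\mathcal T}$ be the family of all $L[P_0,\dots,P_k]$, coinciding point sets being identified. Two members are declared adjacent if they arise consecutively in some chain, and a face $K$ is declared common to two members if they are joined by a sequence of declared-adjacent members whose consecutive ones share $K$. A generatrix of $\mathcal T$ is a $d$-dimensional polyhedral manifold in $\mathbb E^{d+1}$ (a locally finite face-to-face complex of $d$-polytopes whose union is a topological $d$-manifold) whose orthogonal projection to $\mathbb E^d$ is one-to-one and maps its $d$-cells onto the cells of $\mathcal T$. It is called convex if it is the boundary of a closed convex set with nonempty interior of which all its $d$-cells are faces. A real function $s$ on the $(d-1)$-faces describes the normal increments of a generatrix if, for any two of its $d$-cells lying over adjacent cells $P$ and $Q$, with normals $\mathbf h_P,\mathbf h_Q$ normalized to have last coordinate $-1$, one has $\mathbf h_Q-\mathbf h_P=s(P\cap Q)\,\mathbf n_{P,Q}$. Then the following hold. (1) Let $s$ be a canonical scaling of $\mathcal T$ and $P_0$ a cell. For every chain from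 $P_0$ the polytope $L[P_0,\dots,P_k]$ exists and is unique; the declared adjacencies and common faces of $\mathcal G_{\mathcal T}$ are exactly the geometric ones; and $\mathcal G_{\mathcal T}$ is a convex generatrix of $\mathcal T$ whose normal increments are described by $s$. (2) Conversely, the normal increments of any generatrix of $\mathcal T$ are described by a real function $s$ on the $(d-1)$-faces with zero torsion around every $(d-2)$-face; and if the generatrix is convex, then $\mathcal T$ has a canonical scaling $s$ such that $s$ or $-s$ describes the normal increments of the generatrix. -/

import Mathlib

namespace Gen

noncomputable section

/-! ### Polytopes and tilings -/

/-- The Euclidean space of dimension `d`. -/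
abbrev E (d : ℕ) : Type := EuclideanSpace ℝ (Fin d)

/-- The Euclidean space of dimension `d + 1`, as the orthogonal sum of `E d` and the last
coordinate axis. The orthogonal projection onto `E d` is `fun p => p.fst`, and the last
coordinate is `p.snd`. -/
abbrev E' (d : ℕ) : Type := WithLp 2 (E d × ℝ)

section General

variable {V : Type*} [NormedAddCommGroup V] [InnerProductSpace ℝ V]

/-- Dimension of (the affine hull of) a nonempty set. -/
def dim (A : Set V) : ℕ := Module.finrank ℝ (vectorSpan ℝ A)

/-- Convex polytope: the convex hull of finitely many points. -/
def IsPolytope (A : Set V) : Prop := ∃ S : Set V, S.Finite ∧ A = convexHull ℝ S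

/-- `F` is a nonempty face of the convex polytope `A` (`A` itself is a face of `A`). -/
def IsFace (A F : Set V) : Prop := F.Nonempty ∧ IsExposed ℝ A F

/-- `N` is a nonzero vector orthogonal to the affine hull of `A`. -/
def IsNormal (A : Set V) (N : V) : Prop :=
  N ≠ 0 ∧ ∀ x ∈ A, ∀ y ∈ A, inner ℝ N (x - y) = 0

/-- Any two different members meet in the empty set or in a common face. -/
def FaceToFace (T : Set (Set V)) : Prop :=
  ∀ P ∈ T, ∀ Q ∈ T, P ≠ Q → (P ∩ Q).Nonempty → IsFace P (P ∩ Q) ∧ IsFace Q (P ∩ Q)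

/-- Every point has a neighbourhood that meets only finitely many members. -/
def IsLocallyFinite (T : Set (Set V)) : Prop :=
  LocallyFinite fun P : T => (P : Set V)

end General

variable {d : ℕ}

/-- Locally finite face-to-face tiling of `E d` by convex `d`-polytopes, given by its set of
`d`-cells. -/
structure IsTiling (T : Set (Set (E d))) : Prop where
  polytope : ∀ P ∈ T, IsPolytope P
  fullDim : ∀ P ∈ T, (interior P).Nonempty
  cover : ⋃₀ T = Set.univ
  disjoint : ∀ P ∈ T, ∀ Q ∈ T, P ≠ Q → Disjoint (interior P) (interior Q)
  faceToFace : FaceToFace T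
  locallyFinite : IsLocallyFinite T

/-- The `(d-1)`-faces (hyperfaces) of the tiling. -/
def facets (T : Set (Set (E d))) : Set (Set (E d)) :=
  {F | ∃ P ∈ T, IsFace P F ∧ dim F + 1 = d}

/-- The `(d-2)`-faces of the tiling. -/
def ridges (T : Set (Set (E d))) : Set (Set (E d)) :=
  {R | ∃ P ∈ T, IsFace P R ∧ dim R + 2 = d}

/-- The `(d-1)`-faces of the tiling that contain `R`. -/
def facetsAround (T : Set (Set (E d))) (R : Set (E d)) : Set (Set (E d)) :=
  {F | F ∈ facets T ∧ R ⊆ F}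

/-- Two different `d`-cells are adjacent if they have a common `(d-1)`-face. -/
def Adjacent (T : Set (Set (E d))) (P Q : Set (E d)) : Prop :=
  P ∈ T ∧ Q ∈ T ∧ P ≠ Q ∧ (P ∩ Q).Nonempty ∧ dim (P ∩ Q) + 1 = d

/-- `n` is the unit normal to `P ∩ Q` directed from `P` to `Q`. -/
def IsUnitNormal (P Q : Set (E d)) (n : E d) : Prop :=
  ‖n‖ = 1 ∧ (∀ x ∈ P ∩ Q, ∀ y ∈ P ∩ Q, inner ℝ n (x - y) = 0) ∧
    ∀ x ∈ P, ∀ y ∈ Q, inner ℝ n x ≤ inner ℝ n y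

/-- The unit normal to the common `(d-1)`-face of the adjacent cells `P` and `Q`, directed from
`P` to `Q`. -/
def unitNormal (P Q : Set (E d)) : E d := Classical.epsilon (IsUnitNormal P Q)

/-! ### Canonical scalings

A scaling is a function on the set of `(d-1)`-faces of the tiling; it is represented by a function
on all sets, of which only the values at members of `facets T` are ever used. -/

/-- `n` assigns to each `(d-1)`-face `F ⊇ R` its unit normal, all of them directed consistently
with one of the two directions of rotation around the `(d-2)`-face `R`: the plane orthogonal to
`R` is oriented by a quarter turn `J`; if `u` is the unit vector of that plane that points from
`R` into `F`, then `n F = J u`. -/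
def CoherentNormals (T : Set (Set (E d))) (R : Set (E d)) (n : Set (E d) → E d) : Prop :=
  ∃ J : (vectorSpan ℝ R)ᗮ →ₗᵢ[ℝ] (vectorSpan ℝ R)ᗮ, (∀ w, inner ℝ (J w) w = 0) ∧
    ∀ F ∈ facetsAround T R, ∃ u : (vectorSpan ℝ R)ᗮ,
      ‖u‖ = 1 ∧ (u : E d) ∈ vectorSpan ℝ F ∧
      (∀ r ∈ R, ∀ x ∈ F, 0 ≤ inner ℝ (u : E d) (x - r)) ∧ n F = (J u : E d)

/-- The torsion of `s` around `R`, computed with the unit normals `n`. -/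
def torsion (T : Set (Set (E d))) (s : Set (E d) → ℝ) (R : Set (E d)) (n : Set (E d) → E d) :
    E d :=
  ∑ᶠ F ∈ facetsAround T R, s F • n F

/-- The torsion of `s` around every `(d-2)`-face is zero. -/
def ZeroTorsion (T : Set (Set (E d))) (s : Set (E d) → ℝ) : Prop :=
  ∀ R ∈ ridges T, ∀ n : Set (E d) → E d, CoherentNormals T R n → torsion T s R n = 0

/-- Canonical scaling: positive, with zero torsion around every `(d-2)`-face. -/
def IsCanonicalScaling (T : Set (Set (E d))) (s : Set (E d) → ℝ) : Prop :=
  (∀ F ∈ facets T, 0 < s F) ∧ ZeroTorsion T s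

/-! ### Lifts -/

/-- The orthogonal projection of a set to `E d`. -/
def proj (A : Set (E' d)) : Set (E d) := (fun p : E' d => p.fst) '' A

/-- The embedding of `E d` as the hyperplane on which the last coordinate is zero. -/
def embed (x : E d) : E' d := WithLp.toLp 2 (x, 0)

/-- The normal `(0, …, 0, -1)` to that hyperplane. -/
def n₀ : E' d := WithLp.toLp 2 (0, -1)

/-- `A` is a lift of the polytope `P`: a polytope of the same dimension that projects onto `P`. -/
def IsLift (P : Set (E d)) (A : Set (E' d)) : Prop :=
  IsPolytope A ∧ dim A = dim P ∧ proj A = P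

/-- `B` is a lift of `Q` up to the lift `A` of `P`. -/
def IsLiftUpTo (P : Set (E d)) (A : Set (E' d)) (Q : Set (E d)) (B : Set (E' d)) : Prop :=
  IsLift Q B ∧ IsFace A (A ∩ B) ∧ IsFace B (A ∩ B) ∧ proj (A ∩ B) = P ∩ Q

/-- `IsChainLift T s P₀ [Pₖ, …, P₁, P₀] A N`: the polytope `A` is obtained from the chain
`P₀, P₁, …, Pₖ` by lifting the cells one after another, starting from `P₀` in the hyperplane
`E d` with normal `n₀`, each cell being lifted up to the lift of its predecessor with the normal
increment `s (Pᵢ ∩ Pᵢ₊₁) • nᵢ,ᵢ₊₁`; the vector `N` is the resulting normal of `A`.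
(The chain is listed from its last cell to its first one.) -/
inductive IsChainLift (T : Set (Set (E d))) (s : Set (E d) → ℝ) (P₀ : Set (E d)) :
    List (Set (E d)) → Set (E' d) → E' d → Prop
  | base : IsChainLift T s P₀ [P₀] (embed '' P₀) n₀
  | step {c : List (Set (E d))} {P Q : Set (E d)} {A B : Set (E' d)} {N : E' d} :
      IsChainLift T s P₀ (P :: c) A N → Adjacent T P Q → IsLiftUpTo P A Q B →
      IsNormal B (N + embed (s (P ∩ Q) • unitNormal P Q)) →
      IsChainLift T s P₀ (Q :: P :: c) B (N + embed (s (P ∩ Q) • unitNormal P Q))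

/-- A chain of the tiling that starts at `P₀` (listed from its last cell to its first one). -/
def IsChainFrom (T : Set (Set (E d))) (P₀ : Set (E d)) (c : List (Set (E d))) : Prop :=
  c.IsChain (fun Q P => Adjacent T P Q) ∧ c.getLast? = some P₀

/-- The family `𝒢(T, s)` of all lifts along chains that start at `P₀`; lifts that coincide as
point sets are identified. -/
def liftedComplex (T : Set (Set (E d))) (s : Set (E d) → ℝ) (P₀ : Set (E d)) :
    Set (Set (E' d)) :=
  {A | ∃ c N, IsChainLift T s P₀ c A N}

/-- Adjacency of the `d`-faces of `𝒢(T, s)`: they arise one after the other in a chain of lifts. -/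
def LiftAdjacent (T : Set (Set (E d))) (s : Set (E d) → ℝ) (P₀ : Set (E d))
    (A B : Set (E' d)) : Prop :=
  ∃ c P N M, (IsChainLift T s P₀ c A N ∧ IsChainLift T s P₀ (P :: c) B M) ∨
    (IsChainLift T s P₀ c B N ∧ IsChainLift T s P₀ (P :: c) A M)

/-- Incidence in `𝒢(T, s)`: the face `K` of `A` is common to `A` and `B` if there is a chain
of successively adjacent `d`-faces from `A` to `B` whose consecutive members all share `K`. -/
def LiftCommonFace (T : Set (Set (E d))) (s : Set (E d) → ℝ) (P₀ : Set (E d))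
    (A B K : Set (E' d)) : Prop :=
  IsFace A K ∧
    Relation.ReflTransGen (fun X Y => LiftAdjacent T s P₀ X Y ∧ K ⊆ X ∩ Y) A B

/-! ### Generatrices -/

/-- `d`-dimensional polyhedral manifold in `E' d`, given by the set of its `d`-cells: a locally
finite complex of `d`-polytopes, meeting face-to-face, whose union is a topological
`d`-manifold. -/
structure IsPolyhedralManifold (G : Set (Set (E' d))) : Prop where
  polytope : ∀ A ∈ G, IsPolytope A
  nonempty : ∀ A ∈ G, A.Nonempty
  dim_eq : ∀ A ∈ G, dim A = d
  faceToFace : FaceToFace G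
  locallyFinite : IsLocallyFinite G
  manifold : Nonempty (ChartedSpace (E d) (⋃₀ G))

/-- Generatrix of the tiling `T`: a `d`-dimensional polyhedral manifold in `E' d` whose orthogonal
projection to `E d` is one-to-one and coincides with `T`. -/
structure IsGeneratrix (T : Set (Set (E d))) (G : Set (Set (E' d))) : Prop where
  isManifold : IsPolyhedralManifold G
  injOn : Set.InjOn (fun p : E' d => p.fst) (⋃₀ G)
  proj_eq : proj '' G = T

/-- `G` is the boundary of a convex `(d+1)`-dimensional polyhedron whose `d`-dimensional faces are
the members of `G`. -/
def BoundsConvexPolyhedron (G : Set (Set (E' d))) : Prop :=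
  ∃ C : Set (E' d), Convex ℝ C ∧ IsClosed C ∧ (interior C).Nonempty ∧ frontier C = ⋃₀ G ∧
    ∀ A ∈ G, IsFace C A

/-- The scaling `s` describes the normal increments of `G`: if `A` and `B` are the members of `G`
over adjacent cells `P` and `Q`, then their normals with last coordinate `-1` differ by
`s (P ∩ Q)` times the unit normal directed from `P` to `Q`. -/
def HasNormalIncrements (T : Set (Set (E d))) (G : Set (Set (E' d))) (s : Set (E d) → ℝ) : Prop :=
  ∀ A ∈ G, ∀ B ∈ G, Adjacent T (proj A) (proj B) →
    ∀ N M : E' d, IsNormal A N → IsNormal B M → N.snd = -1 → M.snd = -1 →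
      M - N = embed (s (proj A ∩ proj B) • unitNormal (proj A) (proj B))

end

end Gen

/-! Crossing a hyperface `F` should add to the current affine function `s F` times the affine
function that vanishes on `F` and has the unit normal as gradient. Part (1) amounts to showing that
these increments are differences of affine functions `g P` attached to the cells, with `g P₀ = 0`:
the lift obtained from any chain ending in `P` is then the graph of `g P` over `P`, whatever the
chain.

The existence of `g` (`exists_potential`) is an integration argument. Instead of contracting loops
of cells, one sums the increments along straight segments between generic points, with signs for the
direction of crossing, and shows that the sum around a generic triangle is zero (`segSum_triangle`).
The plane of the triangle cuts each hyperface `F` in a piece of a line. Counting its ends by sign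
gives a discrete Stokes formula (`facet_stokes`): the signed crossings of the three sides with `F`
equal a signed count of the faces of codimension two of `F` that the triangle meets. After
exchanging the summations, each such face `R` contributes its torsion, which is zero. The constant
terms vanish too, because all hyperfaces around `R` pass through a common point. General position
excludes faces of codimension three and tangencies, and is available because countably many proper
affine subspaces do not cover an open set.

The functions `g P` agree where cells meet and form a continuous piecewise affine function `f`. If
`s` is positive, then along a generic segment that starts inside `P` every crossing can only
increase the advantage over `g P`. Hence `g P ≤ f`, with strict inequality off `P`
(`evalPair_lt_piecewiseFn`). So `f` is convex, and its epigraph has the graphs over the cells as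
faces. Common faces are the geometric ones because the cells around a face are linked by adjacencies
around that face (`face_connected`).

For part (2), the cells of a generatrix are graphs of affine functions, which agree on intersections
because the projection is injective. The gradients over adjacent cells therefore differ by a
multiple of the normal of the common hyperface, which defines `s`. Its torsion around `R`
telescopes: taking the cell in front of each hyperface around `R`, or the cell behind it, enumerates
the cells around `R` once in either case (`bijOn_side`). If the generatrix is convex, the plane of
each cell supports `f` from below or from above. The sign of `s` on a common hyperface forces
adjacent cells to be of the same kind, so connectedness gives `s` one sign. -/

namespace Gen

open Set Filter Topology

variable {d : ℕ} {T : Set (Set (E d))}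

section Convex

variable {V : Type*} [NormedAddCommGroup V] [InnerProductSpace ℝ V]

/-! ### Faces -/

theorem IsFace.subset {A F : Set V} (h : IsFace A F) : F ⊆ A := h.2.subset

theorem IsFace.refl {A : Set V} (h : A.Nonempty) : IsFace A A := ⟨h, IsExposed.refl A⟩

theorem IsFace.restrict {A B K : Set V} (h : IsFace A K) (hKB : K ⊆ B) (hBA : B ⊆ A) :
    IsFace B K := ⟨h.1, h.2.mono hBA hKB⟩

theorem isFace_of_inner {A F : Set V} {a : V} {c : ℝ} (hF : F.Nonempty)
    (hle : ∀ x ∈ A, inner ℝ a x ≤ c) (heq : F = {x ∈ A | inner ℝ a x = c}) : IsFace A F := by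
  refine ⟨hF, fun _ => ⟨innerSL ℝ a, ?_⟩⟩
  obtain ⟨z, hz⟩ := hF
  rw [heq] at hz ⊢
  ext x
  simp only [mem_ofPred_eq, innerSL_apply_apply]
  refine and_congr_right fun hx => ⟨fun h y hy => by rw [h]; exact hle y hy, fun h => ?_⟩
  exact le_antisymm (hle x hx) (hz.2 ▸ h z hz.1)

theorem IsFace.exists_inner [CompleteSpace V] {A F : Set V} (h : IsFace A F) :
    ∃ (a : V) (c : ℝ), (∀ x ∈ A, inner ℝ a x ≤ c) ∧ F = {x ∈ A | inner ℝ a x = c} := by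
  obtain ⟨l, hl⟩ := h.2 h.1
  obtain ⟨z, hz⟩ := h.1
  have key : ∀ x, inner ℝ ((InnerProductSpace.toDual ℝ V).symm l) x = l x := fun x => by simp
  rw [hl] at hz
  refine ⟨(InnerProductSpace.toDual ℝ V).symm l, l z, fun x hx => by rw [key]; exact hz.2 x hx, ?_⟩
  rw [hl]
  ext x
  simp only [mem_ofPred_eq, key]
  refine and_congr_right fun hx => ⟨fun h => le_antisymm (hz.2 x hx) (h z hz.1), fun h y hy => ?_⟩
  rw [h]; exact hz.2 y hy

theorem IsPolytope.convex {A : Set V} (h : IsPolytope A) : Convex ℝ A := by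
  obtain ⟨S, -, rfl⟩ := h
  exact convex_convexHull ℝ S

theorem IsPolytope.isCompact {A : Set V} (h : IsPolytope A) : IsCompact A := by
  obtain ⟨S, hS, rfl⟩ := h
  exact hS.isCompact_convexHull ℝ

theorem convexHull_inner_le {S : Set V} {a : V} {c : ℝ} (h : ∀ x ∈ S, inner ℝ a x ≤ c) :
    ∀ x ∈ convexHull ℝ S, inner ℝ a x ≤ c := by
  have hc : Convex ℝ {x : V | inner ℝ a x ≤ c} :=
    convex_halfSpace_le (innerSL ℝ a).toLinearMap.isLinear c
  exact fun x hx => convexHull_min (t := {x : V | inner ℝ a x ≤ c}) h hc hx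

/-- A convex combination attains the maximum of a linear functional only if every point of positive
weight attains it. This makes faces of polytopes polytopes, and finite in number. -/
theorem isFace_convexHull_eq [CompleteSpace V] {S F : Set V} (h : IsFace (convexHull ℝ S) F) :
    F = convexHull ℝ (S ∩ F) := by
  obtain ⟨a, c, hle, heq⟩ := h.exists_inner
  have hFc : Convex ℝ F := h.2.convex (convex_convexHull ℝ S)
  refine subset_antisymm (fun x hx => ?_) (convexHull_min inter_subset_right hFc)
  have hx' := heq ▸ hx
  obtain ⟨hxS, hxc⟩ := hx'
  rw [convexHull_eq] at hxS
  obtain ⟨ι, t, w, z, hw, hw1, hz, rfl⟩ := hxS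
  have hzc : ∀ i ∈ t, w i ≠ 0 → z i ∈ F := by
    intro i hi hwi
    rw [heq]
    refine ⟨subset_convexHull ℝ S (hz i hi), ?_⟩
    by_contra hne
    have hlt : inner ℝ a (z i) < c :=
      lt_of_le_of_ne (hle _ (subset_convexHull ℝ S (hz i hi))) hne
    have : ∑ j ∈ t, w j * inner ℝ a (z j) < ∑ j ∈ t, w j * c := by
      refine Finset.sum_lt_sum (fun j hj => ?_) ⟨i, hi, ?_⟩
      · exact mul_le_mul_of_nonneg_left (hle _ (subset_convexHull ℝ S (hz j hj))) (hw j hj)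
      · exact mul_lt_mul_of_pos_left hlt (lt_of_le_of_ne (hw i hi) (Ne.symm hwi))
    rw [← Finset.sum_mul, hw1, one_mul] at this
    rw [Finset.centerMass_eq_of_sum_1 _ _ hw1, inner_sum] at hxc
    simp only [inner_smul_right] at hxc
    linarith
  rw [← Finset.centerMass_filter_ne_zero]
  refine Finset.centerMass_mem_convexHull _ (fun i hi => hw i (Finset.mem_filter.1 hi).1) ?_ ?_
  · rw [Finset.sum_filter_ne_zero, hw1]; exact one_pos
  · intro i hi
    obtain ⟨hi, hwi⟩ := Finset.mem_filter.1 hi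
    exact ⟨hz i hi, hzc i hi hwi⟩

theorem IsFace.isPolytope [CompleteSpace V] {A F : Set V} (h : IsFace A F) (hA : IsPolytope A) :
    IsPolytope F := by
  obtain ⟨S, hS, rfl⟩ := hA
  exact ⟨S ∩ F, hS.inter_of_left F, isFace_convexHull_eq h⟩

theorem IsPolytope.finite_faces [CompleteSpace V] {A : Set V} (hA : IsPolytope A) :
    {F | IsFace A F}.Finite := by
  obtain ⟨S, hS, rfl⟩ := hA
  refine (hS.finite_subsets.image (fun B => convexHull ℝ B)).subset fun F hF => ?_
  exact ⟨S ∩ F, inter_subset_left, (isFace_convexHull_eq hF).symm⟩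

/-- This fails for exposed faces of general convex sets. For a polytope, the functional `a` exposing
`G` has a strict gap at the finitely many generating points outside `G`, so `a + ε • a'` with small
`ε`, where `a'` exposes `K` in `G`, exposes `K` in `A`. -/
theorem IsFace.trans [CompleteSpace V] {A G K : Set V} (hA : IsPolytope A) (hG : IsFace A G)
    (hK : IsFace G K) : IsFace A K := by
  obtain ⟨S, hS, rfl⟩ := hA
  obtain ⟨a, c, hle, heq⟩ := hG.exists_inner
  obtain ⟨a', c', hle', heq'⟩ := hK.exists_inner
  have hev : ∀ᶠ ε in 𝓝 (0 : ℝ), ∀ x ∈ S, x ∉ G → inner ℝ (a + ε • a') x < c + ε * c' := by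
    rw [hS.eventually_all]
    intro x hx
    rw [eventually_imp_distrib_left]
    intro hxG
    have hlt : inner ℝ a x < c := lt_of_le_of_ne (hle x (subset_convexHull ℝ S hx)) fun h =>
      hxG (by rw [heq]; exact ⟨subset_convexHull ℝ S hx, h⟩)
    have h1 : ContinuousAt (fun ε : ℝ => inner ℝ (a + ε • a') x) 0 := by fun_prop
    have h2 : ContinuousAt (fun ε : ℝ => c + ε * c') 0 := by fun_prop
    exact h1.eventually_lt h2 (by simpa using hlt)
  obtain ⟨δ, hδ, hδ'⟩ := Metric.eventually_nhds_iff.1 hev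
  have hbound : ∀ ε, 0 < ε → ε < δ → ∀ x ∈ convexHull ℝ S,
      inner ℝ (a + ε • a') x ≤ c + ε * c' := by
    intro ε hε hεδ
    refine convexHull_inner_le fun x hx => ?_
    by_cases hxG : x ∈ G
    · have h1 := hle' x hxG
      rw [heq] at hxG
      rw [inner_add_left, real_inner_smul_left, hxG.2]
      have := mul_le_mul_of_nonneg_left h1 hε.le
      linarith
    · exact (hδ' (by simpa [abs_of_pos hε] using hεδ) x hx hxG).le
  -- With `δ / 3`, the bound also holds at twice this parameter, which is used below.
  refine isFace_of_inner (a := a + (δ / 3) • a') (c := c + δ / 3 * c') hK.1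
    (hbound _ (by positivity) (by linarith)) ?_
  ext x
  simp only [mem_ofPred_eq]
  constructor
  · intro hx
    have hxG := hK.subset hx
    rw [heq'] at hx
    rw [heq] at hxG
    refine ⟨hxG.1, ?_⟩
    rw [inner_add_left, real_inner_smul_left, hxG.2, hx.2]
  · rintro ⟨hxS, hx⟩
    -- Equality at the parameter `δ / 3` and the inequality at its double together give `c ≤ ⟨a,
    -- x⟩`, hence `x ∈ G`.
    have h2 := hbound (2 * (δ / 3)) (by positivity) (by linarith) x hxS
    rw [inner_add_left, real_inner_smul_left] at hx h2
    have h3 := hle x hxS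
    have hxG : x ∈ G := by
      rw [heq]
      exact ⟨hxS, by linarith⟩
    have h4 : inner ℝ a x = c := by rw [heq] at hxG; exact hxG.2
    rw [heq']
    refine ⟨hxG, ?_⟩
    rw [h4] at hx
    have : δ / 3 * (inner ℝ a' x - c') = 0 := by linarith
    rcases mul_eq_zero.1 this with h | h <;> linarith

/-! ### Relative interior -/

/-- `x` is a relative interior point of `A`. -/
def RelInt (A : Set V) (x : V) : Prop := ∀ᶠ v : vectorSpan ℝ A in 𝓝 0, x + (v : V) ∈ A

theorem RelInt.mem {A : Set V} {x : V} (h : RelInt A x) : x ∈ A := by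
  simpa using h.self_of_nhds

theorem RelInt.eventually {A : Set V} {x v : V} (h : RelInt A x) (hv : v ∈ vectorSpan ℝ A) :
    ∀ᶠ t in 𝓝 (0 : ℝ), x + t • v ∈ A := by
  have hc : Tendsto (fun t : ℝ => t • (⟨v, hv⟩ : vectorSpan ℝ A)) (𝓝 0) (𝓝 0) := by
    have : Continuous (fun t : ℝ => t • (⟨v, hv⟩ : vectorSpan ℝ A)) := by fun_prop
    simpa using this.tendsto 0
  exact hc.eventually h

/-- If the functional exposing `F` were smaller at some `y ∈ K` than at `x`, a small step from `x`
away from `y` would stay in `K` and exceed the maximum. -/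
theorem RelInt.subset_face [CompleteSpace V] {A F K : Set V} {x : V} (hx : RelInt K x)
    (hKA : K ⊆ A) (hF : IsFace A F) (hxF : x ∈ F) : K ⊆ F := by
  intro y hy
  obtain ⟨a, c, hle, heq⟩ := hF.exists_inner
  have hv : x - y ∈ vectorSpan ℝ K := vsub_mem_vectorSpan ℝ hx.mem hy
  obtain ⟨t, ht, htK⟩ := (((hx.eventually hv).filter_mono nhdsWithin_le_nhds).and
    (self_mem_nhdsWithin (s := Ioi (0 : ℝ)))).exists
  have h1 := hle _ (hKA ht)
  rw [heq] at hxF ⊢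
  rw [inner_add_right, inner_smul_right, inner_sub_right, hxF.2] at h1
  refine ⟨hKA hy, le_antisymm (hle y (hKA hy)) ?_⟩
  have htK : (0 : ℝ) < t := htK
  have : t * (c - inner ℝ a y) ≤ t * 0 := by linarith
  have := le_of_mul_le_mul_left this htK
  linarith

theorem inner_eq_zero_of_mem_vectorSpan {A : Set V} {a : V} {c : ℝ}
    (h : ∀ x ∈ A, inner ℝ a x = c) {v : V} (hv : v ∈ vectorSpan ℝ A) : inner ℝ a v = 0 := by
  rw [vectorSpan_def] at hv
  induction hv using Submodule.span_induction with
  | mem v hv =>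
    obtain ⟨y, hy, z, hz, rfl⟩ := hv
    simp [inner_sub_right, h y hy, h z hz]
  | zero => simp
  | add v w _ _ hv hw => rw [inner_add_right, hv, hw, add_zero]
  | smul t v _ hv => rw [inner_smul_right, hv, mul_zero]

/-- Near a relative interior point `r` of a convex subset `R` of `A`, the set `A` contains the
initial pieces of the rays spanned by the directions of `R` and a direction into `A`. -/
theorem RelInt.eventually_mem_of_convex {A R : Set V} (hA : Convex ℝ A) (hRA : R ⊆ A) {r f w : V}
    {c : ℝ} (hr : RelInt R r) (hf : f ∈ A) (hw : w ∈ vectorSpan ℝ R) (hc : 0 ≤ c) :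
    ∀ᶠ t in 𝓝[>] (0 : ℝ), r + t • (c • (f - r) + w) ∈ A := by
  -- The point in question is the convex combination of `f`, with weight `t * c`, and of `r + (t /
  -- (1 - t * c)) • w`, which stays in `R` for small `t`.
  have h1 : Tendsto (fun t : ℝ => t / (1 - t * c)) (𝓝[>] 0) (𝓝 0) := by
    have : ContinuousAt (fun t : ℝ => t / (1 - t * c)) 0 := by
      refine ContinuousAt.div (by fun_prop) (by fun_prop) (by simp)
    have h := this.tendsto
    simp only [zero_div] at h
    exact h.mono_left nhdsWithin_le_nhds
  have h2 : ∀ᶠ t in 𝓝[>] (0 : ℝ), t * c < 1 := by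
    have : Continuous fun t : ℝ => t * c := by fun_prop
    refine nhdsWithin_le_nhds (this.continuousAt.eventually_lt continuousAt_const ?_)
    simp
  filter_upwards [h1.eventually (hr.eventually hw), h2, self_mem_nhdsWithin] with t ht h3 h4
  have h4 : (0 : ℝ) < t := h4
  have h5 := hA (hRA ht) hf (a := 1 - t * c) (b := t * c) (by linarith) (by positivity) (by ring)
  convert h5 using 1
  have e : (1 - t * c) • (r + (t / (1 - t * c)) • w) = (1 - t * c) • r + t • w := by
    rw [smul_add, smul_smul, mul_div_cancel₀ _ (by linarith)]
  rw [e]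
  module

variable [FiniteDimensional ℝ V]

/-- Moves a convex set of any dimension into its own direction space, where it has interior points
and the separation theorems apply. -/
theorem translate_interior_nonempty {A : Set V} (hA : Convex ℝ A) {x : V} (hx : x ∈ A) :
    Convex ℝ {v : vectorSpan ℝ A | x + (v : V) ∈ A} ∧
    (interior {v : vectorSpan ℝ A | x + (v : V) ∈ A}).Nonempty ∧
    Submodule.span ℝ {v : vectorSpan ℝ A | x + (v : V) ∈ A} = ⊤ := by
  have hc : Convex ℝ {v : vectorSpan ℝ A | x + (v : V) ∈ A} := by
    intro v hv w hw a b ha hb hab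
    have := hA hv hw ha hb hab
    have e : x + ((a • v + b • w : vectorSpan ℝ A) : V) = a • (x + (v : V)) + b • (x + (w : V)) := by
      push_cast
      calc x + (a • (v : V) + b • (w : V)) = (a + b) • x + (a • (v : V) + b • (w : V)) := by
            rw [hab, one_smul]
        _ = _ := by module
    rw [mem_ofPred_eq, e]; exact this
  have hspan : Submodule.span ℝ {v : vectorSpan ℝ A | x + (v : V) ∈ A} = ⊤ := by
    apply Submodule.map_injective_of_injective (vectorSpan ℝ A).subtype_injective
    rw [Submodule.map_span, Submodule.map_top, Submodule.range_subtype]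
    conv_rhs => rw [vectorSpan_eq_span_vsub_set_right ℝ hx]
    congr 1
    ext v
    constructor
    · rintro ⟨w, hw, rfl⟩
      exact ⟨x + w, hw, by simp⟩
    · rintro ⟨y, hy, rfl⟩
      exact ⟨⟨y - x, vsub_mem_vectorSpan ℝ hy hx⟩, by simpa using hy, rfl⟩
  refine ⟨hc, ?_, hspan⟩
  rw [hc.interior_nonempty_iff_affineSpan_eq_top]
  have h0 : (0 : vectorSpan ℝ A) ∈ {v : vectorSpan ℝ A | x + (v : V) ∈ A} := by simpa using hx
  rw [AffineSubspace.affineSpan_eq_top_iff_vectorSpan_eq_top_of_nonempty ℝ _ _ ⟨0, h0⟩,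
    vectorSpan_eq_span_vsub_set_right ℝ h0]
  simpa using hspan

theorem exists_relInt {A : Set V} (hA : Convex ℝ A) (hne : A.Nonempty) : ∃ x, RelInt A x := by
  obtain ⟨a, ha⟩ := hne
  obtain ⟨-, ⟨v, hv⟩, -⟩ := translate_interior_nonempty hA ha
  refine ⟨a + v, ?_⟩
  have h1 : {v : vectorSpan ℝ A | a + (v : V) ∈ A} ∈ 𝓝 v := mem_interior_iff_mem_nhds.1 hv
  have h2 : Tendsto (fun w : vectorSpan ℝ A => v + w) (𝓝 0) (𝓝 v) := by
    simpa using (continuous_const_add v).tendsto 0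
  filter_upwards [h2 h1] with w hw
  simpa [add_assoc] using hw

/-- Hahn–Banach in the direction space of `A`. The second conclusion holds because a functional
constant on `A` would vanish on that whole space. -/
theorem exists_supporting {A : Set V} (hA : Convex ℝ A) {x : V} (hx : x ∈ A)
    (hr : ¬ RelInt A x) :
    ∃ a : V, (∀ y ∈ A, inner ℝ a y ≤ inner ℝ a x) ∧ ∃ y ∈ A, inner ℝ a y < inner ℝ a x := by
  obtain ⟨hc, hne, hspan⟩ := translate_interior_nonempty hA hx
  have h0 : (0 : vectorSpan ℝ A) ∉ interior {v : vectorSpan ℝ A | x + (v : V) ∈ A} :=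
    fun h => hr (mem_interior_iff_mem_nhds.1 h)
  obtain ⟨f, hf0, hf⟩ := geometric_hahn_banach_of_nonempty_interior_point hc h0 hne
  have key : ∀ v : vectorSpan ℝ A,
      inner ℝ (((InnerProductSpace.toDual ℝ (vectorSpan ℝ A)).symm f : vectorSpan ℝ A) : V) (v : V)
        = f v := fun v => by
    rw [← Submodule.coe_inner]; simp
  have key2 : ∀ y (hy : y ∈ A),
      inner ℝ (((InnerProductSpace.toDual ℝ (vectorSpan ℝ A)).symm f : vectorSpan ℝ A) : V) (y - x)
        = f ⟨y - x, vsub_mem_vectorSpan ℝ hy hx⟩ := fun y hy =>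
    key ⟨y - x, vsub_mem_vectorSpan ℝ hy hx⟩
  have hle : ∀ y (hy : y ∈ A), f ⟨y - x, vsub_mem_vectorSpan ℝ hy hx⟩ ≤ 0 := fun y hy => by
    simpa using hf ⟨y - x, vsub_mem_vectorSpan ℝ hy hx⟩ (by simpa using hy)
  refine ⟨((InnerProductSpace.toDual ℝ (vectorSpan ℝ A)).symm f : vectorSpan ℝ A),
    fun y hy => ?_, ?_⟩
  · have := key2 y hy
    rw [inner_sub_right] at this
    linarith [hle y hy]
  · by_contra hcon
    push Not at hcon
    apply hf0
    have : ∀ v ∈ Submodule.span ℝ {v : vectorSpan ℝ A | x + (v : V) ∈ A}, f v = 0 := by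
      intro v hv
      induction hv using Submodule.span_induction with
      | mem v hv =>
        have h1 := hcon _ hv
        rw [inner_add_right, key] at h1
        have h2 := hf v hv
        rw [map_zero] at h2
        linarith
      | zero => simp
      | add v w _ _ hv hw => rw [map_add, hv, hw, add_zero]
      | smul c v _ hv => rw [map_smul, hv, smul_zero]
    ext v
    simpa using this v (by rw [hspan]; trivial)

theorem dim_mono {A B : Set V} (h : A ⊆ B) : dim A ≤ dim B :=
  Submodule.finrank_mono (vectorSpan_mono ℝ h)

theorem IsFace.eq_of_dim_le {A F : Set V} (h : IsFace A F) (hd : dim A ≤ dim F) : F = A := by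
  obtain ⟨a, c, hle, heq⟩ := h.exists_inner
  have hs : vectorSpan ℝ F = vectorSpan ℝ A :=
    Submodule.eq_of_le_of_finrank_le (vectorSpan_mono ℝ h.subset) hd
  obtain ⟨z, hz⟩ := h.1
  refine subset_antisymm h.subset fun x hx => ?_
  have hF : ∀ x ∈ F, inner ℝ a x = c := fun x hx => by rw [heq] at hx; exact hx.2
  have h1 : inner ℝ a (x - z) = 0 := inner_eq_zero_of_mem_vectorSpan hF
    (by rw [hs]; exact vsub_mem_vectorSpan ℝ hx (h.subset hz))
  rw [inner_sub_right, hF z hz] at h1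
  rw [heq]
  exact ⟨hx, by linarith⟩

theorem IsFace.dim_lt {A F : Set V} (h : IsFace A F) (hne : F ≠ A) : dim F < dim A := by
  by_contra hcon
  exact hne (h.eq_of_dim_le (not_lt.1 hcon))

/-- A face of least dimension through `x` works: a supporting functional at a relative boundary
point would cut out a smaller face through `x`. -/
theorem exists_face_relInt {A : Set V} (hA : IsPolytope A) {x : V} (hx : x ∈ A) :
    ∃ K, IsFace A K ∧ RelInt K x := by
  have hex : ∃ n, ∃ K, IsFace A K ∧ x ∈ K ∧ dim K = n :=
    ⟨_, A, IsFace.refl ⟨x, hx⟩, hx, rfl⟩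
  classical
  obtain ⟨K, hK, hxK, hdim⟩ := Nat.find_spec hex
  refine ⟨K, hK, ?_⟩
  by_contra hr
  obtain ⟨a, hle, y, hy, hlt⟩ := exists_supporting (hK.isPolytope hA).convex hxK hr
  have hF : IsFace K {z ∈ K | inner ℝ a z = inner ℝ a x} :=
    isFace_of_inner ⟨x, hxK, rfl⟩ hle rfl
  refine Nat.find_min hex (m := dim {z ∈ K | inner ℝ a z = inner ℝ a x}) ?_
    ⟨_, hK.trans hA hF, ⟨hxK, rfl⟩, rfl⟩
  rw [← hdim]
  refine hF.dim_lt fun h => ?_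
  rw [← h] at hy
  exact hlt.ne hy.2

end Convex

/-! ### Cells of a tiling -/

theorem inner_lt_of_mem_interior {V : Type*} [NormedAddCommGroup V] [InnerProductSpace ℝ V]
    {P : Set V} {a p : V} {c : ℝ} (ha : a ≠ 0) (h : ∀ x ∈ P, c ≤ inner ℝ a x)
    (hp : p ∈ interior P) : c < inner ℝ a p := by
  have h1 : Tendsto (fun t : ℝ => p - t • a) (𝓝[>] 0) (𝓝 p) := by
    have : Continuous (fun t : ℝ => p - t • a) := by fun_prop
    have := (this.tendsto 0).mono_left (nhdsWithin_le_nhds (s := Ioi (0 : ℝ)))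
    simpa using this
  obtain ⟨t, ht, ht0⟩ := ((h1.eventually (mem_interior_iff_mem_nhds.1 hp)).and
    self_mem_nhdsWithin).exists
  have h2 := h _ ht
  rw [inner_sub_right, inner_smul_right] at h2
  have : 0 < t * inner ℝ a a := mul_pos ht0 (real_inner_self_pos.2 ha)
  linarith

namespace IsTiling

variable (hT : IsTiling T)
include hT

theorem convex {P : Set (E d)} (hP : P ∈ T) : Convex ℝ P := (hT.polytope P hP).convex

theorem isClosed {P : Set (E d)} (hP : P ∈ T) : IsClosed P := (hT.polytope P hP).isCompact.isClosed

theorem nonempty {P : Set (E d)} (hP : P ∈ T) : P.Nonempty :=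
  (hT.fullDim P hP).mono interior_subset

theorem vectorSpan_eq_top {P : Set (E d)} (hP : P ∈ T) : vectorSpan ℝ P = ⊤ := by
  rw [← AffineSubspace.affineSpan_eq_top_iff_vectorSpan_eq_top_of_nonempty ℝ _ _ (hT.nonempty hP)]
  exact (hT.convex hP).interior_nonempty_iff_affineSpan_eq_top.1 (hT.fullDim P hP)

theorem dim_eq {P : Set (E d)} (hP : P ∈ T) : dim P = d := by
  rw [dim, hT.vectorSpan_eq_top hP, finrank_top, finrank_euclideanSpace_fin]

theorem closure_interior {P : Set (E d)} (hP : P ∈ T) : closure (interior P) = P := by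
  rw [(hT.convex hP).closure_interior_eq_closure_of_nonempty_interior (hT.fullDim P hP),
    (hT.isClosed hP).closure_eq]

theorem eq_of_mem_interior {P Q : Set (E d)} (hP : P ∈ T) (hQ : Q ∈ T) {x : E d}
    (hx : x ∈ interior P) (hxQ : x ∈ Q) : P = Q := by
  by_contra hne
  rw [← hT.closure_interior hQ, mem_closure_iff] at hxQ
  obtain ⟨y, hy, hy'⟩ := hxQ _ isOpen_interior hx
  exact disjoint_left.1 (hT.disjoint P hP Q hQ hne) hy hy'

theorem countable : T.Countable := by
  have := LocallyFinite.countable_univ hT.locallyFinite fun P => hT.nonempty P.2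
  exact countable_coe_iff.1 (countable_univ_iff.1 this)

theorem exists_cell (x : E d) : ∃ P ∈ T, x ∈ P := by
  have : x ∈ ⋃₀ T := by rw [hT.cover]; trivial
  exact this

theorem eventually_cells (x : E d) : ∀ᶠ y in 𝓝 x, ∀ P ∈ T, y ∈ P → x ∈ P := by
  filter_upwards [LocallyFinite.eventually_subset hT.locallyFinite (fun P => hT.isClosed P.2) x]
    with y hy P hP hyP
  exact hy (a := ⟨P, hP⟩) hyP

theorem finite_cells {K : Set (E d)} (hK : IsCompact K) : {P | P ∈ T ∧ (P ∩ K).Nonempty}.Finite := by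
  have := LocallyFinite.finite_nonempty_inter_compact hT.locallyFinite hK
  refine (this.image (Subtype.val)).subset ?_
  rintro P ⟨hP, hPK⟩
  exact ⟨⟨P, hP⟩, hPK, rfl⟩

theorem face_of_subset {P Q K : Set (E d)} (hP : P ∈ T) (hQ : Q ∈ T) (hK : IsFace P K)
    (hKQ : K ⊆ Q) : IsFace Q K := by
  by_cases hPQ : P = Q
  · rwa [← hPQ]
  obtain ⟨x, hx⟩ := hK.1
  obtain ⟨-, h2⟩ := hT.faceToFace P hP Q hQ hPQ ⟨x, hK.subset hx, hKQ hx⟩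
  exact h2.trans (hT.polytope Q hQ) (hK.restrict (subset_inter hK.subset hKQ) inter_subset_left)

/-- `P ∩ Q` is a face of `P` through a relative interior point of `K`. Which cells contain a face
can thus be tested at a single point. -/
theorem subset_of_relInt {P Q K : Set (E d)} (hP : P ∈ T) (hQ : Q ∈ T) (hK : IsFace P K) {x : E d}
    (hx : RelInt K x) (hxQ : x ∈ Q) : K ⊆ Q := by
  by_cases hPQ : P = Q
  · rw [← hPQ]; exact hK.subset
  obtain ⟨h1, -⟩ := hT.faceToFace P hP Q hQ hPQ ⟨x, hK.subset hx.mem, hxQ⟩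
  exact (hx.subset_face hK.subset h1 ⟨hK.subset hx.mem, hxQ⟩).trans inter_subset_right

end IsTiling

/-- All nonempty faces of the cells of a tiling. -/
def faces (T : Set (Set (E d))) : Set (Set (E d)) := {K | ∃ P ∈ T, IsFace P K}

theorem IsTiling.countable_faces (hT : IsTiling T) : (faces T).Countable := by
  have : faces T = ⋃ P ∈ T, {K | IsFace P K} := by
    ext K; simp [faces]
  rw [this]
  exact hT.countable.biUnion fun P hP => (hT.polytope P hP).finite_faces.countable

theorem IsTiling.finite_faces (hT : IsTiling T) {C : Set (E d)} (hC : IsCompact C) :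
    {K | K ∈ faces T ∧ (K ∩ C).Nonempty}.Finite := by
  refine ((hT.finite_cells hC).biUnion fun P hP => (hT.polytope P hP.1).finite_faces).subset ?_
  rintro K ⟨⟨P, hP, hK⟩, hKC⟩
  simp only [mem_iUnion]
  exact ⟨P, ⟨hP, hKC.mono (inter_subset_inter_left _ hK.subset)⟩, hK⟩

theorem IsTiling.isPolytope_face (hT : IsTiling T) {K : Set (E d)} (hK : K ∈ faces T) :
    IsPolytope K := by
  obtain ⟨P, hP, hK⟩ := hK
  exact hK.isPolytope (hT.polytope P hP)

theorem facets_subset_faces {F : Set (E d)} (hF : F ∈ facets T) : F ∈ faces T := by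
  obtain ⟨P, hP, hF, -⟩ := hF
  exact ⟨P, hP, hF⟩

theorem dim_of_mem_facets {F : Set (E d)} (hF : F ∈ facets T) : dim F + 1 = d := by
  obtain ⟨P, hP, hF, h⟩ := hF
  exact h

theorem ridges_subset_faces {F : Set (E d)} (hF : F ∈ ridges T) : F ∈ faces T := by
  obtain ⟨P, hP, hF, -⟩ := hF
  exact ⟨P, hP, hF⟩

theorem nonempty_of_mem_faces {K : Set (E d)} (hK : K ∈ faces T) : K.Nonempty := by
  obtain ⟨P, hP, hK⟩ := hK
  exact hK.1

/-! ### Normals of hyperfaces -/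

/-- `ν` is a unit normal vector of `F`. -/
def IsFacetNormal (F : Set (E d)) (ν : E d) : Prop :=
  ‖ν‖ = 1 ∧ ∀ v ∈ vectorSpan ℝ F, inner ℝ ν v = 0

theorem IsFacetNormal.ne_zero {F : Set (E d)} {ν : E d} (h : IsFacetNormal F ν) : ν ≠ 0 := by
  rintro rfl
  simpa using h.1

theorem IsFacetNormal.inner_self {F : Set (E d)} {ν : E d} (h : IsFacetNormal F ν) :
    inner ℝ ν ν = 1 := by
  rw [real_inner_self_eq_norm_sq, h.1]; norm_num

theorem IsFacetNormal.neg {F : Set (E d)} {ν : E d} (h : IsFacetNormal F ν) :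
    IsFacetNormal F (-ν) :=
  ⟨by rw [norm_neg, h.1], fun v hv => by rw [inner_neg_left, h.2 v hv, neg_zero]⟩

theorem IsFacetNormal.inner_eq {F : Set (E d)} {ν x y : E d} (h : IsFacetNormal F ν) (hx : x ∈ F)
    (hy : y ∈ F) : inner ℝ ν x = inner ℝ ν y := by
  have := h.2 _ (vsub_mem_vectorSpan ℝ hx hy)
  rw [vsub_eq_sub, inner_sub_right] at this
  linarith

theorem exists_isFacetNormal {F : Set (E d)} (hF : dim F + 1 = d) : ∃ ν, IsFacetNormal F ν := by
  have hne : (vectorSpan ℝ F)ᗮ ≠ ⊥ := by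
    intro h
    rw [Submodule.orthogonal_eq_bot_iff] at h
    rw [dim, h, finrank_top, finrank_euclideanSpace_fin] at hF
    omega
  obtain ⟨a, ha, ha0⟩ := Submodule.exists_mem_ne_zero_of_ne_bot hne
  refine ⟨(‖a‖⁻¹ : ℝ) • a, ?_, fun v hv => ?_⟩
  · rw [norm_smul, norm_inv, norm_norm, inv_mul_cancel₀ (norm_ne_zero_iff.2 ha0)]
  · rw [real_inner_smul_left, Submodule.inner_left_of_mem_orthogonal hv ha, mul_zero]

theorem IsFacetNormal.mem_vectorSpan {F : Set (E d)} {ν : E d} (h : IsFacetNormal F ν)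
    (hF : dim F + 1 = d) {v : E d} (hv : inner ℝ ν v = 0) : v ∈ vectorSpan ℝ F := by
  have : Fact (Module.finrank ℝ (E d) = Module.finrank ℝ (vectorSpan ℝ F) + 1) :=
    ⟨by rw [finrank_euclideanSpace_fin]; exact hF.symm⟩
  have h1 : vectorSpan ℝ F ≤ (ℝ ∙ ν)ᗮ := fun w hw => by
    rw [Submodule.mem_orthogonal_singleton_iff_inner_right]
    exact h.2 w hw
  rw [Submodule.eq_of_le_of_finrank_le h1
    (le_of_eq (Submodule.finrank_orthogonal_span_singleton h.ne_zero)),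
    Submodule.mem_orthogonal_singleton_iff_inner_right]
  exact hv

theorem IsFacetNormal.eq_smul {F : Set (E d)} {ν : E d} (h : IsFacetNormal F ν)
    (hF : dim F + 1 = d) {a : E d} (ha : ∀ v ∈ vectorSpan ℝ F, inner ℝ a v = 0) :
    a = inner ℝ ν a • ν := by
  have h0 : inner ℝ ν (a - inner ℝ ν a • ν) = 0 := by
    rw [inner_sub_right, inner_smul_right, h.inner_self, mul_one, sub_self]
  have h1 := h.mem_vectorSpan hF h0
  have h2 : inner ℝ (a - inner ℝ ν a • ν) (a - inner ℝ ν a • ν) = 0 := by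
    rw [inner_sub_left, ha _ h1, real_inner_smul_left, h0, mul_zero, sub_zero]
  exact sub_eq_zero.1 (inner_self_eq_zero.1 h2)

theorem IsFacetNormal.eq_or_eq_neg {F : Set (E d)} {ν n : E d} (h : IsFacetNormal F ν)
    (hF : dim F + 1 = d) (hn : IsFacetNormal F n) : n = ν ∨ n = -ν := by
  have h1 := h.eq_smul hF hn.2
  have h2 : |inner ℝ ν n| = 1 := by
    have := hn.1
    rw [h1, norm_smul, h.1, mul_one] at this
    simpa using this
  rcases (abs_eq zero_le_one).1 h2 with h3 | h3
  · left; rw [h1, h3, one_smul]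
  · right; rw [h1, h3, neg_one_smul]

/-- The set `P` lies on the side of `F` into which `ν` points. -/
def OnSide (F : Set (E d)) (ν : E d) (P : Set (E d)) : Prop :=
  ∀ f ∈ F, ∀ x ∈ P, inner ℝ ν f ≤ inner ℝ ν x

/-! ### The two cells at a hyperface -/

namespace IsTiling

variable (hT : IsTiling T)
include hT

/-- A functional exposing `F` is orthogonal to `F`, hence a multiple of `ν`. The multiple is
nonzero, since otherwise `F` would be the whole cell `P`, which has dimension `d`. -/
theorem facet_normal_form {P F : Set (E d)} {ν : E d} (hP : P ∈ T) (hF : IsFace P F)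
    (hdim : dim F + 1 = d) (hν : IsFacetNormal F ν) :
    (OnSide F ν P ∨ OnSide F (-ν) P) ∧ ∀ f ∈ F, ∀ x ∈ P, inner ℝ ν x = inner ℝ ν f → x ∈ F := by
  obtain ⟨a, c, hle, heq⟩ := hF.exists_inner
  have hFc : ∀ x ∈ F, inner ℝ a x = c := fun x hx => by rw [heq] at hx; exact hx.2
  have ha := hν.eq_smul hdim fun v hv => inner_eq_zero_of_mem_vectorSpan hFc hv
  set κ := inner ℝ ν a
  have hax : ∀ x, inner ℝ a x = κ * inner ℝ ν x := fun x => by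
    rw [ha, real_inner_smul_left]
  have hκ : κ ≠ 0 := by
    intro h0
    have hFP : F = P := by
      rw [heq]
      obtain ⟨f, hf⟩ := hF.1
      have := hFc f hf
      ext x
      refine ⟨fun h => h.1, fun h => ⟨h, ?_⟩⟩
      rw [hax, h0, zero_mul] at this ⊢
      exact this
    rw [hFP, hT.dim_eq hP] at hdim
    omega
  refine ⟨?_, fun f hf x hx h => ?_⟩
  · rcases lt_or_gt_of_ne hκ with h | h
    · left
      intro f hf x hx
      have h1 := hle x hx
      rw [← hFc f hf, hax, hax] at h1
      exact (mul_le_mul_left_of_neg h).1 h1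
    · right
      intro f hf x hx
      have h1 := hle x hx
      rw [← hFc f hf, hax, hax] at h1
      rw [inner_neg_left, inner_neg_left, neg_le_neg_iff]
      exact le_of_mul_le_mul_left h1 h
  · rw [heq]
    refine ⟨hx, ?_⟩
    rw [hax, h, ← hax, hFc f hf]

theorem face_facet {F P : Set (E d)} (hF : F ∈ facets T) (hP : P ∈ T) (h : F ⊆ P) : IsFace P F := by
  obtain ⟨Q, hQ, hFQ, -⟩ := hF
  exact hT.face_of_subset hQ hP hFQ h

/-- From a relative interior point `r` of `F`, the direction to an interior point `p` of `P` is a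
positive multiple of a direction into `Q` plus a vector along `F`. Short pieces of the ray towards
`p` thus lie both in the interior of `P` and in `Q`. -/
theorem side_unique {F P Q : Set (E d)} {ν : E d} (hF : F ∈ facets T) (hν : IsFacetNormal F ν)
    (hP : P ∈ T) (hQ : Q ∈ T) (hFP : F ⊆ P) (hFQ : F ⊆ Q) (hPs : OnSide F ν P)
    (hQs : OnSide F ν Q) : P = Q := by
  obtain ⟨r, hr⟩ := exists_relInt (hT.isPolytope_face (facets_subset_faces hF)).convex
    (nonempty_of_mem_faces (facets_subset_faces hF))
  obtain ⟨p, hp⟩ := hT.fullDim P hP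
  obtain ⟨q, hq⟩ := hT.fullDim Q hQ
  have hpr := inner_lt_of_mem_interior hν.ne_zero (hPs r hr.mem) hp
  have hqr := inner_lt_of_mem_interior hν.ne_zero (hQs r hr.mem) hq
  have hqr' : 0 < inner ℝ ν (q - r) := by rw [inner_sub_right]; linarith
  have hpr' : 0 < inner ℝ ν (p - r) := by rw [inner_sub_right]; linarith
  set c := inner ℝ ν (p - r) / inner ℝ ν (q - r) with hc
  have hw : (p - r) - c • (q - r) ∈ vectorSpan ℝ F := by
    refine hν.mem_vectorSpan (dim_of_mem_facets hF) ?_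
    rw [inner_sub_right, inner_smul_right, hc, div_mul_cancel₀ _ hqr'.ne', sub_self]
  have hev := hr.eventually_mem_of_convex (hT.convex hQ) hFQ (interior_subset hq) hw
    (c := c) (by positivity)
  have h1 : ∀ᶠ t in 𝓝[>] (0 : ℝ), t ∈ Ioc (0 : ℝ) 1 := Ioc_mem_nhdsGT one_pos
  obtain ⟨t, ht, ht1⟩ := (hev.and h1).exists
  rw [add_sub_cancel] at ht
  exact hT.eq_of_mem_interior hP hQ
    ((hT.convex hP).add_smul_sub_mem_interior (hFP hr.mem) hp ht1) ht

/-- Push a relative interior point `r` of `F` slightly along `ν`. By local finiteness, a cell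
containing the result also contains `r`, and hence `F`. -/
theorem exists_side {F : Set (E d)} {ν : E d} (hF : F ∈ facets T) (hν : IsFacetNormal F ν) :
    ∃ Q ∈ T, F ⊆ Q ∧ OnSide F ν Q := by
  obtain ⟨r, hr⟩ := exists_relInt (hT.isPolytope_face (facets_subset_faces hF)).convex
    (nonempty_of_mem_faces (facets_subset_faces hF))
  have h1 : Tendsto (fun t : ℝ => r + t • ν) (𝓝[>] 0) (𝓝 r) := by
    have : Continuous (fun t : ℝ => r + t • ν) := by fun_prop
    have := (this.tendsto 0).mono_left (nhdsWithin_le_nhds (s := Ioi (0 : ℝ)))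
    simpa using this
  obtain ⟨t, ht, ht0⟩ := ((h1.eventually (hT.eventually_cells r)).and self_mem_nhdsWithin).exists
  have ht0 : 0 < t := ht0
  obtain ⟨Q, hQ, hrQ⟩ := hT.exists_cell (r + t • ν)
  obtain ⟨P, hP, hFP, hdim⟩ := id hF
  have hFQ := hT.subset_of_relInt hP hQ hFP hr (ht Q hQ hrQ)
  refine ⟨Q, hQ, hFQ, ?_⟩
  rcases (hT.facet_normal_form hQ (hT.face_facet hF hQ hFQ) hdim hν).1 with h | h
  · exact h
  · have := h r hr.mem _ hrQ
    rw [inner_add_right, inner_smul_right, inner_neg_left, inner_neg_left, hν.inner_self] at this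
    linarith

end IsTiling

/-- The cell that contains the hyperface `F` and lies on the side into which `ν` points. -/
noncomputable def side (T : Set (Set (E d))) (F : Set (E d)) (ν : E d) : Set (E d) :=
  Classical.epsilon fun Q => Q ∈ T ∧ F ⊆ Q ∧ OnSide F ν Q

namespace IsTiling

variable (hT : IsTiling T)
include hT

theorem side_spec {F : Set (E d)} {ν : E d} (hF : F ∈ facets T) (hν : IsFacetNormal F ν) :
    side T F ν ∈ T ∧ F ⊆ side T F ν ∧ OnSide F ν (side T F ν) :=
  Classical.epsilon_spec (p := fun Q => Q ∈ T ∧ F ⊆ Q ∧ OnSide F ν Q) (hT.exists_side hF hν)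

theorem eq_side {F P : Set (E d)} {ν : E d} (hF : F ∈ facets T) (hν : IsFacetNormal F ν)
    (hP : P ∈ T) (hFP : F ⊆ P) (h : OnSide F ν P) : P = side T F ν :=
  let ⟨h1, h2, h3⟩ := hT.side_spec hF hν
  hT.side_unique hF hν hP h1 hFP h2 h h3

theorem eq_side_or {F P : Set (E d)} {ν : E d} (hF : F ∈ facets T) (hν : IsFacetNormal F ν)
    (hP : P ∈ T) (hFP : F ⊆ P) : P = side T F ν ∨ P = side T F (-ν) := by
  rcases (hT.facet_normal_form hP (hT.face_facet hF hP hFP) (dim_of_mem_facets hF) hν).1 with h | h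
  · exact Or.inl (hT.eq_side hF hν hP hFP h)
  · exact Or.inr (hT.eq_side hF hν.neg hP hFP h)

theorem not_onSide_both {F P : Set (E d)} {ν : E d} (hF : F.Nonempty) (hν : IsFacetNormal F ν)
    (hP : P ∈ T) (h : OnSide F ν P) (h' : OnSide F (-ν) P) : False := by
  obtain ⟨f, hf⟩ := hF
  obtain ⟨p, hp⟩ := hT.fullDim P hP
  have h1 := inner_lt_of_mem_interior hν.ne_zero (h f hf) hp
  have h2 := h' f hf p (interior_subset hp)
  rw [inner_neg_left, inner_neg_left] at h2
  linarith

theorem side_inter {F : Set (E d)} {ν : E d} (hF : F ∈ facets T) (hν : IsFacetNormal F ν) :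
    side T F (-ν) ∩ side T F ν = F := by
  obtain ⟨h1, h2, h3⟩ := hT.side_spec hF hν
  obtain ⟨h1', h2', h3'⟩ := hT.side_spec hF hν.neg
  obtain ⟨f, hf⟩ := nonempty_of_mem_faces (facets_subset_faces hF)
  refine subset_antisymm (fun x hx => ?_) (subset_inter h2' h2)
  refine (hT.facet_normal_form h1 (hT.face_facet hF h1 h2) (dim_of_mem_facets hF) hν).2 f hf x hx.2
    (le_antisymm ?_ (h3 f hf x hx.2))
  have := h3' f hf x hx.1
  rw [inner_neg_left, inner_neg_left] at this
  linarith

theorem side_ne {F : Set (E d)} {ν : E d} (hF : F ∈ facets T) (hν : IsFacetNormal F ν) :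
    side T F (-ν) ≠ side T F ν := by
  intro h
  obtain ⟨h1, h2, h3⟩ := hT.side_spec hF hν
  obtain ⟨h1', h2', h3'⟩ := hT.side_spec hF hν.neg
  exact hT.not_onSide_both (nonempty_of_mem_faces (facets_subset_faces hF)) hν h1 h3 (h ▸ h3')

theorem adjacent_side {F : Set (E d)} {ν : E d} (hF : F ∈ facets T) (hν : IsFacetNormal F ν) :
    Adjacent T (side T F (-ν)) (side T F ν) := by
  refine ⟨(hT.side_spec hF hν.neg).1, (hT.side_spec hF hν).1, hT.side_ne hF hν, ?_, ?_⟩ <;>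
    rw [hT.side_inter hF hν]
  · exact nonempty_of_mem_faces (facets_subset_faces hF)
  · exact dim_of_mem_facets hF

theorem inter_mem_facets {P Q : Set (E d)} (h : Adjacent T P Q) : P ∩ Q ∈ facets T :=
  ⟨P, h.1, (hT.faceToFace P h.1 Q h.2.1 h.2.2.1 h.2.2.2.1).1, h.2.2.2.2⟩

omit hT in
theorem _root_.Gen.Adjacent.symm {P Q : Set (E d)} (h : Adjacent T P Q) : Adjacent T Q P := by
  obtain ⟨h1, h2, h3, h4, h5⟩ := h
  rw [inter_comm] at h4 h5
  exact ⟨h2, h1, h3.symm, h4, h5⟩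

theorem exists_normal_of_adjacent {P Q : Set (E d)} (h : Adjacent T P Q) :
    ∃ ν, IsFacetNormal (P ∩ Q) ν ∧ P = side T (P ∩ Q) (-ν) ∧ Q = side T (P ∩ Q) ν := by
  have hF := hT.inter_mem_facets h
  obtain ⟨ν, hν⟩ := exists_isFacetNormal h.2.2.2.2
  rcases hT.eq_side_or hF hν h.1 inter_subset_left with h1 | h1 <;>
  rcases hT.eq_side_or hF hν h.2.1 inter_subset_right with h2 | h2
  · exact absurd (h1.trans h2.symm) h.2.2.1
  · exact ⟨-ν, hν.neg, by rwa [neg_neg], h2⟩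
  · exact ⟨ν, hν, h1, h2⟩
  · exact absurd (h1.trans h2.symm) h.2.2.1

/-- The normal is defined by a choice. The choice is forced, because a hyperface has only the unit
normals `ν` and `-ν`, and a cell cannot lie on both sides. -/
theorem unitNormal_eq {P Q : Set (E d)} {ν : E d} (h : Adjacent T P Q)
    (hν : IsFacetNormal (P ∩ Q) ν) (hQ : OnSide (P ∩ Q) ν Q) : unitNormal P Q = ν := by
  have hF := hT.inter_mem_facets h
  have hQ' := hT.eq_side hF hν h.2.1 inter_subset_right hQ
  have hP' : P = side T (P ∩ Q) (-ν) := by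
    rcases hT.eq_side_or hF hν h.1 inter_subset_left with h1 | h1
    · exact absurd (h1.trans hQ'.symm) h.2.2.1
    · exact h1
  have hPs : OnSide (P ∩ Q) (-ν) P := by
    have := (hT.side_spec hF hν.neg).2.2
    rwa [← hP'] at this
  obtain ⟨f, hf⟩ := h.2.2.2.1
  have hex : IsUnitNormal P Q ν := by
    refine ⟨hν.1, fun x hx y hy => hν.2 _ (vsub_mem_vectorSpan ℝ hx hy), fun x hx y hy => ?_⟩
    have h1 := hPs f hf x hx
    rw [inner_neg_left, inner_neg_left] at h1
    linarith [hQ f hf y hy]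
  have hsp : IsUnitNormal P Q (unitNormal P Q) := Classical.epsilon_spec ⟨ν, hex⟩
  have hn : IsFacetNormal (P ∩ Q) (unitNormal P Q) := by
    refine ⟨hsp.1, fun v hv => ?_⟩
    refine inner_eq_zero_of_mem_vectorSpan (c := inner ℝ (unitNormal P Q) f) (fun x hx => ?_) hv
    have := hsp.2.1 x hx f hf
    rw [inner_sub_right] at this
    linarith
  rcases hν.eq_or_eq_neg h.2.2.2.2 hn with h1 | h1
  · exact h1
  · exfalso
    refine hT.not_onSide_both h.2.2.2.1 hν h.2.1 hQ ?_
    rw [← h1]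
    exact fun f hf x hx => hsp.2.2 f hf.1 x hx

theorem unitNormal_spec {P Q : Set (E d)} (h : Adjacent T P Q) :
    IsFacetNormal (P ∩ Q) (unitNormal P Q) ∧ OnSide (P ∩ Q) (unitNormal P Q) Q ∧
      OnSide (P ∩ Q) (-unitNormal P Q) P := by
  obtain ⟨ν, hν, hP, hQ⟩ := hT.exists_normal_of_adjacent h
  have hF := hT.inter_mem_facets h
  have h1 := (hT.side_spec hF hν).2.2
  rw [← hQ] at h1
  have h2 := (hT.side_spec hF hν.neg).2.2
  rw [← hP] at h2
  rw [hT.unitNormal_eq h hν h1]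
  exact ⟨hν, h1, h2⟩

theorem unitNormal_side {F : Set (E d)} {ν : E d} (hF : F ∈ facets T) (hν : IsFacetNormal F ν) :
    unitNormal (side T F (-ν)) (side T F ν) = ν := by
  have h := hT.side_inter hF hν
  refine hT.unitNormal_eq (hT.adjacent_side hF hν) ?_ ?_ <;> rw [h]
  · exact hν
  · exact (hT.side_spec hF hν).2.2

theorem inner_unitNormal_pos {P Q : Set (E d)} (h : Adjacent T P Q) {x q : E d} (hx : x ∈ P ∩ Q)
    (hq : q ∈ interior Q) : 0 < inner ℝ (unitNormal P Q) (q - x) := by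
  obtain ⟨h1, h2, -⟩ := hT.unitNormal_spec h
  have := inner_lt_of_mem_interior h1.ne_zero (h2 x hx) hq
  rw [inner_sub_right]
  linarith

end IsTiling

/-! ### Generic points and segments -/

/-- Proper affine subspaces have measure zero, nonempty open sets do not. All general position
arguments rest on this. -/
theorem exists_mem_avoiding {S : Set (AffineSubspace ℝ (E d))} (hS : S.Countable)
    (hne : ∀ A ∈ S, A ≠ ⊤) {U : Set (E d)} (hU : IsOpen U) (hU' : U.Nonempty) :
    ∃ x ∈ U, ∀ A ∈ S, x ∉ A := by
  by_contra hcon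
  push Not at hcon
  have h0 : MeasureTheory.volume (⋃ A ∈ S, (A : Set (E d))) = 0 := by
    rw [MeasureTheory.measure_biUnion_null_iff hS]
    exact fun A hA => MeasureTheory.Measure.addHaar_affineSubspace _ A (hne A hA)
  have h1 : U ⊆ ⋃ A ∈ S, (A : Set (E d)) := fun x hx => by
    obtain ⟨A, hA, hxA⟩ := hcon x hx
    exact mem_biUnion hA hxA
  exact (hU.measure_pos MeasureTheory.volume hU').ne' (MeasureTheory.measure_mono_null h1 h0)

theorem affineSpan_ne_top {A : Set (E d)} (h : dim A + 1 ≤ d) : affineSpan ℝ A ≠ ⊤ := by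
  intro h'
  have h2 := AffineSubspace.vectorSpan_eq_top_of_affineSpan_eq_top ℝ (E d) (E d) h'
  rw [dim, h2, finrank_top, finrank_euclideanSpace_fin] at h
  omega

theorem dim_insert_le (x : E d) (A : Set (E d)) : dim (insert x A) ≤ dim A + 1 :=
  finrank_vectorSpan_insert_le_set ℝ A x

/-- The segment from `y` to `z` avoids all faces of codimension at least two. -/
def SegGeneric (T : Set (Set (E d))) (y z : E d) : Prop :=
  ∀ K ∈ faces T, dim K + 2 ≤ d → ∀ t ∈ Icc (0 : ℝ) 1, y + t • (z - y) ∉ K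

theorem mem_affineSpan_insert_of_segment {y z : E d} {K : Set (E d)} (hy : y ∉ K) {t : ℝ}
    (h : y + t • (z - y) ∈ K) : z ∈ affineSpan ℝ (insert y K) := by
  have ht : t ≠ 0 := by
    rintro rfl
    simp at h
    exact hy h
  have h1 : y ∈ affineSpan ℝ (insert y K) := subset_affineSpan ℝ _ (mem_insert _ _)
  have h2 : y + t • (z - y) ∈ affineSpan ℝ (insert y K) :=
    subset_affineSpan ℝ _ (mem_insert_of_mem _ h)
  have h3 := AffineMap.lineMap_mem t⁻¹ h1 h2
  rw [AffineMap.lineMap_apply_module'] at h3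
  simpa [smul_smul, inv_mul_cancel₀ ht] using h3

theorem relInt_of_mem_interior {P : Set (E d)} {x : E d} (hx : x ∈ interior P) : RelInt P x := by
  have : Tendsto (fun v : vectorSpan ℝ P => x + (v : E d)) (𝓝 0) (𝓝 x) := by
    have h : Continuous (fun v : vectorSpan ℝ P => x + (v : E d)) := by fun_prop
    simpa using h.tendsto 0
  exact this.eventually (mem_interior_iff_mem_nhds.1 hx)

theorem IsTiling.notMem_of_mem_interior (hT : IsTiling T) {P K : Set (E d)} (hP : P ∈ T)
    (hK : K ∈ faces T) (hdim : dim K + 1 ≤ d) {x : E d} (hx : x ∈ interior P) : x ∉ K := by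
  intro hxK
  obtain ⟨Q, hQ, hKQ⟩ := hK
  obtain rfl := hT.eq_of_mem_interior hP hQ hx (hKQ.subset hxK)
  have h1 := (relInt_of_mem_interior hx).subset_face subset_rfl hKQ hxK
  have h2 := dim_mono h1
  rw [hT.dim_eq hP] at h2
  omega

/-- The endpoints `z` whose segment from `y` hits a face `K` of codimension at least two lie in the
affine hull of `K` and `y`, which is still proper. -/
theorem IsTiling.exists_segGeneric (hT : IsTiling T) {P : Set (E d)} (hP : P ∈ T) {y : E d}
    (hy : y ∈ interior P) {U : Set (E d)} (hU : IsOpen U) (hU' : U.Nonempty) :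
    ∃ z ∈ U, SegGeneric T y z := by
  obtain ⟨z, hz, hz'⟩ := exists_mem_avoiding
    (S := (fun K => affineSpan ℝ (insert y K)) '' {K | K ∈ faces T ∧ dim K + 2 ≤ d})
    ((hT.countable_faces.mono (fun K hK => hK.1)).image _)
    (by
      rintro _ ⟨K, hK, rfl⟩
      refine affineSpan_ne_top ?_
      have := dim_insert_le y K
      have := hK.2
      omega) hU hU'
  refine ⟨z, hz, fun K hK hdim t _ h => ?_⟩
  refine hz' _ ⟨K, ⟨hK, hdim⟩, rfl⟩ (mem_affineSpan_insert_of_segment ?_ h)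
  exact hT.notMem_of_mem_interior hP hK (by omega) hy

/-- The common face is proper, and the point `x` rules out codimension two or more. -/
theorem IsTiling.adjacent_of_mem (hT : IsTiling T) {P Q : Set (E d)} (hP : P ∈ T) (hQ : Q ∈ T)
    (hne : P ≠ Q) {x : E d} (hxP : x ∈ P) (hxQ : x ∈ Q)
    (hx : ∀ K ∈ faces T, dim K + 2 ≤ d → x ∉ K) : Adjacent T P Q := by
  refine ⟨hP, hQ, hne, ⟨x, hxP, hxQ⟩, ?_⟩
  obtain ⟨h1, h2⟩ := hT.faceToFace P hP Q hQ hne ⟨x, hxP, hxQ⟩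
  have h3 : ¬ (dim (P ∩ Q) + 2 ≤ d) := fun h => hx _ ⟨P, hP, h1⟩ h ⟨hxP, hxQ⟩
  have h4 : P ∩ Q ≠ P := by
    intro h
    obtain ⟨p, hp⟩ := hT.fullDim P hP
    exact hne (hT.eq_of_mem_interior hP hQ hp (inter_eq_left.1 h (interior_subset hp)))
  have h5 := h1.dim_lt h4
  rw [hT.dim_eq hP] at h5
  omega

/-- Propagation of a property from cell to cell along a generic segment. -/
theorem IsTiling.segment_induction (hT : IsTiling T) {P : Set (E d)} (hP : P ∈ T) {y z : E d}
    (hy : y ∈ interior P) (hgen : SegGeneric T y z) (C : Set (E d) → ℝ → Prop) (h0 : C P 0)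
    (hmono : ∀ Q t t', t ≤ t' → C Q t → C Q t')
    (hstep : ∀ Q Q' t t', 0 ≤ t' → t' < t → t ≤ 1 → C Q t → Adjacent T Q Q' →
      y + t' • (z - y) ∈ Q → y + t • (z - y) ∈ Q → y + t • (z - y) ∈ Q' → C Q' t) :
    ∀ t ∈ Icc (0 : ℝ) 1, ∀ Q ∈ T, y + t • (z - y) ∈ Q → C Q t := by
  set S : Set ℝ := {t | ∀ t' ∈ Icc 0 t, ∀ Q ∈ T, y + t' • (z - y) ∈ Q → C Q t'} with hS
  have hcells : ∀ t : ℝ, ∃ ε > 0, ∀ t', |t' - t| < ε → ∀ Q ∈ T, y + t' • (z - y) ∈ Q →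
      y + t • (z - y) ∈ Q := by
    intro t
    have hc : Continuous fun t : ℝ => y + t • (z - y) := by fun_prop
    obtain ⟨ε, hε, h⟩ := Metric.eventually_nhds_iff.1
      ((hc.tendsto t).eventually (hT.eventually_cells _))
    exact ⟨ε, hε, fun t' ht' => h (by rwa [Real.dist_eq])⟩
  have hbase : ∀ Q ∈ T, y + (0 : ℝ) • (z - y) ∈ Q → C Q 0 := by
    intro Q hQ hyQ
    rw [zero_smul, add_zero] at hyQ
    rwa [← hT.eq_of_mem_interior hP hQ hy hyQ]
  -- Continuous induction on the time. For closedness, a cell met at a limit time is either a cell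
  -- met just before or adjacent to one, and `hstep` applies. To the right of a time in `S`, the
  -- cells met are for a while among those containing the current point, and `hmono` applies.
  have key : Icc (0 : ℝ) 1 ⊆ S := by
    apply IsClosed.Icc_subset_of_forall_mem_nhdsWithin
    · refine isClosed_of_closure_subset fun t₀ ht₀ => ?_
      have htI : t₀ ∈ Icc (0 : ℝ) 1 :=
        closure_minimal inter_subset_right isClosed_Icc ht₀
      refine ⟨fun t' ht' Q hQ hQt => ?_, htI⟩
      rcases ht'.2.lt_or_eq with hlt | rfl
      · obtain ⟨t'', h1, h2⟩ := mem_closure_iff.1 ht₀ (Ioi t') isOpen_Ioi hlt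
        exact h2.1 t' ⟨ht'.1, (mem_Ioi.1 h1).le⟩ Q hQ hQt
      · rcases ht'.1.eq_or_lt with h | hpos
        · rw [← h] at hQt ⊢
          exact hbase Q hQ hQt
        obtain ⟨ε, hε, hc⟩ := hcells t'
        obtain ⟨t'', h1, h2⟩ := Metric.mem_closure_iff.1 ht₀ ε hε
        rcases le_or_gt t' t'' with h3 | h3
        · exact h1.1 t' ⟨ht'.1, h3⟩ Q hQ hQt
        obtain ⟨Q'', hQ'', hm⟩ := hT.exists_cell (y + t'' • (z - y))
        have hm' := hc t'' (by rwa [Real.dist_eq, abs_sub_comm] at h2) Q'' hQ'' hm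
        have hC := hmono _ _ _ h3.le (h1.1 t'' ⟨h1.2.1, le_rfl⟩ Q'' hQ'' hm)
        by_cases hne : Q'' = Q
        · rwa [← hne]
        · exact hstep Q'' Q t' t'' h1.2.1 h3 htI.2 hC
            (hT.adjacent_of_mem hQ'' hQ hne hm' hQt fun K hK hd => hgen K hK hd t' htI) hm hm' hQt
    · intro t' ht' Q hQ hQt
      obtain rfl : t' = 0 := le_antisymm ht'.2 ht'.1
      exact hbase Q hQ hQt
    · rintro t₀ ⟨ht₀, htI⟩
      obtain ⟨ε, hε, hc⟩ := hcells t₀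
      have : Ioo t₀ (t₀ + ε) ∈ 𝓝[>] t₀ := Ioo_mem_nhdsGT (by linarith)
      filter_upwards [this] with t ht t' ht' Q hQ hQt
      rcases le_or_gt t' t₀ with h | h
      · exact ht₀ t' ⟨ht'.1, h⟩ Q hQ hQt
      · refine hmono _ _ _ h.le (ht₀ t₀ ⟨htI.1, le_rfl⟩ Q hQ (hc t' ?_ Q hQ hQt))
        rw [abs_of_pos (by linarith)]
        linarith [ht'.2, ht.2]
  exact fun t ht Q hQ h => key ht t ⟨ht.1, le_rfl⟩ Q hQ h

/-- Cells that meet an open convex set are joined by chains of adjacent cells that meet it. -/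
theorem IsTiling.exists_chain (hT : IsTiling T) {U : Set (E d)} (hU : IsOpen U) (hUc : Convex ℝ U)
    {P Q : Set (E d)} (hP : P ∈ T) (hQ : Q ∈ T) (hPU : (P ∩ U).Nonempty) (hQU : (Q ∩ U).Nonempty) :
    Relation.ReflTransGen
      (fun A B => Adjacent T A B ∧ (A ∩ U).Nonempty ∧ (B ∩ U).Nonempty) P Q := by
  have hint : ∀ P ∈ T, (P ∩ U).Nonempty → (interior P ∩ U).Nonempty := by
    rintro P hP ⟨x, hx, hxU⟩
    rw [← hT.closure_interior hP, mem_closure_iff] at hx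
    obtain ⟨y, hy, hy'⟩ := hx U hU hxU
    exact ⟨y, hy', hy⟩
  obtain ⟨y, hy, hyU⟩ := hint P hP hPU
  obtain ⟨z, ⟨hz, hzU⟩, hgen⟩ := hT.exists_segGeneric hP hy (isOpen_interior.inter hU)
    (hint Q hQ hQU)
  have hseg : ∀ t ∈ Icc (0 : ℝ) 1, y + t • (z - y) ∈ U := fun t ht =>
    hUc.add_smul_sub_mem hyU hzU ht
  refine hT.segment_induction hP hy hgen (fun A _ => Relation.ReflTransGen
      (fun A B => Adjacent T A B ∧ (A ∩ U).Nonempty ∧ (B ∩ U).Nonempty) P A) .refl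
      (fun _ _ _ _ h => h) ?_ 1 ⟨zero_le_one, le_rfl⟩ Q hQ ?_
  · intro A B t t' h0 h1 h2 hC hadj _ hA hB
    have := hseg t ⟨by linarith, h2⟩
    exact hC.tail ⟨hadj, ⟨_, hA, this⟩, ⟨_, hB, this⟩⟩
  · simpa using interior_subset hz

theorem IsTiling.connected (hT : IsTiling T) {P Q : Set (E d)} (hP : P ∈ T) (hQ : Q ∈ T) :
    Relation.ReflTransGen (Adjacent T) P Q := by
  have h := hT.exists_chain isOpen_univ convex_univ hP hQ (by simpa using hT.nonempty hP)
    (by simpa using hT.nonempty hQ)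
  exact Relation.ReflTransGen.mono (fun _ _ h => h.1) _ _ h

/-- Inside a small ball around `x` only cells through `x` occur, so a chain of cells meeting the
ball stays in the star of `x`. -/
theorem IsTiling.star_connected (hT : IsTiling T) {P Q : Set (E d)} (hP : P ∈ T) (hQ : Q ∈ T)
    {x : E d} (hxP : x ∈ P) (hxQ : x ∈ Q) :
    Relation.ReflTransGen (fun A B => Adjacent T A B ∧ x ∈ A ∧ x ∈ B) P Q := by
  obtain ⟨ε, hε, h⟩ := Metric.eventually_nhds_iff_ball.1 (hT.eventually_cells x)
  have h1 := hT.exists_chain Metric.isOpen_ball (convex_ball x ε) hP hQ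
    ⟨x, hxP, Metric.mem_ball_self hε⟩ ⟨x, hxQ, Metric.mem_ball_self hε⟩
  refine Relation.ReflTransGen.mono ?_ _ _ h1
  rintro A B ⟨h2, ⟨a, ha, ha'⟩, ⟨b, hb, hb'⟩⟩
  exact ⟨h2, h a ha' A h2.1 ha, h b hb' B h2.2.1 hb⟩

/-- The star of a relative interior point of `K` consists of the cells that contain `K`. -/
theorem IsTiling.face_connected (hT : IsTiling T) {P Q K : Set (E d)} (hP : P ∈ T) (hQ : Q ∈ T)
    (hK : IsFace P K) (hKQ : K ⊆ Q) :
    Relation.ReflTransGen (fun A B => Adjacent T A B ∧ K ⊆ A ∧ K ⊆ B) P Q := by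
  obtain ⟨x, hx⟩ := exists_relInt (hK.isPolytope (hT.polytope P hP)).convex hK.1
  refine Relation.ReflTransGen.mono ?_ _ _ (hT.star_connected hP hQ (hK.subset hx.mem) (hKQ hx.mem))
  rintro A B ⟨h, hA, hB⟩
  exact ⟨h, hT.subset_of_relInt hP h.1 hK hx hA, hT.subset_of_relInt hP h.2.1 hK hx hB⟩

/-! ### Geometry around a face of codimension two -/

theorem dim_of_mem_ridges {R : Set (E d)} (hR : R ∈ ridges T) : dim R + 2 = d := by
  obtain ⟨P, hP, hF, h⟩ := hR
  exact h

/-- `K` is a quarter turn of the orthogonal complement of `W`, extended by zero on `W`. -/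
structure IsQuarterTurn (W : Submodule ℝ (E d)) (K : E d →ₗ[ℝ] E d) : Prop where
  map_mem : ∀ v ∈ W, K v = 0
  skew : ∀ v w, inner ℝ (K v) w = -inner ℝ (K w) v
  isometry : ∀ v ∈ Wᗮ, ∀ w ∈ Wᗮ, inner ℝ (K v) (K w) = inner ℝ v w

theorem IsQuarterTurn.inner_self {W : Submodule ℝ (E d)} {K : E d →ₗ[ℝ] E d}
    (h : IsQuarterTurn W K) (v : E d) : inner ℝ (K v) v = 0 := by
  have := h.skew v v
  linarith

theorem IsQuarterTurn.inner_mem {W : Submodule ℝ (E d)} {K : E d →ₗ[ℝ] E d}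
    (h : IsQuarterTurn W K) (v : E d) {w : E d} (hw : w ∈ W) : inner ℝ (K v) w = 0 := by
  rw [h.skew, h.map_mem w hw, inner_zero_left, neg_zero]

theorem IsQuarterTurn.neg {W : Submodule ℝ (E d)} {K : E d →ₗ[ℝ] E d}
    (h : IsQuarterTurn W K) : IsQuarterTurn W (-K) where
  map_mem v hv := by simp [h.map_mem v hv]
  skew v w := by simp [h.skew v w]
  isometry v hv w hw := by simp [h.isometry v hv w hw]

/-- Compose `J` with the orthogonal projection onto `Wᗮ`. Skewness comes from polarizing `⟨J w, w⟩ =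
0`. -/
theorem isQuarterTurn_of_isometry {W : Submodule ℝ (E d)} (J : Wᗮ →ₗᵢ[ℝ] Wᗮ)
    (hJ : ∀ w, inner ℝ (J w) w = 0) :
    ∃ K : E d →ₗ[ℝ] E d, IsQuarterTurn W K ∧ ∀ u : Wᗮ, K u = (J u : E d) := by
  have hskew : ∀ v w : Wᗮ, inner ℝ (J v) w = -inner ℝ (J w) v := by
    intro v w
    have h := hJ (v + w)
    rw [map_add, inner_add_left, inner_add_right, inner_add_right, hJ, hJ] at h
    linarith
  have hproj : ∀ (a : Wᗮ) (w : E d), inner ℝ (a : E d) w = inner ℝ a (Wᗮ.orthogonalProjectionOnto w) :=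
    fun a w => by
      rw [Submodule.coe_inner]
      exact (Submodule.inner_orthogonalProjectionOnto_eq_of_mem_left a w).symm
  refine ⟨Wᗮ.subtype ∘ₗ J.toLinearMap ∘ₗ (Wᗮ.orthogonalProjectionOnto).toLinearMap, ⟨?_, ?_, ?_⟩, ?_⟩
  · intro v hv
    have : Wᗮ.orthogonalProjectionOnto v = 0 :=
      Submodule.orthogonalProjectionOnto_apply_of_mem_orthogonal
        (Submodule.le_orthogonal_orthogonal W hv)
    simp [this]
  · intro v w
    simp only [LinearMap.comp_apply, Submodule.subtype_apply, LinearIsometry.coe_toLinearMap,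
      ContinuousLinearMap.coe_coe, hproj]
    exact hskew _ _
  · intro v hv w hw
    lift v to Wᗮ using hv
    lift w to Wᗮ using hw
    simp [← Submodule.coe_inner]
  · intro u
    simp

theorem exists_quarterTurn_isometry {W : Submodule ℝ (E d)} (h : Module.finrank ℝ W + 2 = d) :
    ∃ J : Wᗮ →ₗᵢ[ℝ] Wᗮ, ∀ w, inner ℝ (J w) w = 0 := by
  have h2 : Module.finrank ℝ Wᗮ = 2 := by
    have := W.finrank_add_finrank_orthogonal
    rw [finrank_euclideanSpace_fin] at this
    omega
  have : Fact (Module.finrank ℝ Wᗮ = 2) := ⟨h2⟩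
  let o : Orientation ℝ Wᗮ (Fin 2) :=
    (((stdOrthonormalBasis ℝ Wᗮ).reindex (finCongr h2)).toBasis).orientation
  exact ⟨o.rightAngleRotation.toLinearIsometry, fun w => o.inner_rightAngleRotation_self w⟩

/-- `u` is the unit vector orthogonal to `R` that points from `R` into `F`. -/
structure IsInward (R F : Set (E d)) (u : E d) : Prop where
  norm_eq : ‖u‖ = 1
  orth : u ∈ (vectorSpan ℝ R)ᗮ
  mem : u ∈ vectorSpan ℝ F
  nonneg : ∀ r ∈ R, ∀ x ∈ F, 0 ≤ inner ℝ u (x - r)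

theorem coherentNormals_iff {R : Set (E d)} {n : Set (E d) → E d} (h : CoherentNormals T R n) :
    ∃ K : E d →ₗ[ℝ] E d, IsQuarterTurn (vectorSpan ℝ R) K ∧
      ∀ F ∈ facetsAround T R, ∃ u, IsInward R F u ∧ n F = K u := by
  obtain ⟨J, hJ, hn⟩ := h
  obtain ⟨K, hK, hKJ⟩ := isQuarterTurn_of_isometry J hJ
  refine ⟨K, hK, fun F hF => ?_⟩
  obtain ⟨u, h1, h2, h3, h4⟩ := hn F hF
  exact ⟨u, ⟨by simpa using h1, u.2, h2, h3⟩, by rw [h4, hKJ]⟩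

namespace IsTiling

variable (hT : IsTiling T)
include hT

theorem face_ridge {R P : Set (E d)} (hR : R ∈ ridges T) (hP : P ∈ T) (h : R ⊆ P) : IsFace P R := by
  obtain ⟨Q, hQ, hRQ, -⟩ := hR
  exact hT.face_of_subset hQ hP hRQ h

theorem face_ridge_facet {R F : Set (E d)} (hR : R ∈ ridges T) (hF : F ∈ facetsAround T R) :
    IsFace F R := by
  obtain ⟨⟨P, hP, hFP, -⟩, hRF⟩ := hF
  exact (hT.face_ridge hR hP (hRF.trans hFP.subset)).restrict hRF hFP.subset

omit hT in
theorem _root_.Gen.nonempty_ridge {R : Set (E d)} (hR : R ∈ ridges T) : R.Nonempty :=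
  nonempty_of_mem_faces (ridges_subset_faces hR)

/-- Take a functional exposing `R` in `F`, project it to the direction space of `F`, change its sign
and normalize. The projection is nonzero because `R ≠ F`. -/
theorem exists_isInward {R F : Set (E d)} (hR : R ∈ ridges T) (hF : F ∈ facetsAround T R) :
    ∃ u, IsInward R F u := by
  have hRF := hT.face_ridge_facet hR hF
  obtain ⟨a, c, hle, heq⟩ := hRF.exists_inner
  have hRc : ∀ x ∈ R, inner ℝ a x = c := fun x hx => by rw [heq] at hx; exact hx.2
  set u₀ : E d := -((vectorSpan ℝ F).orthogonalProjectionOnto a : E d) with hu₀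
  have hin : ∀ v ∈ vectorSpan ℝ F, inner ℝ u₀ v = -inner ℝ a v := fun v hv => by
    rw [hu₀, inner_neg_left]
    congr 1
    exact Submodule.inner_orthogonalProjectionOnto_eq_of_mem_right ⟨v, hv⟩ a
  have hmem : u₀ ∈ vectorSpan ℝ F := neg_mem (Subtype.coe_prop _)
  have hne : u₀ ≠ 0 := by
    intro h0
    have : R = F := by
      refine subset_antisymm hRF.subset fun x hx => ?_
      obtain ⟨r, hr⟩ := hRF.1
      have := hin _ (vsub_mem_vectorSpan ℝ hx (hRF.subset hr))
      rw [h0, inner_zero_left, vsub_eq_sub, inner_sub_right, hRc r hr] at this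
      rw [heq]
      exact ⟨hx, by linarith⟩
    have h1 := dim_of_mem_ridges hR
    have h2 := dim_of_mem_facets hF.1
    rw [this] at h1
    omega
  have hpos : 0 < ‖u₀‖⁻¹ := inv_pos.2 (norm_pos_iff.2 hne)
  refine ⟨‖u₀‖⁻¹ • u₀, ?_, ?_, Submodule.smul_mem _ _ hmem, fun r hr x hx => ?_⟩
  · rw [norm_smul, norm_inv, norm_norm, inv_mul_cancel₀ (norm_ne_zero_iff.2 hne)]
  · refine Submodule.smul_mem _ _ fun v hv => ?_
    rw [real_inner_comm, hin v (vectorSpan_mono ℝ hRF.subset hv),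
      inner_eq_zero_of_mem_vectorSpan hRc hv, neg_zero]
  · rw [real_inner_smul_left, hin (x - r) (vsub_mem_vectorSpan ℝ hx (hRF.subset hr)),
      inner_sub_right, hRc r hr]
    have := hle x hx
    exact mul_nonneg hpos.le (by linarith)

omit hT in
theorem _root_.Gen.IsInward.inner_self {R F : Set (E d)} {u : E d} (hu : IsInward R F u) :
    inner ℝ u u = 1 := by
  rw [real_inner_self_eq_norm_sq, hu.norm_eq]; norm_num

omit hT in
theorem _root_.Gen.IsInward.mem_vectorSpan {R F : Set (E d)} {u : E d} (hR : R ∈ ridges T)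
    (hF : F ∈ facetsAround T R) (hu : IsInward R F u) {v : E d} (hv : v ∈ vectorSpan ℝ F)
    (huv : inner ℝ u v = 0) : v ∈ vectorSpan ℝ R := by
  have h1 : vectorSpan ℝ R ≤ vectorSpan ℝ F ⊓ (ℝ ∙ u)ᗮ := le_inf (vectorSpan_mono ℝ hF.2)
    fun w hw => by
      rw [Submodule.mem_orthogonal_singleton_iff_inner_left]
      exact hu.orth w hw
  have h2 : vectorSpan ℝ F ⊓ (ℝ ∙ u)ᗮ < vectorSpan ℝ F := by
    refine lt_of_le_of_ne inf_le_left fun h => ?_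
    have := hu.mem
    rw [← h, Submodule.mem_inf, Submodule.mem_orthogonal_singleton_iff_inner_left,
      hu.inner_self] at this
    exact one_ne_zero this.2
  have h3 := Submodule.finrank_lt_finrank_of_lt h2
  have h4 := dim_of_mem_ridges hR
  have h5 := dim_of_mem_facets hF.1
  rw [dim] at h4 h5
  rw [Submodule.eq_of_le_of_finrank_le h1 (by omega)]
  refine ⟨hv, ?_⟩
  rwa [SetLike.mem_coe, Submodule.mem_orthogonal_singleton_iff_inner_right]

omit hT in
theorem _root_.Gen.IsInward.decomp {R F : Set (E d)} {u : E d} (hR : R ∈ ridges T)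
    (hF : F ∈ facetsAround T R) (hu : IsInward R F u) {v : E d} (hv : v ∈ vectorSpan ℝ F) :
    v - inner ℝ u v • u ∈ vectorSpan ℝ R := by
  refine hu.mem_vectorSpan hR hF (sub_mem hv (Submodule.smul_mem _ _ hu.mem)) ?_
  rw [inner_sub_right, inner_smul_right, hu.inner_self, mul_one, sub_self]

theorem mem_ridge {R F : Set (E d)} {u r x : E d} (hR : R ∈ ridges T)
    (hF : F ∈ facetsAround T R) (hu : IsInward R F u) (hr : r ∈ R) (hx : x ∈ F)
    (h : inner ℝ u (x - r) = 0) : x ∈ R := by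
  obtain ⟨a, c, hle, heq⟩ := (hT.face_ridge_facet hR hF).exists_inner
  have hRc : ∀ x ∈ R, inner ℝ a x = c := fun x hx => by rw [heq] at hx; exact hx.2
  have h1 := inner_eq_zero_of_mem_vectorSpan hRc
    (hu.mem_vectorSpan hR hF (vsub_mem_vectorSpan ℝ hx (hF.2 hr)) h)
  rw [vsub_eq_sub, inner_sub_right, hRc r hr] at h1
  rw [heq]
  exact ⟨hx, by linarith⟩

theorem inner_inward_pos {R F : Set (E d)} {u r x : E d} (hR : R ∈ ridges T)
    (hF : F ∈ facetsAround T R) (hu : IsInward R F u) (hr : r ∈ R) (hx : x ∈ F) (hxR : x ∉ R) :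
    0 < inner ℝ u (x - r) :=
  lt_of_le_of_ne (hu.nonneg r hr x hx) fun h => hxR (hT.mem_ridge hR hF hu hr hx h.symm)

omit hT in
theorem _root_.Gen.IsQuarterTurn.map_eq {R F : Set (E d)} {u : E d} {K : E d →ₗ[ℝ] E d}
    (hK : IsQuarterTurn (vectorSpan ℝ R) K) (hR : R ∈ ridges T) (hF : F ∈ facetsAround T R)
    (hu : IsInward R F u) {v : E d} (hv : v ∈ vectorSpan ℝ F) : K v = inner ℝ u v • K u := by
  have := hK.map_mem _ (hu.decomp hR hF hv)
  rw [map_sub, map_smul] at this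
  exact sub_eq_zero.1 this

omit hT in
theorem _root_.Gen.IsQuarterTurn.isFacetNormal {R F : Set (E d)} {u : E d} {K : E d →ₗ[ℝ] E d}
    (hK : IsQuarterTurn (vectorSpan ℝ R) K) (hR : R ∈ ridges T) (hF : F ∈ facetsAround T R)
    (hu : IsInward R F u) : IsFacetNormal F (K u) := by
  refine ⟨?_, fun v hv => ?_⟩
  · have h := hK.isometry u hu.orth u hu.orth
    rw [real_inner_self_eq_norm_sq, hu.inner_self] at h
    nlinarith [norm_nonneg (K u)]
  · rw [hK.skew, hK.map_eq hR hF hu hv, real_inner_smul_left, hK.inner_self, mul_zero, neg_zero]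

omit hT in
theorem _root_.Gen.exists_notMem_ridge {R F : Set (E d)} (hR : R ∈ ridges T) (hF : F ∈ facetsAround T R) :
    ∃ x ∈ F, x ∉ R := by
  by_contra hcon
  push Not at hcon
  have h1 := dim_mono hcon
  have h4 := dim_of_mem_ridges hR
  have h5 := dim_of_mem_facets hF.1
  omega

theorem finite_facetsAround {R : Set (E d)} (hR : R ∈ ridges T) : (facetsAround T R).Finite := by
  obtain ⟨r, hr⟩ := nonempty_ridge hR
  refine (hT.finite_faces (isCompact_singleton (x := r))).subset fun F hF => ?_
  exact ⟨facets_subset_faces hF.1, r, hF.2 hr, rfl⟩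

/-- If one cell lies in front of both hyperfaces, with inward vectors `u` and `u'`, then `⟨K u, u'⟩`
and `⟨K u', u⟩` are both nonnegative. By skewness they vanish, so `u' = u` or `u' = -u`. In the
first case both hyperfaces are cut from the cell by the same hyperplane. In the second the cell
would lie on both sides of it. -/
theorem injOn_side {R : Set (E d)} (hR : R ∈ ridges T) {K : E d →ₗ[ℝ] E d}
    (hK : IsQuarterTurn (vectorSpan ℝ R) K) {n : Set (E d) → E d}
    (hn : ∀ F ∈ facetsAround T R, ∃ u, IsInward R F u ∧ n F = K u) :
    InjOn (fun F => side T F (n F)) (facetsAround T R) := by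
  intro F hF F' hF' heq
  obtain ⟨u, hu, hnu⟩ := hn F hF
  obtain ⟨u', hu', hnu'⟩ := hn F' hF'
  simp only [hnu, hnu'] at heq
  have hν := hK.isFacetNormal hR hF hu
  have hν' := hK.isFacetNormal hR hF' hu'
  obtain ⟨hP, hFP, hs⟩ := hT.side_spec hF.1 hν
  obtain ⟨-, hFP', hs'⟩ := hT.side_spec hF'.1 hν'
  rw [← heq] at hFP' hs'
  obtain ⟨r, hr⟩ := nonempty_ridge hR
  have key : ∀ {F F' u u'}, F ∈ facetsAround T R → F' ∈ facetsAround T R → IsInward R F u →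
      IsInward R F' u' → (∀ f ∈ F, ∀ x ∈ F', inner ℝ (K u) f ≤ inner ℝ (K u) x) →
      0 ≤ inner ℝ (K u) u' := by
    intro F F' u u' hF hF' hu hu' h
    obtain ⟨x, hx, hxR⟩ := exists_notMem_ridge hR hF'
    have h1 := hT.inner_inward_pos hR hF' hu' hr hx hxR
    have h2 := h r (hF.2 hr) x hx
    have h3 := hK.inner_mem u (hu'.decomp hR hF' (vsub_mem_vectorSpan ℝ hx (hF'.2 hr)))
    rw [vsub_eq_sub, inner_sub_right, inner_smul_right, inner_sub_right _ x r] at h3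
    have h4 : 0 ≤ inner ℝ u' (x - r) * inner ℝ (K u) u' := by linarith
    exact nonneg_of_mul_nonneg_right h4 h1
  have h1 := key hF hF' hu hu' fun f hf x hx => hs f hf x (hFP' hx)
  have h2 := key hF' hF hu' hu fun f hf x hx => hs' f hf x (hFP hx)
  have h3 := hK.skew u u'
  have h4 : inner ℝ (K u) u' = 0 := by linarith
  have h5 := hu.decomp hR hF (hν.mem_vectorSpan (dim_of_mem_facets hF.1) h4)
  have h6 : u' - inner ℝ u u' • u = 0 := by
    have : u' - inner ℝ u u' • u ∈ (vectorSpan ℝ R)ᗮ :=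
      sub_mem hu'.orth (Submodule.smul_mem _ _ hu.orth)
    exact inner_self_eq_zero.1 (this _ h5)
  have h7 : u' = inner ℝ u u' • u := sub_eq_zero.1 h6
  have h8 : |inner ℝ u u'| = 1 := by
    have := hu'.norm_eq
    rw [h7, norm_smul, hu.norm_eq, mul_one] at this
    simpa using this
  rcases (abs_eq zero_le_one).1 h8 with h9 | h9
  · rw [h9, one_smul] at h7
    rw [h7] at hν'
    have e1 := (hT.facet_normal_form hP (hT.face_facet hF.1 hP hFP) (dim_of_mem_facets hF.1) hν).2
    have e2 := (hT.facet_normal_form hP (hT.face_facet hF'.1 hP hFP') (dim_of_mem_facets hF'.1)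
      hν').2
    refine subset_antisymm (fun x hx => ?_) (fun x hx => ?_)
    · exact e2 r (hF'.2 hr) x (hFP hx) (hν.inner_eq hx (hF.2 hr))
    · exact e1 r (hF.2 hr) x (hFP' hx) (hν'.inner_eq hx (hF'.2 hr))
  · exfalso
    rw [h9, neg_one_smul] at h7
    refine hT.not_onSide_both ⟨r, hF.2 hr⟩ hν hP hs ?_
    rw [h7, map_neg] at hs' hν'
    intro f hf x hx
    have := hs' r (hF'.2 hr) x hx
    rwa [hν.neg.inner_eq hf (hF.2 hr)]

/-- Rotate a hyperplane that supports `P` exactly in `R` about `R`, in the plane spanned by `a` and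
`K a`, until it hits another generating point of `P`. It then supports `P` along a hyperface through
`R`. The direction of rotation decides on which side of that hyperface `P` lies. -/
theorem surjOn_side {R : Set (E d)} (hR : R ∈ ridges T) {K : E d →ₗ[ℝ] E d}
    (hK : IsQuarterTurn (vectorSpan ℝ R) K) {n : Set (E d) → E d}
    (hn : ∀ F ∈ facetsAround T R, ∃ u, IsInward R F u ∧ n F = K u) :
    SurjOn (fun F => side T F (n F)) (facetsAround T R) {P | P ∈ T ∧ R ⊆ P} := by
  rintro P ⟨hP, hRP⟩
  obtain ⟨r, hr⟩ := nonempty_ridge hR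
  obtain ⟨a₁, c, hle, heq⟩ := (hT.face_ridge hR hP hRP).exists_inner
  have hRc : ∀ x ∈ R, inner ℝ a₁ x = c := fun x hx => by rw [heq] at hx; exact hx.2
  obtain ⟨a, rfl⟩ : ∃ a, a₁ = -a := ⟨-a₁, by simp⟩
  have ha : a ∈ (vectorSpan ℝ R)ᗮ := fun v hv => by
    have := inner_eq_zero_of_mem_vectorSpan hRc hv
    rw [inner_neg_left] at this
    rw [real_inner_comm]; linarith
  have hαnn : ∀ x ∈ P, 0 ≤ inner ℝ a (x - r) := fun x hx => by
    have := hle x hx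
    have h2 := hRc r hr
    rw [inner_neg_left] at this h2
    rw [inner_sub_right]; linarith
  have hα : ∀ x ∈ P, inner ℝ a (x - r) = 0 → x ∈ R := fun x hx h => by
    have h2 := hRc r hr
    rw [heq]
    refine ⟨hx, ?_⟩
    rw [inner_neg_left] at h2 ⊢
    rw [inner_sub_right] at h
    linarith
  obtain ⟨S, hS, hPS⟩ := hT.polytope P hP
  have hSP : S ⊆ P := by rw [hPS]; exact subset_convexHull ℝ S
  have hRconv : Convex ℝ R := (hT.isPolytope_face (ridges_subset_faces hR)).convex
  have hdimR := dim_of_mem_ridges hR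
  have hSne : (S \ R).Nonempty := by
    by_contra hcon
    rw [not_nonempty_iff_eq_empty, sdiff_eq_empty] at hcon
    have h1 := dim_mono ((convexHull_min hcon hRconv))
    rw [← hPS, hT.dim_eq hP] at h1
    omega
  have hαpos : ∀ v ∈ S \ R, 0 < inner ℝ a (v - r) := fun v hv =>
    lt_of_le_of_ne (hαnn v (hSP hv.1)) fun h => hv.2 (hα v (hSP hv.1) h.symm)
  -- The point `v` with the least slope is hit first. By minimality, `ψ = K a - m • a` satisfies
  -- `⟨ψ, x - r⟩ ≥ 0` on `P`, with equality on `R` and at `v`.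
  obtain ⟨v, hv, hmin⟩ := exists_min_image (S \ R)
    (fun v => inner ℝ (K a) (v - r) / inner ℝ a (v - r)) hS.sdiff hSne
  set m := inner ℝ (K a) (v - r) / inner ℝ a (v - r) with hm
  set ψ := K a - m • a with hψ
  have hψR : ∀ x ∈ R, inner ℝ ψ (x - r) = 0 := fun x hx => by
    have hx' : x - r ∈ vectorSpan ℝ R := vsub_mem_vectorSpan ℝ hx hr
    rw [hψ, inner_sub_left, real_inner_smul_left, hK.inner_mem a hx',
      Submodule.inner_left_of_mem_orthogonal hx' ha, mul_zero, sub_zero]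
  have hψv : inner ℝ ψ (v - r) = 0 := by
    rw [hψ, inner_sub_left, real_inner_smul_left, hm, div_mul_cancel₀ _ (hαpos v hv).ne', sub_self]
  have hψP : ∀ x ∈ P, inner ℝ (-ψ) x ≤ inner ℝ (-ψ) r := by
    intro x hx
    rw [hPS] at hx
    refine convexHull_inner_le (fun w hw => ?_) x hx
    have : 0 ≤ inner ℝ ψ (w - r) := by
      by_cases hwR : w ∈ R
      · rw [hψR w hwR]
      · have h1 := hmin w ⟨hw, hwR⟩
        rw [le_div_iff₀ (hαpos w ⟨hw, hwR⟩)] at h1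
        rw [hψ, inner_sub_left, real_inner_smul_left]
        linarith
    rw [inner_neg_left, inner_neg_left]
    rw [inner_sub_right] at this
    linarith
  have hane : a ≠ 0 := by
    rintro rfl
    simpa using hαpos v hv
  have hψKa : 0 < inner ℝ ψ (K a) := by
    rw [hψ, inner_sub_left, real_inner_smul_left, hK.isometry a ha a ha, real_inner_comm (K a) a,
      hK.inner_self, mul_zero, sub_zero]
    exact real_inner_self_pos.2 hane
  have hψne : ψ ≠ 0 := by
    intro h
    rw [h, inner_zero_left] at hψKa
    exact lt_irrefl _ hψKa
  set F := {x ∈ P | inner ℝ (-ψ) x = inner ℝ (-ψ) r} with hFdef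
  have hFP : IsFace P F := isFace_of_inner ⟨r, hRP hr, rfl⟩ hψP hFdef
  have hRF : R ⊆ F := fun x hx => ⟨hRP hx, by
    have := hψR x hx
    rw [inner_sub_right] at this
    rw [inner_neg_left, inner_neg_left]; linarith⟩
  have hvF : v ∈ F := ⟨hSP hv.1, by
    rw [inner_sub_right] at hψv
    rw [inner_neg_left, inner_neg_left]; linarith⟩
  have hFne : F ≠ P := by
    intro h
    obtain ⟨p, hp⟩ := hT.fullDim P hP
    have h1 : ∀ x ∈ P, inner ℝ ψ r ≤ inner ℝ ψ x := fun x hx => by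
      have := hψP x hx
      rw [inner_neg_left, inner_neg_left] at this
      linarith
    have h2 := inner_lt_of_mem_interior hψne h1 hp
    have h3 : p ∈ F := by rw [h]; exact interior_subset hp
    have h4 := h3.2
    rw [inner_neg_left, inner_neg_left] at h4
    linarith
  have hdimF : dim F + 1 = d := by
    have h1 := hFP.dim_lt hFne
    rw [hT.dim_eq hP] at h1
    have h2 : vectorSpan ℝ R < vectorSpan ℝ F := by
      refine lt_of_le_of_ne (vectorSpan_mono ℝ hRF) fun h => ?_
      have h3 : v - r ∈ vectorSpan ℝ R := by
        rw [h]; exact vsub_mem_vectorSpan ℝ hvF (hRF hr)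
      exact (hαpos v hv).ne' (Submodule.inner_left_of_mem_orthogonal h3 ha)
    have h3 : dim R < dim F := Submodule.finrank_lt_finrank_of_lt h2
    omega
  have hF : F ∈ facetsAround T R := ⟨⟨P, hP, hFP, hdimF⟩, hRF⟩
  obtain ⟨u, hu, hnu⟩ := hn F hF
  have hν := hK.isFacetNormal hR hF hu
  refine ⟨F, hF, ?_⟩
  simp only [hnu]
  refine (hT.eq_side hF.1 hν hP hFP.subset ?_).symm
  have hψF : ∀ w ∈ vectorSpan ℝ F, inner ℝ ψ w = 0 := fun w hw =>
    inner_eq_zero_of_mem_vectorSpan (A := F) (c := inner ℝ ψ r) (fun x hx => by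
      have h4 := hx.2
      rw [inner_neg_left, inner_neg_left] at h4
      linarith) hw
  have hκ := hν.eq_smul hdimF hψF
  set κ := inner ℝ (K u) ψ
  have hua : 0 < inner ℝ u a := by
    have h1 := hu.decomp hR hF (vsub_mem_vectorSpan ℝ hvF (hRF hr))
    have h2 := Submodule.inner_left_of_mem_orthogonal h1 ha
    rw [vsub_eq_sub, inner_sub_right, inner_smul_right] at h2
    have h3 := hαpos v hv
    have h4 : 0 < inner ℝ u (v - r) * inner ℝ a u := by linarith
    have h5 := hu.nonneg r hr v hvF
    rw [real_inner_comm]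
    exact pos_of_mul_pos_right h4 h5
  -- From `ψ = κ • K u` one gets `⟨ψ, K a⟩ = κ * ⟨u, a⟩`, while `⟨ψ, K a⟩ = ⟨a, a⟩ > 0` and `⟨u, a⟩
  -- > 0`.
  have hκpos : 0 < κ := by
    rw [hκ, real_inner_smul_left, hK.isometry u hu.orth a ha] at hψKa
    exact pos_of_mul_pos_left hψKa hua.le
  intro f hf x hx
  have h1 := hψP x hx
  rw [← hf.2, inner_neg_left, inner_neg_left, hκ, real_inner_smul_left, real_inner_smul_left,
    neg_le_neg_iff] at h1
  exact le_of_mul_le_mul_left h1 hκpos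

theorem bijOn_side {R : Set (E d)} (hR : R ∈ ridges T) {K : E d →ₗ[ℝ] E d}
    (hK : IsQuarterTurn (vectorSpan ℝ R) K) {n : Set (E d) → E d}
    (hn : ∀ F ∈ facetsAround T R, ∃ u, IsInward R F u ∧ n F = K u) :
    BijOn (fun F => side T F (n F)) (facetsAround T R) {P | P ∈ T ∧ R ⊆ P} := by
  refine ⟨fun F hF => ?_, hT.injOn_side hR hK hn, hT.surjOn_side hR hK hn⟩
  obtain ⟨u, hu, hnu⟩ := hn F hF
  obtain ⟨h1, h2, -⟩ := hT.side_spec hF.1 (hK.isFacetNormal hR hF hu)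
  simp only [hnu]
  exact ⟨h1, hF.2.trans h2⟩

/-- Increments of a function on the cells have zero torsion. -/
theorem zeroTorsion_of_increments {s : Set (E d) → ℝ} {h : Set (E d) → E d}
    (hs : ∀ F ∈ facets T, ∀ ν, IsFacetNormal F ν → s F • ν = h (side T F ν) - h (side T F (-ν))) :
    ZeroTorsion T s := by
  intro R hR n hn
  obtain ⟨K, hK, hn⟩ := coherentNormals_iff hn
  have h1 : torsion T s R n =
      ∑ᶠ F ∈ facetsAround T R, (h (side T F (n F)) - h (side T F (-n F))) := by
    refine finsum_mem_congr rfl fun F hF => ?_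
    obtain ⟨u, hu, hnu⟩ := hn F hF
    rw [hnu]
    exact hs F hF.1 _ (hK.isFacetNormal hR hF hu)
  -- The cells in front of the hyperfaces around `R` run once through all cells around `R`. So do
  -- the cells behind them, by the same statement for the opposite quarter turn. The two sums of `h`
  -- cancel.
  have e1 := finsum_mem_eq_of_bijOn (f := fun F => h (side T F (n F))) (g := h) _
    (hT.bijOn_side hR hK hn) fun F _ => rfl
  have e2 := finsum_mem_eq_of_bijOn (f := fun F => h (side T F (-n F))) (g := h) _
    (hT.bijOn_side hR hK.neg (n := fun F => -n F) fun F hF => by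
      obtain ⟨u, hu, hnu⟩ := hn F hF
      exact ⟨u, hu, by simp [hnu]⟩) fun F _ => rfl
  rw [h1, finsum_mem_sub_distrib _ _ (hT.finite_facetsAround hR), e1, e2, sub_self]

end IsTiling

/-! ### A line through a hyperface -/

/-- The sign of a real number, as a real number. -/
noncomputable def sg (x : ℝ) : ℝ := (SignType.sign x : ℝ)

theorem sg_mul (x y : ℝ) : sg (x * y) = sg x * sg y := by
  rw [sg, sign_mul, SignType.coe_mul]; rfl

theorem sg_pos {x : ℝ} (h : 0 < x) : sg x = 1 := by simp [sg, h]

theorem sg_neg {x : ℝ} (h : x < 0) : sg x = -1 := by simp [sg, h]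

theorem sg_neg_eq (x : ℝ) : sg (-x) = -sg x := by
  rw [neg_eq_neg_one_mul, sg_mul, sg_neg (by norm_num), neg_one_mul]

theorem sg_mul_self {x : ℝ} (h : x ≠ 0) : sg x * sg x = 1 := by
  rcases lt_or_gt_of_ne h with h | h
  · rw [sg_neg h]; norm_num
  · rw [sg_pos h]; norm_num

namespace IsTiling

variable (hT : IsTiling T)
include hT

theorem facet_cases {F : Set (E d)} (hF : F ∈ facets T) {x : E d} (hx : x ∈ F)
    (hlow : ∀ K ∈ faces T, dim K + 3 ≤ d → x ∉ K) :
    RelInt F x ∨ ∃ R ∈ ridges T, R ⊆ F ∧ RelInt R x := by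
  obtain ⟨K, hK, hxK⟩ := exists_face_relInt (hT.isPolytope_face (facets_subset_faces hF)) hx
  obtain ⟨P, hP, hFP, hdim⟩ := hF
  have hKP := hFP.trans (hT.polytope P hP) hK
  by_cases hKF : K = F
  · left; rwa [← hKF]
  · right
    have h1 := hK.dim_lt hKF
    have h2 : ¬ (dim K + 3 ≤ d) := fun h => hlow K ⟨P, hP, hKP⟩ h hxK.mem
    exact ⟨K, ⟨P, hP, hKP, by omega⟩, hK.subset, hxK⟩

theorem eventually_mem_facet {R F : Set (E d)} {u r v : E d} (hR : R ∈ ridges T)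
    (hF : F ∈ facetsAround T R) (hu : IsInward R F u) (hr : RelInt R r) (hv : v ∈ vectorSpan ℝ F)
    (hpos : 0 < inner ℝ u v) : ∀ᶠ t in 𝓝[>] (0 : ℝ), r + t • v ∈ F := by
  obtain ⟨x, hx, hxR⟩ := exists_notMem_ridge hR hF
  have h1 := hT.inner_inward_pos hR hF hu hr.mem hx hxR
  have hxr : x - r ∈ vectorSpan ℝ F := vsub_mem_vectorSpan ℝ hx (hF.2 hr.mem)
  have hw : v - (inner ℝ u v / inner ℝ u (x - r)) • (x - r) ∈ vectorSpan ℝ R := by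
    refine hu.mem_vectorSpan hR hF (sub_mem hv (Submodule.smul_mem _ _ hxr)) ?_
    rw [inner_sub_right, inner_smul_right, div_mul_cancel₀ _ h1.ne', sub_self]
  have := hr.eventually_mem_of_convex (hT.isPolytope_face (facets_subset_faces hF.1)).convex hF.2
    hx hw (c := inner ℝ u v / inner ℝ u (x - r)) (by positivity)
  simpa using this

theorem relInt_ridge {R F : Set (E d)} {x : E d} (hR : R ∈ ridges T) (hF : F ∈ facetsAround T R)
    (hx : x ∈ R) (hlow : ∀ K ∈ faces T, dim K + 3 ≤ d → x ∉ K) : RelInt R x := by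
  have hRF := hT.face_ridge_facet hR hF
  have h4 := dim_of_mem_ridges hR
  rcases hT.facet_cases hF.1 (hF.2 hx) hlow with h | ⟨R', hR', hR'F, h⟩
  · have h1 := dim_mono (h.subset_face subset_rfl hRF hx)
    have h5 := dim_of_mem_facets hF.1
    omega
  · have h1 := h.subset_face hR'F hRF hx
    have h2 : IsFace R R' := (hT.face_ridge_facet hR' ⟨hF.1, hR'F⟩).restrict h1 hRF.subset
    have h5 := dim_of_mem_ridges hR'
    have h6 := h2.eq_of_dim_le (by omega)
    rwa [← h6]

/-- If a segment in the affine hull of a hyperface starts outside and meets the hyperface, then it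
enters through exactly one face of codimension two. -/
theorem sum_entering {F : Set (E d)} (hF : F ∈ facets T) {p e : E d} {u : Set (E d) → E d}
    (he : e ∈ vectorSpan ℝ F)
    (hlow : ∀ K ∈ faces T, dim K + 3 ≤ d → ∀ t ∈ Icc (0 : ℝ) 1, p + t • e ∉ K)
    (hp : ∀ R ∈ ridges T, p ∉ R) (hu : ∀ R ∈ ridges T, R ⊆ F → IsInward R F (u R))
    {S : Finset (Set (E d))}
    (hS : ∀ R, R ∈ S ↔ R ∈ ridges T ∧ R ⊆ F ∧ ∃ t ∈ Icc (0 : ℝ) 1, p + t • e ∈ R)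
    (htr : ∀ R ∈ S, inner ℝ (u R) e ≠ 0) [Decidable (∃ t ∈ Icc (0 : ℝ) 1, p + t • e ∈ F)]
    [Decidable (p ∈ F)] :
    ∑ R ∈ S, (if 0 < inner ℝ (u R) e then (1 : ℝ) else 0) =
      if p ∉ F ∧ ∃ t ∈ Icc (0 : ℝ) 1, p + t • e ∈ F then 1 else 0 := by
  -- If `e` points inwards at `R`, the line has not met `F` before it reaches `R`, since `F` lies on
  -- the inner side of `R`.
  have hback : ∀ R ∈ S, 0 < inner ℝ (u R) e → ∀ t : ℝ, p + t • e ∈ R →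
      ∀ t' < t, p + t' • e ∉ F := by
    intro R hR hpos t ht t' htt hF'
    have h1 := (hu R ((hS R).1 hR).1 ((hS R).1 hR).2.1).nonneg _ ht _ hF'
    have h2 : p + t' • e - (p + t • e) = (t' - t) • e := by module
    rw [h2, inner_smul_right] at h1
    have := mul_neg_of_neg_of_pos (sub_neg.2 htt) hpos
    linarith
  split_ifs with h
  · obtain ⟨hpF, t₁, ht₁, ht₁F⟩ := h
    have hcomp : IsCompact {t ∈ Icc (0 : ℝ) 1 | p + t • e ∈ F} := by
      have hcl : IsClosed F := (hT.isPolytope_face (facets_subset_faces hF)).isCompact.isClosed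
      have hc : Continuous fun t : ℝ => p + t • e := by fun_prop
      exact isCompact_Icc.inter_right (hcl.preimage hc)
    -- At the first contact the point cannot be moved back within `F`. So it is not relatively
    -- interior to `F`, and `e` points inwards at the ridge containing it. By `hback`, no other
    -- ridge is entered.
    obtain ⟨t₀, ⟨ht₀, ht₀F⟩, hmin⟩ := hcomp.exists_isLeast ⟨t₁, ht₁, ht₁F⟩
    have ht₀pos : 0 < t₀ := lt_of_le_of_ne ht₀.1 fun h0 => hpF (by simpa [← h0] using ht₀F)
    have hno : ∀ v : E d, (v = -e) → ¬ ∀ᶠ ε in 𝓝[>] (0 : ℝ), p + t₀ • e + ε • v ∈ F := by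
      rintro v rfl hev
      obtain ⟨ε, hε, hε'⟩ := (hev.and (Ioo_mem_nhdsGT ht₀pos)).exists
      have h1 : p + (t₀ - ε) • e ∈ F := by
        convert hε using 1; module
      have := hmin ⟨⟨by linarith [hε'.2], by linarith [hε'.1, ht₀.2]⟩, h1⟩
      linarith [hε'.1]
    have hlow' := fun K hK hd => hlow K hK hd t₀ ht₀
    obtain ⟨R, hR, hRF, hrel⟩ := (hT.facet_cases hF ht₀F hlow').resolve_left fun h =>
      hno _ rfl (nhdsWithin_le_nhds (h.eventually (neg_mem he)))
    have hRS : R ∈ S := (hS R).2 ⟨hR, hRF, t₀, ht₀, hrel.mem⟩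
    have hpos : 0 < inner ℝ (u R) e := by
      rcases lt_or_gt_of_ne (htr R hRS) with hneg | hpos
      · exfalso
        exact hno _ rfl (hT.eventually_mem_facet hR ⟨hF, hRF⟩ (hu R hR hRF) hrel (neg_mem he)
          (by rw [inner_neg_right]; linarith))
      · exact hpos
    rw [Finset.sum_eq_single_of_mem R hRS, if_pos hpos]
    intro R' hR'S hne
    rw [if_neg]
    intro hpos'
    obtain ⟨hR', hR'F, t', ht', ht'R⟩ := (hS R').1 hR'S
    have h1 : t' = t₀ := by
      rcases lt_trichotomy t' t₀ with h | h | h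
      · exact absurd (hR'F ht'R) (hback R hRS hpos t₀ hrel.mem t' h)
      · exact h
      · exact absurd ht₀F (hback R' hR'S hpos' t' ht'R t₀ h)
    rw [h1] at ht'R
    have hrel' := hT.relInt_ridge hR' ⟨hF, hR'F⟩ ht'R hlow'
    exact hne (subset_antisymm
      (hrel'.subset_face hR'F (hT.face_ridge_facet hR ⟨hF, hRF⟩) hrel.mem)
      (hrel.subset_face hRF (hT.face_ridge_facet hR' ⟨hF, hR'F⟩) ht'R))
  · refine Finset.sum_eq_zero fun R hRS => if_neg fun hpos => h ?_
    obtain ⟨hR, hRF, t, ht, htR⟩ := (hS R).1 hRS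
    refine ⟨?_, t, ht, hRF htR⟩
    have ht0 : 0 < t := lt_of_le_of_ne ht.1 fun h0 => hp R hR (by simpa [← h0] using htR)
    simpa using hback R hRS hpos t htR 0 ht0

/-- The signs count entries minus exits, and the exits are the entries of the reversed segment.
Entries minus exits depend only on which of the endpoints belong to `F`. -/
theorem sum_sg {F : Set (E d)} (hF : F ∈ facets T) {p e : E d} {u : Set (E d) → E d}
    (he : e ∈ vectorSpan ℝ F)
    (hlow : ∀ K ∈ faces T, dim K + 3 ≤ d → ∀ t ∈ Icc (0 : ℝ) 1, p + t • e ∉ K)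
    (hp : ∀ R ∈ ridges T, p ∉ R) (hq : ∀ R ∈ ridges T, p + e ∉ R)
    (hu : ∀ R ∈ ridges T, R ⊆ F → IsInward R F (u R)) {S : Finset (Set (E d))}
    (hS : ∀ R, R ∈ S ↔ R ∈ ridges T ∧ R ⊆ F ∧ ∃ t ∈ Icc (0 : ℝ) 1, p + t • e ∈ R)
    (htr : ∀ R ∈ S, inner ℝ (u R) e ≠ 0) [Decidable (p ∈ F)] [Decidable (p + e ∈ F)] :
    ∑ R ∈ S, sg (inner ℝ (u R) e) = (if p + e ∈ F then 1 else 0) - (if p ∈ F then 1 else 0) := by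
  classical
  have hrev : ∀ K : Set (E d), (∃ t ∈ Icc (0 : ℝ) 1, p + e + t • -e ∈ K) ↔
      ∃ t ∈ Icc (0 : ℝ) 1, p + t • e ∈ K := by
    intro K
    constructor
    · rintro ⟨t, ht, h⟩
      refine ⟨1 - t, ⟨by linarith [ht.2], by linarith [ht.1]⟩, ?_⟩
      convert h using 1; module
    · rintro ⟨t, ht, h⟩
      refine ⟨1 - t, ⟨by linarith [ht.2], by linarith [ht.1]⟩, ?_⟩
      convert h using 1; module
  have h1 := hT.sum_entering hF he hlow hp hu hS htr
  have h2 := hT.sum_entering hF (p := p + e) (e := -e) (u := u) (neg_mem he)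
    (fun K hK hd t ht h => by
      obtain ⟨t', ht', h'⟩ := (hrev K).1 ⟨t, ht, h⟩
      exact hlow K hK hd t' ht' h') hq hu (S := S) (fun R => by rw [hS, hrev])
    (fun R hR => by rw [inner_neg_right]; exact neg_ne_zero.2 (htr R hR))
  have h3 : ∑ R ∈ S, sg (inner ℝ (u R) e) =
      ∑ R ∈ S, (if 0 < inner ℝ (u R) e then (1 : ℝ) else 0) -
        ∑ R ∈ S, (if 0 < inner ℝ (u R) (-e) then (1 : ℝ) else 0) := by
    rw [← Finset.sum_sub_distrib]
    refine Finset.sum_congr rfl fun R hR => ?_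
    rw [inner_neg_right]
    rcases lt_or_gt_of_ne (htr R hR) with h | h
    · rw [sg_neg h, if_neg (by linarith), if_pos (by linarith)]; norm_num
    · rw [sg_pos h, if_pos h, if_neg (by linarith)]; norm_num
  rw [h3, h1, h2]
  simp only [hrev]
  have hpI : p ∈ F → ∃ t ∈ Icc (0 : ℝ) 1, p + t • e ∈ F := fun h => ⟨0, by simp, by simpa using h⟩
  have hqI : p + e ∈ F → ∃ t ∈ Icc (0 : ℝ) 1, p + t • e ∈ F :=
    fun h => ⟨1, by simp, by simpa using h⟩
  by_cases hc : ∃ t ∈ Icc (0 : ℝ) 1, p + t • e ∈ F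
  · simp only [hc, and_true, ite_not]
    split_ifs <;> norm_num
  · rw [if_neg fun h => hc h.2, if_neg fun h => hc h.2, if_neg fun h => hc (hpI h),
      if_neg fun h => hc (hqI h)]

end IsTiling

/-! ### Crossing numbers and triangles -/

open Classical in
/-- The signed number of crossings of the segment from `a` to `b` with `F`, where `ν` is a normal
of `F`. -/
noncomputable def crossing (F : Set (E d)) (ν a b : E d) : ℝ :=
  if ∃ t ∈ Icc (0 : ℝ) 1, a + t • (b - a) ∈ F then sg (inner ℝ ν (b - a)) else 0

theorem exists_segment_comm (F : Set (E d)) (a b : E d) :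
    (∃ t ∈ Icc (0 : ℝ) 1, a + t • (b - a) ∈ F) ↔ ∃ t ∈ Icc (0 : ℝ) 1, b + t • (a - b) ∈ F := by
  constructor <;>
  · rintro ⟨t, ht, h⟩
    refine ⟨1 - t, ⟨by linarith [ht.2], by linarith [ht.1]⟩, ?_⟩
    convert h using 1; module

theorem crossing_comm (F : Set (E d)) (ν a b : E d) : crossing F ν a b = -crossing F ν b a := by
  by_cases h : ∃ t ∈ Icc (0 : ℝ) 1, a + t • (b - a) ∈ F
  · rw [crossing, crossing, if_pos h, if_pos ((exists_segment_comm F a b).1 h), ← sg_neg_eq,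
      ← inner_neg_right, neg_sub]
  · rw [crossing, crossing, if_neg h, if_neg (mt (exists_segment_comm F a b).2 h), neg_zero]

/-- The triangle with vertices `x`, `y`, `z`. -/
def tri (x y z : E d) : Set (E d) :=
  {r | ∃ a b c : ℝ, 0 ≤ a ∧ 0 ≤ b ∧ 0 ≤ c ∧ a + b + c = 1 ∧ r = a • x + b • y + c • z}

theorem tri_rotate (x y z : E d) : tri y z x = tri x y z := by
  ext r
  constructor
  · rintro ⟨a, b, c, ha, hb, hc, h, rfl⟩
    exact ⟨c, a, b, hc, ha, hb, by linarith, by module⟩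
  · rintro ⟨a, b, c, ha, hb, hc, h, rfl⟩
    exact ⟨b, c, a, hb, hc, ha, by linarith, by module⟩

/-- General position of a triangle with respect to the tiling. -/
structure TriGeneric (T : Set (Set (E d))) (x y z : E d) : Prop where
  facet : ∀ F ∈ facets T, x ∉ affineSpan ℝ F ∧ y ∉ affineSpan ℝ F ∧ z ∉ affineSpan ℝ F
  seg : SegGeneric T x y ∧ SegGeneric T y z ∧ SegGeneric T z x
  low : ∀ K ∈ faces T, dim K + 3 ≤ d → ∀ r ∈ tri x y z, r ∉ K
  ridge : ∀ R ∈ ridges T, ∀ K, IsQuarterTurn (vectorSpan ℝ R) K → inner ℝ (K (y - x)) (z - x) ≠ 0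

theorem IsQuarterTurn.rotate {W : Submodule ℝ (E d)} {K : E d →ₗ[ℝ] E d} (hK : IsQuarterTurn W K)
    (x y z : E d) : inner ℝ (K (z - y)) (x - y) = inner ℝ (K (y - x)) (z - x) := by
  have h1 : z - y = (z - x) - (y - x) := by abel
  have h2 : x - y = -(y - x) := by abel
  rw [h1, h2, map_sub, inner_neg_right, inner_sub_left, hK.inner_self, hK.skew (z - x)]
  ring

theorem TriGeneric.rotate {x y z : E d} (h : TriGeneric T x y z) : TriGeneric T y z x where
  facet F hF := ⟨(h.facet F hF).2.1, (h.facet F hF).2.2, (h.facet F hF).1⟩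
  seg := ⟨h.seg.2.1, h.seg.2.2, h.seg.1⟩
  low := by rw [tri_rotate]; exact h.low
  ridge R hR K hK := by rw [hK.rotate]; exact h.ridge R hR K hK

theorem SegGeneric.symm {y z : E d} (h : SegGeneric T y z) : SegGeneric T z y := by
  intro K hK hd t ht hm
  obtain ⟨t', ht', h'⟩ := (exists_segment_comm K z y).1 ⟨t, ht, hm⟩
  exact h K hK hd t' ht' h'

theorem IsFacetNormal.mem_affineSpan {F : Set (E d)} {ν f x : E d} (hν : IsFacetNormal F ν)
    (hdim : dim F + 1 = d) (hf : f ∈ F) (h : inner ℝ ν x = inner ℝ ν f) : x ∈ affineSpan ℝ F := by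
  have h1 : x - f ∈ vectorSpan ℝ F := hν.mem_vectorSpan hdim (by rw [inner_sub_right, h, sub_self])
  have := vadd_mem_affineSpan_of_mem_affineSpan_of_mem_vectorSpan
    (subset_affineSpan ℝ F hf) h1
  simpa using this

namespace IsTiling

variable (hT : IsTiling T)
include hT

omit hT in
theorem crossing_eq {F : Set (E d)} {ν f x y : E d} (hν : IsFacetNormal F ν) (hf : f ∈ F) {τ : ℝ}
    (hτ : τ ∈ Icc (0 : ℝ) 1) (hne : inner ℝ ν (y - x) ≠ 0)
    (hp : τ * inner ℝ ν (y - x) = inner ℝ ν (f - x)) [Decidable (x + τ • (y - x) ∈ F)] :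
    crossing F ν x y = if x + τ • (y - x) ∈ F then sg (inner ℝ ν (y - x)) else 0 := by
  have h : (∃ t ∈ Icc (0 : ℝ) 1, x + t • (y - x) ∈ F) ↔ x + τ • (y - x) ∈ F := by
    refine ⟨fun ⟨t, ht, h⟩ => ?_, fun h => ⟨τ, hτ, h⟩⟩
    have h1 := hν.inner_eq h hf
    rw [inner_add_right, inner_smul_right] at h1
    rw [inner_sub_right ν f x] at hp
    have h2 : t = τ := mul_right_cancel₀ hne (by linarith)
    rwa [← h2]
  simp only [crossing, h]

/-- The hyperplane of `F` separates `x` from `y` and `z`, so it cuts the triangle in a segment from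
a point `p` of the side `xy` to a point `q` of the side `xz`, and the side `yz` does not cross it.
The left side is therefore a sign times the difference of the indicators of `p ∈ F` and `q ∈ F`,
which `sum_sg` counts by the ridges met between them. -/
theorem facet_stokes_alone {F : Set (E d)} (hF : F ∈ facets T) {ν f x y z : E d}
    (hν : IsFacetNormal F ν) (hf : f ∈ F) (hg : TriGeneric T x y z)
    {K : Set (E d) → E d →ₗ[ℝ] E d} (hK : ∀ R ∈ ridges T, IsQuarterTurn (vectorSpan ℝ R) (K R))
    {u : Set (E d) → E d} (hu : ∀ R ∈ ridges T, R ⊆ F → IsInward R F (u R))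
    {S : Finset (Set (E d))} (hS : ∀ R, R ∈ S ↔ R ∈ ridges T ∧ R ⊆ F ∧ (R ∩ tri x y z).Nonempty)
    (hxy : inner ℝ ν (x - f) * inner ℝ ν (y - f) < 0)
    (hxz : inner ℝ ν (x - f) * inner ℝ ν (z - f) < 0) :
    crossing F ν x y + crossing F ν y z + crossing F ν z x =
      ∑ R ∈ S, sg (inner ℝ (K R (y - x)) (z - x)) * inner ℝ ν (K R (u R)) := by
  classical
  have hdim := dim_of_mem_facets hF
  have hyx : inner ℝ ν (y - x) = inner ℝ ν (y - f) - inner ℝ ν (x - f) := by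
    rw [← inner_sub_right]; congr 1; abel
  have hzx : inner ℝ ν (z - x) = inner ℝ ν (z - f) - inner ℝ ν (x - f) := by
    rw [← inner_sub_right]; congr 1; abel
  have hfx : inner ℝ ν (f - x) = -inner ℝ ν (x - f) := by
    rw [← inner_neg_right, neg_sub]
  set A := inner ℝ ν (x - f) with hA
  set B := inner ℝ ν (y - f) with hB
  set C := inner ℝ ν (z - f) with hC
  have hτ : ∀ B : ℝ, A * B < 0 → B - A ≠ 0 ∧ 0 < -A / (B - A) ∧ -A / (B - A) ≤ 1 ∧
      sg (B - A) = sg (-A) := by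
    intro B hAB
    rcases lt_trichotomy A 0 with h | h | h
    · have hB : 0 < B := by nlinarith
      refine ⟨by linarith, div_pos (by linarith) (by linarith), ?_, ?_⟩
      · rw [div_le_one (by linarith)]; linarith
      · rw [sg_pos (by linarith), sg_pos (by linarith)]
    · rw [h] at hAB; simp at hAB
    · have hB : B < 0 := by nlinarith
      refine ⟨by linarith, div_pos_of_neg_of_neg (by linarith) (by linarith), ?_, ?_⟩
      · rw [div_le_one_of_neg (by linarith)]; linarith
      · rw [sg_neg (by linarith), sg_neg (by linarith)]
  obtain ⟨hy0, hτ0, hτ1, hσ⟩ := hτ B hxy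
  obtain ⟨hz0, hτ'0, hτ'1, hσ'⟩ := hτ C hxz
  -- The parameters `τ` and `τ'` locate the intersections of the sides `xy` and `xz` with the
  -- hyperplane of `F`.
  set τ := -A / (B - A) with hτdef
  set τ' := -A / (C - A) with hτ'def
  have hτe : τ * (B - A) = -A := div_mul_cancel₀ _ hy0
  have hτ'e : τ' * (C - A) = -A := div_mul_cancel₀ _ hz0
  set p := x + τ • (y - x) with hp
  set q := x + τ' • (z - x) with hq
  have hcxy := crossing_eq hν hf (x := x) (y := y) (τ := τ) ⟨hτ0.le, hτ1⟩ (by rwa [hyx])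
    (by rw [hyx, hfx, hτe])
  have hcxz := crossing_eq hν hf (x := x) (y := z) (τ := τ') ⟨hτ'0.le, hτ'1⟩ (by rwa [hzx])
    (by rw [hzx, hfx, hτ'e])
  have hcyz : crossing F ν y z = 0 := by
    rw [crossing, if_neg]
    rintro ⟨t, ht, h⟩
    have h1 : inner ℝ ν (y + t • (z - y) - f) = 0 := by
      rw [inner_sub_right, hν.inner_eq h hf, sub_self]
    have h2 : y + t • (z - y) - f = (1 - t) • (y - f) + t • (z - f) := by module
    rw [h2, inner_add_right, inner_smul_right, inner_smul_right, ← hB, ← hC] at h1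
    have h3 : (1 - t) * (A * B) + t * (A * C) = 0 := by linear_combination A * h1
    nlinarith [ht.1, ht.2, mul_nonneg ht.1 (neg_nonneg.2 hxz.le),
      mul_nonneg (sub_nonneg.2 ht.2) (neg_nonneg.2 hxy.le)]
  set e := q - p with he
  have heF : e ∈ vectorSpan ℝ F := by
    refine hν.mem_vectorSpan hdim ?_
    rw [he, hq, hp, inner_sub_right, inner_add_right, inner_add_right, inner_smul_right,
      inner_smul_right, hyx, hzx, hτe, hτ'e, sub_self]
  have hpq : p + e = q := by rw [he]; abel
  have hsegtri : ∀ t ∈ Icc (0 : ℝ) 1, p + t • e ∈ tri x y z := by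
    intro t ht
    refine ⟨1 - (1 - t) * τ - t * τ', (1 - t) * τ, t * τ', ?_, ?_, ?_, by ring, ?_⟩
    · have h1 := mul_le_mul_of_nonneg_left hτ1 (sub_nonneg.2 ht.2)
      have h2 := mul_le_mul_of_nonneg_left hτ'1 ht.1
      linarith
    · exact mul_nonneg (sub_nonneg.2 ht.2) hτ0.le
    · exact mul_nonneg ht.1 hτ'0.le
    · rw [he, hp, hq]; module
  have hmeet : ∀ R ⊆ F, (R ∩ tri x y z).Nonempty ↔ ∃ t ∈ Icc (0 : ℝ) 1, p + t • e ∈ R := by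
    intro R hRF
    constructor
    · rintro ⟨r, hr, a, b, c, ha, hb, hc, hsum, hre⟩
      have h1 : inner ℝ ν (r - f) = 0 := by
        rw [inner_sub_right, hν.inner_eq (hRF hr) hf, sub_self]
      have h2 : r - f = a • (x - f) + b • (y - f) + c • (z - f) := by
        rw [hre]
        have : f = (a + b + c) • f := by rw [hsum, one_smul]
        conv_lhs => rw [this]
        module
      rw [h2, inner_add_right, inner_add_right, inner_smul_right, inner_smul_right,
        inner_smul_right, ← hA, ← hB, ← hC] at h1
      have hA0 : A ≠ 0 := by rintro h; rw [h] at hxy; simp at hxy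
      have h3 : b / τ + c / τ' = 1 := by
        rw [hτdef, hτ'def]
        field_simp
        have ha' : a = 1 - b - c := by linarith
        rw [ha'] at h1
        linear_combination -h1
      refine ⟨c / τ', ⟨by positivity, ?_⟩, ?_⟩
      · have : 0 ≤ b / τ := by positivity
        linarith
      · have h4 : p + (c / τ') • e = (b / τ) • p + (c / τ') • q := by
          have : (b / τ) = 1 - c / τ' := by linarith
          rw [this, he]; module
        have h5 : (b / τ) • p + (c / τ') • q = r := by
          have e1 : b / τ * τ = b := div_mul_cancel₀ _ hτ0.ne'
          have e2 : c / τ' * τ' = c := div_mul_cancel₀ _ hτ'0.ne'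
          have e3 : (b / τ) • p + (c / τ') • q = (b / τ + c / τ') • x + (b / τ * τ) • (y - x) +
              (c / τ' * τ') • (z - x) := by
            rw [hp, hq]; module
          rw [e3, h3, e1, e2, hre]
          have ha' : a = 1 - b - c := by linarith
          rw [ha']; module
        rw [h4, h5]
        exact hr
    · rintro ⟨t, ht, h⟩
      exact ⟨_, h, hsegtri t ht⟩
  have hS' : ∀ R, R ∈ S ↔ R ∈ ridges T ∧ R ⊆ F ∧ ∃ t ∈ Icc (0 : ℝ) 1, p + t • e ∈ R := by
    intro R
    rw [hS]
    refine and_congr_right fun _ => and_congr_right fun h => hmeet R h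
  -- Compares the orientation of the triangle around `R` with the direction in which `e` passes `R`.
  -- It follows by evaluating `⟨K e, y - x⟩` in two ways: from `e = τ' • (z - x) - τ • (y - x)`, and
  -- from `K e = ⟨u, e⟩ • K u` with `K u = ±ν`.
  have hid : ∀ R ∈ S, τ' * inner ℝ (K R (y - x)) (z - x) =
      -(inner ℝ (u R) e * inner ℝ ν (K R (u R)) * (B - A)) ∧
      sg (inner ℝ ν (K R (u R))) = inner ℝ ν (K R (u R)) := by
    intro R hRS
    obtain ⟨hR, hRF, -⟩ := (hS R).1 hRS
    have hKR := hK R hR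
    have huR := hu R hR hRF
    have hn := hKR.isFacetNormal hR ⟨hF, hRF⟩ huR
    have h1 := hKR.map_eq hR ⟨hF, hRF⟩ huR heF
    have h2 : inner ℝ (K R e) (y - x) = -(τ' * inner ℝ (K R (y - x)) (z - x)) := by
      have : e = τ' • (z - x) - τ • (y - x) := by rw [he, hp, hq]; abel
      rw [this, map_sub, map_smul, map_smul, inner_sub_left, real_inner_smul_left,
        real_inner_smul_left, hKR.inner_self, hKR.skew (z - x)]
      ring
    have h3 := hν.eq_smul hdim hn.2
    have h4 : inner ℝ (K R (u R)) (y - x) = inner ℝ ν (K R (u R)) * (B - A) := by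
      rw [← hyx]
      conv_lhs => rw [h3]
      rw [real_inner_smul_left]
    rw [h1, real_inner_smul_left, h4] at h2
    refine ⟨by linarith, ?_⟩
    rcases hν.eq_or_eq_neg hdim hn with h5 | h5
    · rw [h5, hν.inner_self, sg_pos one_pos]
    · rw [h5, inner_neg_right, hν.inner_self, sg_neg (by norm_num)]
  have htr : ∀ R ∈ S, inner ℝ (u R) e ≠ 0 := by
    intro R hRS h0
    have h1 := (hid R hRS).1
    rw [h0, zero_mul, zero_mul, neg_zero] at h1
    rcases mul_eq_zero.1 h1 with h | h
    · exact hτ'0.ne' h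
    · exact hg.ridge R ((hS R).1 hRS).1 _ (hK R ((hS R).1 hRS).1) h
  have hsum := hT.sum_sg hF heF (fun K hK hd t ht => hg.low K hK hd _ (hsegtri t ht))
    (fun R hR => hg.seg.1 R (ridges_subset_faces hR) (dim_of_mem_ridges hR).le τ ⟨hτ0.le, hτ1⟩)
    (fun R hR => by
      rw [hpq]
      exact hg.seg.2.2.symm R (ridges_subset_faces hR) (dim_of_mem_ridges hR).le τ'
        ⟨hτ'0.le, hτ'1⟩) hu hS' htr
  rw [hpq] at hsum
  have hterm : ∀ R ∈ S, sg (inner ℝ (K R (y - x)) (z - x)) * inner ℝ ν (K R (u R)) =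
      -sg (-A) * sg (inner ℝ (u R) e) := by
    intro R hRS
    obtain ⟨h1, h2⟩ := hid R hRS
    have h3 := congrArg sg h1
    rw [sg_mul, sg_pos hτ'0, one_mul, sg_neg_eq, sg_mul, sg_mul, hσ] at h3
    have h4 : inner ℝ ν (K R (u R)) ≠ 0 := by
      intro h0
      rw [h0, mul_zero, zero_mul, neg_zero] at h1
      rcases mul_eq_zero.1 h1 with h | h
      · exact hτ'0.ne' h
      · exact hg.ridge R ((hS R).1 hRS).1 _ (hK R ((hS R).1 hRS).1) h
    have h5 := sg_mul_self h4
    rw [h3]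
    rw [h2] at h5 ⊢
    linear_combination (-sg (inner ℝ (u R) e) * sg (-A)) * h5
  rw [Finset.sum_congr rfl hterm, ← Finset.mul_sum, hsum, hcyz, crossing_comm F ν z x, hcxy, hcxz,
    hyx, hzx, hσ, hσ']
  split_ifs <;> ring

/-- No vertex lies on the hyperplane of `F`. Either one vertex is separated from the other two, and
a cyclic rotation, which preserves both sides, makes it the first one; or the triangle misses the
hyperplane and everything is zero. -/
theorem facet_stokes {F : Set (E d)} (hF : F ∈ facets T) {ν x y z : E d}
    (hν : IsFacetNormal F ν) (hg : TriGeneric T x y z)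
    {K : Set (E d) → E d →ₗ[ℝ] E d} (hK : ∀ R ∈ ridges T, IsQuarterTurn (vectorSpan ℝ R) (K R))
    {u : Set (E d) → E d} (hu : ∀ R ∈ ridges T, R ⊆ F → IsInward R F (u R))
    {S : Finset (Set (E d))} (hS : ∀ R, R ∈ S ↔ R ∈ ridges T ∧ R ⊆ F ∧ (R ∩ tri x y z).Nonempty) :
    crossing F ν x y + crossing F ν y z + crossing F ν z x =
      ∑ R ∈ S, sg (inner ℝ (K R (y - x)) (z - x)) * inner ℝ ν (K R (u R)) := by
  have hdim := dim_of_mem_facets hF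
  obtain ⟨f, hf⟩ := nonempty_of_mem_faces (facets_subset_faces hF)
  have hne : ∀ x, x ∉ affineSpan ℝ F → inner ℝ ν (x - f) ≠ 0 := fun x hx h =>
    hx (hν.mem_affineSpan hdim hf (by rw [inner_sub_right] at h; linarith))
  obtain ⟨hx, hy, hz⟩ := hg.facet F hF
  have hx := hne x hx
  have hy := hne y hy
  have hz := hne z hz
  have hrot : ∀ x y z, ∀ R ∈ S, inner ℝ (K R (z - y)) (x - y) = inner ℝ (K R (y - x)) (z - x) :=
    fun x y z R hR => (hK R ((hS R).1 hR).1).rotate x y z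
  by_cases h1 : inner ℝ ν (x - f) * inner ℝ ν (y - f) < 0
  · by_cases h2 : inner ℝ ν (x - f) * inner ℝ ν (z - f) < 0
    · exact hT.facet_stokes_alone hF hν hf hg hK hu hS h1 h2
    · have h2' := lt_of_le_of_ne (not_lt.1 h2) (mul_ne_zero hx hz).symm
      have h3 : inner ℝ ν (y - f) * inner ℝ ν (z - f) < 0 := by
        by_contra h
        have := lt_of_le_of_ne (not_lt.1 h) (mul_ne_zero hy hz).symm
        nlinarith [mul_pos h2' this, mul_self_nonneg (inner ℝ ν (z - f))]
      have := hT.facet_stokes_alone hF hν hf hg.rotate hK hu (S := S)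
        (fun R => by rw [tri_rotate]; exact hS R) h3 (by linarith)
      rw [Finset.sum_congr rfl fun R hR => by rw [hrot x y z R hR]] at this
      linarith
  · have h1' := lt_of_le_of_ne (not_lt.1 h1) (mul_ne_zero hx hy).symm
    by_cases h2 : inner ℝ ν (x - f) * inner ℝ ν (z - f) < 0
    · have h3 : inner ℝ ν (z - f) * inner ℝ ν (y - f) < 0 := by
        by_contra h
        have := lt_of_le_of_ne (not_lt.1 h) (mul_ne_zero hz hy).symm
        nlinarith [mul_pos h1' this, mul_self_nonneg (inner ℝ ν (y - f))]
      have := hT.facet_stokes_alone hF hν hf hg.rotate.rotate hK hu (S := S)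
        (fun R => by rw [tri_rotate, tri_rotate]; exact hS R) (by linarith) h3
      rw [Finset.sum_congr rfl fun R hR => by rw [hrot y z x R hR, hrot x y z R hR]] at this
      linarith
    · have h2' := lt_of_le_of_ne (not_lt.1 h2) (mul_ne_zero hx hz).symm
      have hno : ∀ r ∈ tri x y z, r ∉ F := by
        rintro r ⟨a, b, c, ha, hb, hc, hsum, rfl⟩ hr
        have h4 : inner ℝ ν (a • x + b • y + c • z - f) = 0 := by
          rw [inner_sub_right, hν.inner_eq hr hf, sub_self]
        have h5 : a • x + b • y + c • z - f = a • (x - f) + b • (y - f) + c • (z - f) := by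
          have : f = (a + b + c) • f := by rw [hsum, one_smul]
          conv_lhs => rw [this]
          module
        rw [h5, inner_add_right, inner_add_right, inner_smul_right, inner_smul_right,
          inner_smul_right] at h4
        have h6 : a * (inner ℝ ν (x - f) * inner ℝ ν (x - f)) +
            b * (inner ℝ ν (x - f) * inner ℝ ν (y - f)) +
            c * (inner ℝ ν (x - f) * inner ℝ ν (z - f)) = 0 := by
          linear_combination inner ℝ ν (x - f) * h4
        have h7 : 0 < inner ℝ ν (x - f) * inner ℝ ν (x - f) := mul_self_pos.2 hx
        have e1 := mul_nonneg ha h7.le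
        have e2 := mul_nonneg hb h1'.le
        have e3 := mul_nonneg hc h2'.le
        have f1 : a = 0 := by
          rcases mul_eq_zero.1 (show a * (inner ℝ ν (x - f) * inner ℝ ν (x - f)) = 0 by linarith)
            with h | h
          · exact h
          · exact absurd h h7.ne'
        have f2 : b = 0 := by
          rcases mul_eq_zero.1 (show b * (inner ℝ ν (x - f) * inner ℝ ν (y - f)) = 0 by linarith)
            with h | h
          · exact h
          · exact absurd h h1'.ne'
        have f3 : c = 0 := by
          rcases mul_eq_zero.1 (show c * (inner ℝ ν (x - f) * inner ℝ ν (z - f)) = 0 by linarith)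
            with h | h
          · exact h
          · exact absurd h h2'.ne'
        rw [f1, f2, f3] at hsum
        norm_num at hsum
      have hc1 : crossing F ν x y = 0 := by
        rw [crossing, if_neg]
        rintro ⟨t, ht, h⟩
        exact hno _ ⟨1 - t, t, 0, by linarith [ht.2], ht.1, le_rfl, by ring, by module⟩ h
      have hc2 : crossing F ν y z = 0 := by
        rw [crossing, if_neg]
        rintro ⟨t, ht, h⟩
        exact hno _ ⟨0, 1 - t, t, le_rfl, by linarith [ht.2], ht.1, by ring, by module⟩ h
      have hc3 : crossing F ν z x = 0 := by
        rw [crossing, if_neg]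
        rintro ⟨t, ht, h⟩
        exact hno _ ⟨t, 0, 1 - t, ht.1, le_rfl, by linarith [ht.2], by ring, by module⟩ h
      rw [hc1, hc2, hc3, Finset.sum_eq_zero]
      · norm_num
      · intro R hR
        obtain ⟨-, hRF, r, hr, hr'⟩ := (hS R).1 hR
        exact absurd (hRF hr) (hno r hr')

end IsTiling

/-! ### The increments of a canonical scaling are exact -/

/-- A chosen unit normal of a hyperface. -/
noncomputable def facetNormal (F : Set (E d)) : E d := Classical.epsilon (IsFacetNormal F)

/-- A chosen point of a hyperface. -/
noncomputable def facetPoint (F : Set (E d)) : E d := Classical.epsilon (· ∈ F)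

theorem facetNormal_spec {F : Set (E d)} (hF : F ∈ facets T) : IsFacetNormal F (facetNormal F) :=
  Classical.epsilon_spec (exists_isFacetNormal (dim_of_mem_facets hF))

theorem facetPoint_mem {F : Set (E d)} (hF : F ∈ facets T) : facetPoint F ∈ F :=
  Classical.epsilon_spec (p := (· ∈ F)) (nonempty_of_mem_faces (facets_subset_faces hF))

/-- The pair of the gradient and the constant term of the affine function
`x ↦ ⟨n, x - y⟩`. -/
noncomputable def affinePair (y n : E d) : E d × ℝ := (n, -inner ℝ n y)

/-- The sum of the increments of the scaling `s` along the segment from `a` to `b`. -/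
noncomputable def segSum (T : Set (Set (E d))) (s : Set (E d) → ℝ) (a b : E d) : E d × ℝ :=
  ∑ᶠ F ∈ facets T, (crossing F (facetNormal F) a b * s F) • affinePair (facetPoint F) (facetNormal F)

theorem segSum_comm (s : Set (E d) → ℝ) (a b : E d) : segSum T s a b = -segSum T s b a := by
  simp_rw [segSum, ← finsum_neg_distrib]
  refine finsum_mem_congr rfl fun F _ => ?_
  rw [crossing_comm, neg_mul, neg_smul]

theorem segment_subset_tri {x y z : E d} {t : ℝ} (ht : t ∈ Icc (0 : ℝ) 1) :
    x + t • (y - x) ∈ tri x y z :=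
  ⟨1 - t, t, 0, by linarith [ht.2], ht.1, le_rfl, by ring, by module⟩

theorem tri_subset_convexHull (x y z : E d) : tri x y z ⊆ convexHull ℝ {x, y, z} := by
  rintro r ⟨a, b, c, ha, hb, hc, h, rfl⟩
  have hm : ∀ w ∈ ({x, y, z} : Set (E d)), w ∈ convexHull ℝ ({x, y, z} : Set (E d)) :=
    fun w hw => subset_convexHull ℝ _ hw
  have := (convex_convexHull ℝ ({x, y, z} : Set (E d))).sum_mem
    (t := Finset.univ) (w := ![a, b, c]) (z := ![x, y, z])
    (fun i _ => by fin_cases i <;> simpa) (by simpa [Fin.sum_univ_three] using h)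
    (fun i _ => by fin_cases i <;> exact hm _ (by simp))
  simpa [Fin.sum_univ_three] using this

theorem isCompact_triangle (x y z : E d) : IsCompact (convexHull ℝ ({x, y, z} : Set (E d))) :=
  (toFinite _).isCompact_convexHull ℝ

theorem segSum_eq_sum (s : Set (E d) → ℝ) {x y z : E d} {a b : E d}
    (hab : ∀ t ∈ Icc (0 : ℝ) 1, a + t • (b - a) ∈ tri x y z) {S : Finset (Set (E d))}
    (hS : ∀ F, F ∈ S ↔ F ∈ facets T ∧ (F ∩ tri x y z).Nonempty) :
    segSum T s a b = ∑ F ∈ S, (crossing F (facetNormal F) a b * s F) •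
      affinePair (facetPoint F) (facetNormal F) := by
  rw [segSum, finsum_mem_eq_sum_of_inter_support_eq]
  ext F
  simp only [mem_inter_iff, Function.mem_support, SetLike.mem_coe]
  refine and_congr_left fun h => ⟨fun hF => (hS F).2 ⟨hF, ?_⟩, fun h => ((hS F).1 h).1⟩
  by_contra hcon
  apply h
  rw [crossing, if_neg, zero_mul, zero_smul]
  rintro ⟨t, ht, htF⟩
  exact hcon ⟨_, htF, hab t ht⟩

namespace IsTiling

variable (hT : IsTiling T)
include hT

theorem exists_frame {s : Set (E d) → ℝ} (hs : ZeroTorsion T s) {R : Set (E d)}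
    (hR : R ∈ ridges T) : ∃ (K : E d →ₗ[ℝ] E d) (u : Set (E d) → E d),
      IsQuarterTurn (vectorSpan ℝ R) K ∧ (∀ F ∈ facetsAround T R, IsInward R F (u F)) ∧
      ∑ᶠ F ∈ facetsAround T R, s F • K (u F) = 0 := by
  obtain ⟨J, hJ⟩ := exists_quarterTurn_isometry (dim_of_mem_ridges hR)
  obtain ⟨K, hK, hKJ⟩ := isQuarterTurn_of_isometry J hJ
  have hex : ∀ F, ∃ u, F ∈ facetsAround T R → IsInward R F u := fun F => by
    by_cases hF : F ∈ facetsAround T R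
    · obtain ⟨u, hu⟩ := hT.exists_isInward hR hF
      exact ⟨u, fun _ => hu⟩
    · exact ⟨0, fun h => absurd h hF⟩
  choose u hu using hex
  refine ⟨K, u, hK, hu, hs R hR (fun F => K (u F)) ⟨J, hJ, fun F hF => ?_⟩⟩
  have h := hu F hF
  exact ⟨⟨u F, h.orth⟩, by simpa using h.norm_eq, h.mem, h.nonneg, hKJ ⟨u F, h.orth⟩⟩

/-- The increments of a scaling with zero torsion add up to zero around a generic triangle. -/
theorem segSum_triangle {s : Set (E d) → ℝ} (hs : ZeroTorsion T s) {x y z : E d}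
    (hg : TriGeneric T x y z) : segSum T s x y + segSum T s y z + segSum T s z x = 0 := by
  classical
  have hframe : ∀ R, ∃ (K : E d →ₗ[ℝ] E d) (u : Set (E d) → E d), R ∈ ridges T →
      IsQuarterTurn (vectorSpan ℝ R) K ∧ (∀ F ∈ facetsAround T R, IsInward R F (u F)) ∧
      ∑ᶠ F ∈ facetsAround T R, s F • K (u F) = 0 := fun R => by
    by_cases hR : R ∈ ridges T
    · obtain ⟨K, u, h⟩ := hT.exists_frame hs hR
      exact ⟨K, u, fun _ => h⟩
    · exact ⟨0, 0, fun h => absurd h hR⟩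
  choose K u hKu using hframe
  have hfin := hT.finite_faces (isCompact_triangle x y z)
  have hsub : ∀ {A : Set (E d)}, (A ∩ tri x y z).Nonempty →
      (A ∩ convexHull ℝ {x, y, z}).Nonempty :=
    fun h => h.mono (inter_subset_inter_right _ (tri_subset_convexHull x y z))
  have hfinF : {F | F ∈ facets T ∧ (F ∩ tri x y z).Nonempty}.Finite :=
    hfin.subset fun F hF => ⟨facets_subset_faces hF.1, hsub hF.2⟩
  have hfinR : {R | R ∈ ridges T ∧ (R ∩ tri x y z).Nonempty}.Finite :=
    hfin.subset fun F hF => ⟨ridges_subset_faces hF.1, hsub hF.2⟩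
  set SF := hfinF.toFinset with hSF
  set SR := hfinR.toFinset with hSR
  have hSF' : ∀ F, F ∈ SF ↔ F ∈ facets T ∧ (F ∩ tri x y z).Nonempty := fun F => by simp [hSF]
  have hSR' : ∀ R, R ∈ SR ↔ R ∈ ridges T ∧ (R ∩ tri x y z).Nonempty := fun F => by simp [hSR]
  rw [segSum_eq_sum s (fun t ht => segment_subset_tri ht) hSF',
    segSum_eq_sum s (x := x) (y := y) (z := z)
      (fun t ht => by rw [← tri_rotate]; exact segment_subset_tri ht) hSF',
    segSum_eq_sum s (x := x) (y := y) (z := z)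
      (fun t ht => by rw [← tri_rotate, ← tri_rotate]; exact segment_subset_tri ht) hSF',
    ← Finset.sum_add_distrib, ← Finset.sum_add_distrib]
  -- The discrete Stokes formula turns the contribution of each hyperface into a sum over its ridges
  -- met by the triangle, so that the order of summation can be exchanged.
  have h1 : ∀ F ∈ SF, (crossing F (facetNormal F) x y * s F) •
        affinePair (facetPoint F) (facetNormal F) + (crossing F (facetNormal F) y z * s F) •
        affinePair (facetPoint F) (facetNormal F) + (crossing F (facetNormal F) z x * s F) •
        affinePair (facetPoint F) (facetNormal F) =
      ∑ R ∈ SR, if R ⊆ F then sg (inner ℝ (K R (y - x)) (z - x)) • s F •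
        (inner ℝ (facetNormal F) (K R (u R F)) • affinePair (facetPoint F) (facetNormal F))
        else 0 := by
    intro F hF
    obtain ⟨hF, -⟩ := (hSF' F).1 hF
    have := hT.facet_stokes hF (facetNormal_spec hF) hg (fun R hR => (hKu R hR).1)
      (u := fun R => u R F) (fun R hR hRF => (hKu R hR).2.1 F ⟨hF, hRF⟩)
      (S := SR.filter (· ⊆ F)) (fun R => by rw [Finset.mem_filter, hSR']; tauto)
    rw [← add_smul, ← add_smul, ← add_mul, ← add_mul, this, ← Finset.sum_filter, Finset.sum_mul,
      Finset.sum_smul]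
    refine Finset.sum_congr rfl fun R _ => ?_
    rw [smul_smul, smul_smul]
    congr 1
    ring
  rw [Finset.sum_congr rfl h1, Finset.sum_comm]
  refine Finset.sum_eq_zero fun R hR => ?_
  obtain ⟨hR, r, hr, hrtri⟩ := (hSR' R).1 hR
  obtain ⟨hK, hu, hsum⟩ := hKu R hR
  have h2 : ∑ᶠ F ∈ facetsAround T R, s F • K R (u R F) =
      ∑ F ∈ SF.filter (R ⊆ ·), s F • K R (u R F) := by
    rw [finsum_mem_eq_sum_of_inter_support_eq]
    congr 1
    ext F
    simp only [Finset.coe_filter, mem_ofPred_eq, hSF']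
    exact ⟨fun h => ⟨⟨h.1, r, h.2 hr, hrtri⟩, h.2⟩, fun h => ⟨h.1.1, h.2⟩⟩
  rw [h2] at hsum
  rw [← Finset.sum_filter, ← Finset.smul_sum]
  -- The inner product is the sign that converts the chosen normal into the coherent one. Since
  -- every `F` contains the same point `r`, the pair is a linear function of `s F • K (u F)`, so
  -- zero torsion kills gradient and constant term alike.
  have h3 : ∀ F ∈ SF.filter (R ⊆ ·), s F • (inner ℝ (facetNormal F) (K R (u R F)) •
      affinePair (facetPoint F) (facetNormal F)) =
      (s F • K R (u R F), -inner ℝ (s F • K R (u R F)) r) := by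
    intro F hF
    obtain ⟨hF, hRF⟩ := Finset.mem_filter.1 hF
    obtain ⟨hF, -⟩ := (hSF' F).1 hF
    have hn := hK.isFacetNormal hR ⟨hF, hRF⟩ (hu F ⟨hF, hRF⟩)
    have e := (facetNormal_spec hF).eq_smul (dim_of_mem_facets hF) hn.2
    have e2 := (facetNormal_spec hF).inner_eq (facetPoint_mem hF) (hRF hr)
    refine Prod.ext ?_ ?_
    · simp only [affinePair, Prod.smul_mk]
      rw [← e]
    · simp only [affinePair, Prod.smul_mk, smul_eq_mul]
      rw [real_inner_smul_left]
      conv_rhs => rw [e]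
      rw [real_inner_smul_left, e2]
      ring
  rw [Finset.sum_congr rfl h3]
  have h4 : ∑ F ∈ SF.filter (R ⊆ ·), ((s F • K R (u R F), -inner ℝ (s F • K R (u R F)) r) : E d × ℝ)
      = 0 := by
    refine Prod.ext ?_ ?_
    · rw [Prod.fst_sum]; exact hsum
    · rw [Prod.snd_sum, Finset.sum_neg_distrib, ← sum_inner, hsum, inner_zero_left, neg_zero]
      rfl
  rw [h4, smul_zero]

end IsTiling

/-! ### Generic choices -/

/-- `x` lies on no affine hull of a proper face. -/
def PointGeneric (T : Set (Set (E d))) (x : E d) : Prop :=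
  ∀ K ∈ faces T, dim K + 1 ≤ d → x ∉ affineSpan ℝ K

/-- General position of a pair of points. -/
structure PairGeneric (T : Set (Set (E d))) (x y : E d) : Prop where
  left : PointGeneric T x
  right : PointGeneric T y
  seg : SegGeneric T x y
  ridge : ∀ R ∈ ridges T, y - x ∉ vectorSpan ℝ R

/-- The affine subspaces to be avoided by the second point of a generic pair. -/
def avoidPair (T : Set (Set (E d))) (x : E d) : Set (AffineSubspace ℝ (E d)) :=
  (affineSpan ℝ '' {K | K ∈ faces T ∧ dim K + 1 ≤ d}) ∪
  ((fun K => affineSpan ℝ (insert x K)) '' {K | K ∈ faces T ∧ dim K + 2 ≤ d}) ∪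
  ((fun R => AffineSubspace.mk' x (vectorSpan ℝ R)) '' ridges T)

/-- The affine subspaces to be avoided by the third vertex of a generic triangle. -/
def avoidTri (T : Set (Set (E d))) (x y : E d) : Set (AffineSubspace ℝ (E d)) :=
  avoidPair T x ∪ avoidPair T y ∪
  ((fun K => affineSpan ℝ (insert x (insert y K))) '' {K | K ∈ faces T ∧ dim K + 3 ≤ d}) ∪
  ((fun R => AffineSubspace.mk' x (vectorSpan ℝ R ⊔ (ℝ ∙ (y - x)))) '' ridges T)

theorem mk'_ne_top {x : E d} {W : Submodule ℝ (E d)} (h : Module.finrank ℝ W + 1 ≤ d) :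
    AffineSubspace.mk' x W ≠ ⊤ := by
  intro h'
  have h1 := AffineSubspace.direction_mk' x W
  rw [h', AffineSubspace.direction_top] at h1
  rw [← h1, finrank_top, finrank_euclideanSpace_fin] at h
  omega

theorem IsTiling.countable_ridges (hT : IsTiling T) : (ridges T).Countable :=
  hT.countable_faces.mono fun _ => ridges_subset_faces

theorem IsTiling.countable_avoidPair (hT : IsTiling T) (x : E d) : (avoidPair T x).Countable :=
  (((hT.countable_faces.mono fun _ h => h.1).image _).union
    ((hT.countable_faces.mono fun _ h => h.1).image _)).union (hT.countable_ridges.image _)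

theorem IsTiling.countable_avoidTri (hT : IsTiling T) (x y : E d) : (avoidTri T x y).Countable :=
  (((hT.countable_avoidPair x).union (hT.countable_avoidPair y)).union
    ((hT.countable_faces.mono fun _ h => h.1).image _)).union (hT.countable_ridges.image _)

theorem avoidPair_ne_top {x : E d} {A : AffineSubspace ℝ (E d)} (hA : A ∈ avoidPair T x) :
    A ≠ ⊤ := by
  rcases hA with (⟨K, hK, rfl⟩ | ⟨K, hK, rfl⟩) | ⟨R, hR, rfl⟩
  · exact affineSpan_ne_top hK.2
  · refine affineSpan_ne_top ?_
    have := dim_insert_le x K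
    have := hK.2
    omega
  · refine mk'_ne_top ?_
    have := dim_of_mem_ridges hR
    rw [dim] at this
    omega

theorem avoidTri_ne_top {x y : E d} {A : AffineSubspace ℝ (E d)} (hA : A ∈ avoidTri T x y) :
    A ≠ ⊤ := by
  rcases hA with ((hA | hA) | ⟨K, hK, rfl⟩) | ⟨R, hR, rfl⟩
  · exact avoidPair_ne_top hA
  · exact avoidPair_ne_top hA
  · refine affineSpan_ne_top ?_
    have := dim_insert_le y K
    have := dim_insert_le x (insert y K)
    have := hK.2
    omega
  · refine mk'_ne_top ?_
    have h1 := dim_of_mem_ridges hR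
    rw [dim] at h1
    have h2 := Submodule.finrank_add_le_finrank_add_finrank (vectorSpan ℝ R) (ℝ ∙ (y - x))
    have h3 : Module.finrank ℝ (ℝ ∙ (y - x)) ≤ 1 := by
      simpa using finrank_span_le_card (R := ℝ) ({y - x} : Set (E d))
    omega

theorem pairGeneric_of_avoid {x y : E d} (hx : PointGeneric T x)
    (hy : ∀ A ∈ avoidPair T x, y ∉ A) : PairGeneric T x y where
  left := hx
  right K hK hd := hy _ (Or.inl (Or.inl ⟨K, ⟨hK, hd⟩, rfl⟩))
  seg K hK hd t _ h := hy _ (Or.inl (Or.inr ⟨K, ⟨hK, hd⟩, rfl⟩))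
    (mem_affineSpan_insert_of_segment
      (fun hxK => hx K hK (by omega) (subset_affineSpan ℝ K hxK)) h)
  ridge R hR h := hy _ (Or.inr ⟨R, hR, rfl⟩) (by
    rw [AffineSubspace.mem_mk']; exact h)

/-- `K v` is nonzero and orthogonal to the hyperplane `W ⊔ (ℝ ∙ v)`, so this hyperplane is its whole
orthogonal complement. -/
theorem IsQuarterTurn.inner_ne_zero {W : Submodule ℝ (E d)} {K : E d →ₗ[ℝ] E d}
    (hK : IsQuarterTurn W K) (hW : Module.finrank ℝ W + 2 = d) {v w : E d} (hv : v ∉ W)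
    (hw : w ∉ W ⊔ (ℝ ∙ v)) : inner ℝ (K v) w ≠ 0 := by
  intro h0
  have hKv : K v ≠ 0 := by
    intro h
    obtain ⟨a, ha, b, hb, rfl⟩ := W.exists_add_mem_mem_orthogonal v
    rw [map_add, hK.map_mem a ha, zero_add] at h
    have h1 := hK.isometry b hb b hb
    rw [h, inner_zero_left] at h1
    rw [inner_self_eq_zero.1 h1.symm, add_zero] at hv
    exact hv ha
  have hle : W ⊔ (ℝ ∙ v) ≤ (ℝ ∙ K v)ᗮ := by
    refine sup_le (fun a ha => ?_) ?_
    · rw [Submodule.mem_orthogonal_singleton_iff_inner_right]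
      exact hK.inner_mem v ha
    · rw [Submodule.span_singleton_le_iff_mem, Submodule.mem_orthogonal_singleton_iff_inner_right]
      exact hK.inner_self v
  have hlt : W < W ⊔ (ℝ ∙ v) := by
    refine lt_of_le_of_ne le_sup_left fun h => hv ?_
    rw [h]
    exact Submodule.mem_sup_right (Submodule.mem_span_singleton_self v)
  have h1 := Submodule.finrank_lt_finrank_of_lt hlt
  have : Fact (Module.finrank ℝ (E d) = (Module.finrank ℝ W + 1) + 1) :=
    ⟨by rw [finrank_euclideanSpace_fin]; omega⟩
  have h2 : Module.finrank ℝ (ℝ ∙ K v)ᗮ = Module.finrank ℝ W + 1 :=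
    Submodule.finrank_orthogonal_span_singleton hKv
  apply hw
  rw [Submodule.eq_of_le_of_finrank_le hle (by omega),
    Submodule.mem_orthogonal_singleton_iff_inner_right]
  exact h0

theorem triGeneric_of_avoid {x y z : E d} (h : PairGeneric T x y)
    (hz : ∀ A ∈ avoidTri T x y, z ∉ A) :
    TriGeneric T x y z ∧ PairGeneric T x z ∧ PairGeneric T y z := by
  have hxz : PairGeneric T x z :=
    pairGeneric_of_avoid h.left fun A hA => hz A (Or.inl (Or.inl (Or.inl hA)))
  have hyz : PairGeneric T y z :=
    pairGeneric_of_avoid h.right fun A hA => hz A (Or.inl (Or.inl (Or.inr hA)))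
  refine ⟨⟨fun F hF => ?_, ⟨h.seg, hyz.seg, hxz.seg.symm⟩, ?_, fun R hR K hK => ?_⟩, hxz, hyz⟩
  · have h1 := facets_subset_faces hF
    have h2 := (dim_of_mem_facets hF).le
    exact ⟨h.left F h1 h2, h.right F h1 h2, hyz.right F h1 h2⟩
  · rintro K hK hd r ⟨a, b, c, ha, hb, hc, hsum, rfl⟩ hr
    -- For `c = 0` the point lies on the side `xy`, which is already generic. Otherwise `z` can be
    -- solved for and falls into the affine hull of `x`, `y` and `K`, of dimension less than `d`.
    by_cases hc0 : c = 0
    · refine h.seg K hK (by omega) b ⟨hb, by linarith⟩ ?_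
      convert hr using 1
      have : a = 1 - b := by linarith
      rw [hc0, this]; module
    · refine hz _ (Or.inl (Or.inr ⟨K, ⟨hK, hd⟩, rfl⟩)) ?_
      set A := affineSpan ℝ (insert x (insert y K))
      have hxA : x ∈ A := subset_affineSpan ℝ _ (mem_insert _ _)
      have hyA : y ∈ A := subset_affineSpan ℝ _ (mem_insert_of_mem _ (mem_insert _ _))
      have hrA : a • x + b • y + c • z ∈ A :=
        subset_affineSpan ℝ _ (mem_insert_of_mem _ (mem_insert_of_mem _ hr))
      have h1 : (a • x + b • y + c • z) - x ∈ A.direction := AffineSubspace.vsub_mem_direction hrA hxA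
      have h2 : y - x ∈ A.direction := AffineSubspace.vsub_mem_direction hyA hxA
      have h3 : z - x ∈ A.direction := by
        have e : z - x = c⁻¹ • (((a • x + b • y + c • z) - x) - b • (y - x)) := by
          have ha' : a = 1 - b - c := by linarith
          have e1 : ((a • x + b • y + c • z) - x) - b • (y - x) = c • (z - x) := by
            rw [ha']; module
          rw [e1, smul_smul, inv_mul_cancel₀ hc0, one_smul]
        rw [e]
        exact Submodule.smul_mem _ _ (sub_mem h1 (Submodule.smul_mem _ _ h2))
      have := AffineSubspace.vadd_mem_of_mem_direction h3 hxA
      simpa using this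
  · refine hK.inner_ne_zero (dim_of_mem_ridges hR) (h.ridge R hR) fun hmem => ?_
    refine hz _ (Or.inr ⟨R, hR, rfl⟩) ?_
    rw [AffineSubspace.mem_mk']
    exact hmem

namespace IsTiling

variable (hT : IsTiling T)
include hT

theorem exists_pointGeneric {U : Set (E d)} (hU : IsOpen U) (hU' : U.Nonempty) :
    ∃ x ∈ U, PointGeneric T x := by
  obtain ⟨x, hx, h⟩ := exists_mem_avoiding
    (S := affineSpan ℝ '' {K | K ∈ faces T ∧ dim K + 1 ≤ d})
    ((hT.countable_faces.mono fun _ h => h.1).image _)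
    (by rintro _ ⟨K, hK, rfl⟩; exact affineSpan_ne_top hK.2) hU hU'
  exact ⟨x, hx, fun K hK hd => h _ ⟨K, ⟨hK, hd⟩, rfl⟩⟩

theorem exists_pairGeneric {x : E d} (hx : PointGeneric T x) {U : Set (E d)} (hU : IsOpen U)
    (hU' : U.Nonempty) : ∃ y ∈ U, PairGeneric T x y := by
  obtain ⟨y, hy, h⟩ := exists_mem_avoiding (hT.countable_avoidPair x)
    (fun A hA => avoidPair_ne_top hA) hU hU'
  exact ⟨y, hy, pairGeneric_of_avoid hx h⟩

/-- One third vertex serves two triangles at once, so that triangles can be glued along a common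
generic side. -/
theorem exists_triGeneric {x y y' : E d} (h : PairGeneric T x y) (h' : PairGeneric T x y')
    {U : Set (E d)} (hU : IsOpen U) (hU' : U.Nonempty) :
    ∃ z ∈ U, TriGeneric T x y z ∧ TriGeneric T x y' z ∧ PairGeneric T x z := by
  obtain ⟨z, hz, hav⟩ := exists_mem_avoiding
    ((hT.countable_avoidTri x y).union (hT.countable_avoidTri x y'))
    (fun A hA => hA.elim avoidTri_ne_top avoidTri_ne_top) hU hU'
  have h1 := triGeneric_of_avoid h fun A hA => hav A (Or.inl hA)
  have h2 := triGeneric_of_avoid h' fun A hA => hav A (Or.inr hA)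
  exact ⟨z, hz, h1.1, h2.1, h1.2.1⟩

/-! ### Integrating the increments -/

theorem segSum_of_mem_interior (s : Set (E d) → ℝ) {P : Set (E d)} (hP : P ∈ T) {a b : E d}
    (ha : a ∈ interior P) (hb : b ∈ interior P) : segSum T s a b = 0 := by
  refine finsum_mem_eq_zero_of_forall_eq_zero fun F hF => ?_
  rw [crossing, if_neg, zero_mul, zero_smul]
  rintro ⟨t, ht, h⟩
  exact hT.notMem_of_mem_interior hP (facets_subset_faces hF) (dim_of_mem_facets hF).le
    ((hT.convex hP).interior.add_smul_sub_mem ha hb ht) h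

theorem eq_or_eq_of_subset {P Q A : Set (E d)} (h : Adjacent T P Q) (hA : A ∈ T)
    (hPA : P ∩ Q ⊆ A) : A = P ∨ A = Q := by
  obtain ⟨ν, hν, hP, hQ⟩ := hT.exists_normal_of_adjacent h
  rcases hT.eq_side_or (hT.inter_mem_facets h) hν hA hPA with h1 | h1
  · right; rw [h1]; exact hQ.symm
  · left; rw [h1]; exact hP.symm

/-- Near a relative interior point `f` of the common hyperface only `P` and `Q` occur, so the
segment meets no other hyperface. Replacing the chosen normal by its negative changes the sign of
the crossing too, and the choice of the point on the hyperface does not affect the affine function.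
-/
theorem segSum_adjacent (s : Set (E d) → ℝ) {P Q : Set (E d)} (h : Adjacent T P Q) {f a b x : E d}
    {U : Set (E d)} (hUc : Convex ℝ U) (hf : RelInt (P ∩ Q) f)
    (hU : ∀ y ∈ U, ∀ A ∈ T, y ∈ A → f ∈ A) (ha : a ∈ interior P) (haU : a ∈ U)
    (hb : b ∈ interior Q) (hbU : b ∈ U) (hx : x ∈ P ∩ Q) :
    segSum T s a b = s (P ∩ Q) • affinePair x (unitNormal P Q) := by
  have hF := hT.inter_mem_facets h
  have hface := (hT.faceToFace P h.1 Q h.2.1 h.2.2.1 h.2.2.2.1).1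
  have hcell : ∀ y ∈ U, ∀ A ∈ T, y ∈ A → A = P ∨ A = Q := fun y hy A hA hyA =>
    hT.eq_or_eq_of_subset h hA (hT.subset_of_relInt h.1 hA hface hf (hU y hy A hA hyA))
  have hseg : ∀ t ∈ Icc (0 : ℝ) 1, a + t • (b - a) ∈ U := fun t ht => hUc.add_smul_sub_mem haU hbU ht
  -- The unit interval is connected and covered by the two closed sets of times spent in `P` and in
  -- `Q`.
  have hmeet : ∃ t ∈ Icc (0 : ℝ) 1, a + t • (b - a) ∈ P ∩ Q := by
    have hc : Continuous fun t : ℝ => a + t • (b - a) := by fun_prop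
    have hpre := isPreconnected_closed_iff.1 (isPreconnected_Icc (a := (0 : ℝ)) (b := 1))
      _ _ ((hT.isClosed h.1).preimage hc) ((hT.isClosed h.2.1).preimage hc)
      (fun t ht => by
        obtain ⟨A, hA, htA⟩ := hT.exists_cell (a + t • (b - a))
        rcases hcell _ (hseg t ht) A hA htA with rfl | rfl
        · exact Or.inl htA
        · exact Or.inr htA)
      ⟨0, by simp, by simpa using interior_subset ha⟩
      ⟨1, by simp, by simpa using interior_subset hb⟩
    obtain ⟨t, ht, h1, h2⟩ := hpre
    exact ⟨t, ht, h1, h2⟩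
  have hother : ∀ F ∈ facets T, F ≠ P ∩ Q → crossing F (facetNormal F) a b = 0 := by
    intro F hF' hne
    rw [crossing, if_neg]
    rintro ⟨t, ht, htF⟩
    apply hne
    have hν := facetNormal_spec hF'
    obtain ⟨h1, h2, -⟩ := hT.side_spec hF' hν
    obtain ⟨h1', h2', -⟩ := hT.side_spec hF' hν.neg
    have hsi := hT.side_inter hF' hν
    have hsn := hT.side_ne hF' hν
    have c1 := hcell _ (hseg t ht) _ h1 (h2 htF)
    have c2 := hcell _ (hseg t ht) _ h1' (h2' htF)
    rcases c1 with c1 | c1 <;> rcases c2 with c2 | c2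
    · exact absurd (c2.trans c1.symm) hsn
    · rw [← hsi, c1, c2, inter_comm]
    · rw [← hsi, c1, c2]
    · exact absurd (c2.trans c1.symm) hsn
  rw [segSum, finsum_mem_eq_sum_of_subset (t := {P ∩ Q}), Finset.sum_singleton, crossing,
    if_pos hmeet]
  · obtain ⟨hn, hQs, hPs⟩ := hT.unitNormal_spec h
    have hν := facetNormal_spec hF
    have hpos : 0 < inner ℝ (unitNormal P Q) (b - a) := by
      have h1 := inner_lt_of_mem_interior hn.ne_zero (hQs x hx) hb
      have h2 := hPs x hx a (interior_subset ha)
      rw [inner_neg_left, inner_neg_left] at h2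
      rw [inner_sub_right]
      linarith
    have hpt : inner ℝ (unitNormal P Q) (facetPoint (P ∩ Q)) = inner ℝ (unitNormal P Q) x :=
      hn.inner_eq (facetPoint_mem hF) hx
    rcases hn.eq_or_eq_neg (dim_of_mem_facets hF) hν with h1 | h1
    · rw [h1, sg_pos hpos, one_mul, affinePair, affinePair, hpt]
    · rw [h1, inner_neg_left, sg_neg (by linarith), affinePair, affinePair, inner_neg_left, hpt,
        ← Prod.neg_mk, smul_neg, neg_one_mul, neg_smul, neg_neg]
  · rintro F ⟨hF', hne⟩
    rw [Finset.coe_singleton, mem_singleton_iff]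
    by_contra hcon
    apply hne
    simp only [hother F hF' hcon, zero_mul, zero_smul]
  · simpa using hF

/-- Integration of a scaling with zero torsion: the increments across hyperfaces are the
differences of affine functions attached to the cells. -/
theorem exists_potential {s : Set (E d) → ℝ} (hs : ZeroTorsion T s) {P₀ : Set (E d)}
    (hP₀ : P₀ ∈ T) : ∃ g : Set (E d) → E d × ℝ, g P₀ = 0 ∧ ∀ P Q, Adjacent T P Q → ∀ x ∈ P ∩ Q,
      g Q - g P = s (P ∩ Q) • affinePair x (unitNormal P Q) := by
  obtain ⟨y₀, -, hy₀⟩ := hT.exists_pointGeneric isOpen_interior (hT.fullDim P₀ hP₀)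
  have hex : ∀ P, ∃ z, P ∈ T → z ∈ interior P ∧ PairGeneric T y₀ z := fun P => by
    by_cases hP : P ∈ T
    · obtain ⟨z, hz, h⟩ := hT.exists_pairGeneric hy₀ isOpen_interior (hT.fullDim P hP)
      exact ⟨z, fun _ => ⟨hz, h⟩⟩
    · exact ⟨0, fun h => absurd h hP⟩
  choose z hz using hex
  have key : ∀ P Q, Adjacent T P Q → ∀ x ∈ P ∩ Q,
      segSum T s y₀ (z Q) - segSum T s y₀ (z P) = s (P ∩ Q) • affinePair x (unitNormal P Q) := by
    intro P Q h x hx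
    obtain ⟨f, hf⟩ := exists_relInt ((hT.convex h.1).inter (hT.convex h.2.1)) ⟨x, hx⟩
    obtain ⟨ε, hε, hU⟩ := Metric.eventually_nhds_iff_ball.1 (hT.eventually_cells f)
    have hne : ∀ A ∈ T, f ∈ A → (interior A ∩ Metric.ball f ε).Nonempty := by
      intro A hA hfA
      rw [← hT.closure_interior hA, mem_closure_iff] at hfA
      obtain ⟨y, hy, hy'⟩ := hfA _ Metric.isOpen_ball (Metric.mem_ball_self hε)
      exact ⟨y, hy', hy⟩
    obtain ⟨hzP, hgP⟩ := hz P h.1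
    obtain ⟨hzQ, hgQ⟩ := hz Q h.2.1
    -- Pass from `z P` to `w` inside `P`, cross to `w'` near `f`, and pass to `z Q` inside `Q`. The
    -- triangles from `y₀` over these three moves are generic, and only the middle move contributes
    -- an increment.
    obtain ⟨w, ⟨hw, hwU⟩, hw1, -, hw2⟩ := hT.exists_triGeneric hgP hgP
      (isOpen_interior.inter Metric.isOpen_ball) (hne P h.1 hf.mem.1)
    obtain ⟨w', ⟨hw', hw'U⟩, hw'1, hw'2, -⟩ := hT.exists_triGeneric hw2 hgQ
      (isOpen_interior.inter Metric.isOpen_ball) (hne Q h.2.1 hf.mem.2)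
    have e1 := hT.segSum_triangle hs hw1
    have e2 := hT.segSum_triangle hs hw'1
    have e3 := hT.segSum_triangle hs hw'2
    rw [hT.segSum_of_mem_interior s h.1 hzP hw, segSum_comm s w y₀] at e1
    rw [hT.segSum_of_mem_interior s h.2.1 hzQ hw', segSum_comm s w' y₀] at e3
    rw [segSum_comm s w' y₀, hT.segSum_adjacent s h (convex_ball f ε) hf hU hw hwU hw' hw'U hx] at e2
    have e1' : segSum T s y₀ (z P) = segSum T s y₀ w := by
      rw [← sub_eq_zero, ← e1]; abel
    have e3' : segSum T s y₀ (z Q) = segSum T s y₀ w' := by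
      rw [← sub_eq_zero, ← e3]; abel
    rw [e1', e3', ← sub_eq_zero, ← neg_eq_zero, ← e2]
    abel
  refine ⟨fun P => segSum T s y₀ (z P) - segSum T s y₀ (z P₀), sub_self _, fun P Q h x hx => ?_⟩
  rw [← key P Q h x hx]
  exact sub_sub_sub_cancel_right _ _ _

end IsTiling

/-! ### Graphs of affine functions -/

/-- The value at `x` of the affine function with gradient `g.1` and constant term `g.2`. -/
noncomputable def evalPair (g : E d × ℝ) (x : E d) : ℝ := inner ℝ g.1 x + g.2

/-- The affine map of `E d` onto the graph of an affine function. -/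
noncomputable def liftMap (g : E d × ℝ) : E d →ᵃ[ℝ] E' d where
  toFun x := WithLp.toLp 2 (x, evalPair g x)
  linear := (WithLp.linearEquiv 2 ℝ (E d × ℝ)).symm.toLinearMap ∘ₗ
    LinearMap.prod LinearMap.id (innerₗ (E d) g.1)
  map_vadd' x v := by
    apply (WithLp.linearEquiv 2 ℝ (E d × ℝ)).injective
    simp [evalPair, inner_add_right, add_assoc]

/-- The graph over `P` of an affine function. -/
noncomputable def graphOver (g : E d × ℝ) (P : Set (E d)) : Set (E' d) := liftMap g '' P

/-- The normal with last coordinate `-1` of the graph of an affine function. -/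
noncomputable def graphNormal (g : E d × ℝ) : E' d := WithLp.toLp 2 (g.1, -1)

@[simp] theorem liftMap_fst (g : E d × ℝ) (x : E d) : (liftMap g x).fst = x := rfl

@[simp] theorem liftMap_snd (g : E d × ℝ) (x : E d) : (liftMap g x).snd = evalPair g x := rfl

@[simp] theorem graphNormal_fst (g : E d × ℝ) : (graphNormal g).fst = g.1 := rfl

@[simp] theorem graphNormal_snd (g : E d × ℝ) : (graphNormal g).snd = -1 := rfl

theorem E'_ext {p q : E' d} (h1 : p.fst = q.fst) (h2 : p.snd = q.snd) : p = q := by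
  apply (WithLp.linearEquiv 2 ℝ (E d × ℝ)).injective
  exact Prod.ext h1 h2

theorem inner_E' (p q : E' d) : inner ℝ p q = inner ℝ p.fst q.fst + p.snd * q.snd := by
  rw [WithLp.prod_inner_apply]
  congr 1
  simp [mul_comm]

theorem mem_graphOver {g : E d × ℝ} {P : Set (E d)} {p : E' d} :
    p ∈ graphOver g P ↔ p.fst ∈ P ∧ p.snd = evalPair g p.fst := by
  constructor
  · rintro ⟨x, hx, rfl⟩
    exact ⟨hx, rfl⟩
  · rintro ⟨h1, h2⟩
    exact ⟨p.fst, h1, E'_ext rfl h2.symm⟩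

theorem proj_graphOver (g : E d × ℝ) (P : Set (E d)) : proj (graphOver g P) = P := by
  ext x
  constructor
  · rintro ⟨p, hp, rfl⟩
    exact (mem_graphOver.1 hp).1
  · intro hx
    exact ⟨liftMap g x, ⟨x, hx, rfl⟩, rfl⟩

theorem graphOver_congr {g g' : E d × ℝ} {P : Set (E d)}
    (h : ∀ x ∈ P, evalPair g x = evalPair g' x) : graphOver g P = graphOver g' P := by
  ext p
  rw [mem_graphOver, mem_graphOver]
  exact and_congr_right fun hp => by rw [h _ hp]

theorem graphOver_inter {g g' : E d × ℝ} {P Q : Set (E d)}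
    (h : ∀ x ∈ P ∩ Q, evalPair g x = evalPair g' x) :
    graphOver g P ∩ graphOver g' Q = graphOver g (P ∩ Q) := by
  ext p
  rw [mem_inter_iff, mem_graphOver, mem_graphOver, mem_graphOver]
  constructor
  · rintro ⟨⟨h1, h2⟩, h3, -⟩
    exact ⟨⟨h1, h3⟩, h2⟩
  · rintro ⟨h1, h2⟩
    exact ⟨⟨h1.1, h2⟩, h1.2, by rw [h2, h _ h1]⟩

theorem liftMap_injective (g : E d × ℝ) : Function.Injective (liftMap g) := fun x y h => by
  have := congrArg WithLp.fst h
  simpa using this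

theorem isPolytope_graphOver (g : E d × ℝ) {P : Set (E d)} (hP : IsPolytope P) :
    IsPolytope (graphOver g P) := by
  obtain ⟨S, hS, rfl⟩ := hP
  exact ⟨liftMap g '' S, hS.image _, (liftMap g).image_convexHull S⟩

theorem dim_graphOver (g : E d × ℝ) (P : Set (E d)) : dim (graphOver g P) = dim P := by
  rw [dim, dim, graphOver, ← AffineMap.map_vectorSpan]
  exact (Submodule.equivMapOfInjective _
    ((liftMap g).linear_injective_iff.2 (liftMap_injective g)) _).finrank_eq.symm

theorem isFace_graphOver (g : E d × ℝ) {P F : Set (E d)} (h : IsFace P F) :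
    IsFace (graphOver g P) (graphOver g F) := by
  obtain ⟨a, c, hle, heq⟩ := h.exists_inner
  have key : ∀ p : E' d, inner ℝ (WithLp.toLp 2 (a, (0 : ℝ)) : E' d) p = inner ℝ a p.fst := fun p => by
    rw [inner_E']; simp
  refine isFace_of_inner (a := WithLp.toLp 2 (a, (0 : ℝ))) (c := c) (h.1.image _)
    (fun p hp => ?_) ?_
  · rw [key]; exact hle _ (mem_graphOver.1 hp).1
  · ext p
    rw [mem_ofPred_eq, mem_graphOver, mem_graphOver, key, heq]
    simp only [mem_ofPred_eq]
    tauto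

/-- A functional on the graph pulls back along `liftMap g` to an affine functional on `E d`. -/
theorem isFace_of_graphOver {g : E d × ℝ} {P : Set (E d)} {K : Set (E' d)}
    (h : IsFace (graphOver g P) K) : IsFace P (proj K) ∧ K = graphOver g (proj K) := by
  have hK : K = graphOver g (proj K) := by
    ext p
    rw [mem_graphOver]
    constructor
    · intro hp
      exact ⟨⟨p, hp, rfl⟩, (mem_graphOver.1 (h.subset hp)).2⟩
    · rintro ⟨⟨q, hq, hqp⟩, h2⟩
      have h3 := (mem_graphOver.1 (h.subset hq)).2
      have hqp : q.fst = p.fst := hqp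
      rw [hqp, ← h2] at h3
      rwa [← E'_ext hqp h3]
  refine ⟨?_, hK⟩
  obtain ⟨a, c, hle, heq⟩ := h.exists_inner
  have key : ∀ x, inner ℝ a (liftMap g x) =
      inner ℝ (a.fst + a.snd • g.1) x + a.snd * g.2 := fun x => by
    rw [inner_E', inner_add_left, real_inner_smul_left, liftMap_fst, liftMap_snd, evalPair]
    ring
  refine isFace_of_inner (a := a.fst + a.snd • g.1) (c := c - a.snd * g.2) (h.1.image _)
    (fun x hx => ?_) ?_
  · have := hle _ ⟨x, hx, rfl⟩
    rw [key] at this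
    linarith
  · ext x
    constructor
    · rintro ⟨p, hp, rfl⟩
      rw [heq] at hp
      obtain ⟨⟨y, hy, rfl⟩, hp2⟩ := hp
      rw [key] at hp2
      refine ⟨hy, ?_⟩
      change inner ℝ (a.fst + a.snd • g.1) y = _
      linarith
    · rintro ⟨hx, hx2⟩
      refine ⟨liftMap g x, ?_, rfl⟩
      rw [heq]
      exact ⟨⟨x, hx, rfl⟩, by rw [key]; linarith⟩

theorem isNormal_graphOver (g : E d × ℝ) (P : Set (E d)) :
    IsNormal (graphOver g P) (graphNormal g) := by
  refine ⟨fun h => ?_, ?_⟩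
  · have := congrArg WithLp.snd h
    simp [graphNormal] at this
  · rintro p hp q hq
    rw [inner_sub_right, inner_E', inner_E', (mem_graphOver.1 hp).2, (mem_graphOver.1 hq).2,
      evalPair, evalPair, graphNormal_fst, graphNormal_snd]
    ring

/-- Two normals with last coordinate `-1` differ by a horizontal vector that is orthogonal to every
direction of `P`, hence zero. -/
theorem IsNormal.eq_graphNormal {g : E d × ℝ} {P : Set (E d)} (hP : vectorSpan ℝ P = ⊤)
    (hne : P.Nonempty) {N : E' d} (h : IsNormal (graphOver g P) N) (hN : N.snd = -1) :
    N = graphNormal g := by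
  refine E'_ext ?_ hN
  obtain ⟨x, hx⟩ := hne
  have h1 : ∀ y ∈ P, inner ℝ (N.fst - g.1) y = inner ℝ (N.fst - g.1) x := fun y hy => by
    have := h.2 _ ⟨y, hy, rfl⟩ _ ⟨x, hx, rfl⟩
    rw [inner_sub_right, inner_E', inner_E', hN] at this
    simp only [liftMap_fst, liftMap_snd, evalPair] at this
    rw [inner_sub_left, inner_sub_left]
    linarith
  have h2 : inner ℝ (N.fst - g.1) (N.fst - g.1) = 0 :=
    inner_eq_zero_of_mem_vectorSpan h1 (by rw [hP]; trivial)
  exact sub_eq_zero.1 (inner_self_eq_zero.1 h2)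

theorem graphOver_zero (P : Set (E d)) : graphOver 0 P = embed '' P := by
  refine image_congr fun x _ => E'_ext rfl ?_
  simp [evalPair, embed]

theorem continuous_evalPair (g : E d × ℝ) : Continuous (evalPair g) := by
  unfold evalPair
  fun_prop

theorem evalPair_combo (g : E d × ℝ) (x y : E d) {a b : ℝ} (hab : a + b = 1) :
    evalPair g (a • x + b • y) = a * evalPair g x + b * evalPair g y := by
  simp only [evalPair, inner_add_right, inner_smul_right]
  linear_combination -g.2 * hab

/-! ### The convex function of a positive potential -/

/-- The affine functions `g` attached to the cells have the increments described by `s`. -/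
def IsPotential (T : Set (Set (E d))) (s : Set (E d) → ℝ) (g : Set (E d) → E d × ℝ) : Prop :=
  ∀ P Q, Adjacent T P Q → ∀ x ∈ P ∩ Q, g Q - g P = s (P ∩ Q) • affinePair x (unitNormal P Q)

/-- The affine functions attached to the cells agree where the cells meet. -/
def Agree (T : Set (Set (E d))) (g : Set (E d) → E d × ℝ) : Prop :=
  ∀ P ∈ T, ∀ Q ∈ T, ∀ x, x ∈ P → x ∈ Q → evalPair (g P) x = evalPair (g Q) x

theorem IsPotential.eval_sub {s : Set (E d) → ℝ} {g : Set (E d) → E d × ℝ}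
    (hg : IsPotential T s g) {P Q : Set (E d)} (h : Adjacent T P Q) {x : E d} (hx : x ∈ P ∩ Q)
    (y : E d) :
    evalPair (g Q) y - evalPair (g P) y = s (P ∩ Q) * inner ℝ (unitNormal P Q) (y - x) := by
  have h1 := congrArg Prod.fst (hg P Q h x hx)
  have h2 := congrArg Prod.snd (hg P Q h x hx)
  simp only [affinePair, Prod.fst_sub, Prod.snd_sub, Prod.smul_fst, Prod.smul_snd,
    smul_eq_mul] at h1 h2
  have h3 : inner ℝ (g Q).1 y - inner ℝ (g P).1 y = s (P ∩ Q) * inner ℝ (unitNormal P Q) y := by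
    rw [← inner_sub_left, h1, real_inner_smul_left]
  rw [evalPair, evalPair, inner_sub_right]
  linear_combination h3 + h2

/-- The increment across a hyperface vanishes on it, and two cells through `x` are linked by
hyperfaces through `x`. -/
theorem IsPotential.agree (hT : IsTiling T) {s : Set (E d) → ℝ} {g : Set (E d) → E d × ℝ}
    (hg : IsPotential T s g) : Agree T g := by
  intro P hP Q hQ x hxP hxQ
  have h := hT.star_connected hP hQ hxP hxQ
  induction h with
  | refl => rfl
  | tail _ h ih =>
    have := hg.eval_sub h.1 ⟨h.2.1, h.2.2⟩ x
    rw [sub_self, inner_zero_right, mul_zero] at this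
    rw [ih h.1.1 h.2.1]
    linarith

/-- The piecewise affine function that is given by `g P` on each cell `P`. -/
noncomputable def piecewiseFn (T : Set (Set (E d))) (g : Set (E d) → E d × ℝ) (x : E d) : ℝ :=
  evalPair (g (Classical.epsilon fun P => P ∈ T ∧ x ∈ P)) x

namespace IsTiling

variable (hT : IsTiling T)
include hT

theorem piecewiseFn_eq {g : Set (E d) → E d × ℝ} (hg : Agree T g) {P : Set (E d)} (hP : P ∈ T)
    {x : E d} (hx : x ∈ P) : piecewiseFn T g x = evalPair (g P) x := by
  obtain ⟨h1, h2⟩ := Classical.epsilon_spec (p := fun P => P ∈ T ∧ x ∈ P) (hT.exists_cell x)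
  exact hg _ h1 P hP x h2 hx

theorem continuous_piecewiseFn {g : Set (E d) → E d × ℝ} (hg : Agree T g) :
    Continuous (piecewiseFn T g) := by
  refine hT.locallyFinite.continuous ?_ (fun P => hT.isClosed P.2) fun P => ?_
  · rw [← sUnion_eq_iUnion, hT.cover]
  · exact (continuous_evalPair (g P)).continuousOn.congr fun x hx => hT.piecewiseFn_eq hg P.2 hx

/-- Along a generic segment leaving `P`, each crossing at time `t` adds `s F * (τ - t) * ⟨n, z - y⟩`
at every later time `τ`, and this is nonnegative because the segment moves in the direction of `n`.
Generic endpoints are dense, and continuity does the rest. -/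
theorem evalPair_le_piecewiseFn {s : Set (E d) → ℝ} (hs : ∀ F ∈ facets T, 0 < s F)
    {g : Set (E d) → E d × ℝ} (hg : IsPotential T s g) {P : Set (E d)} (hP : P ∈ T) (x : E d) :
    evalPair (g P) x ≤ piecewiseFn T g x := by
  have hagree := hg.agree hT
  obtain ⟨y, hy⟩ := hT.fullDim P hP
  have hcl : IsClosed {x | evalPair (g P) x ≤ piecewiseFn T g x} :=
    isClosed_le (continuous_evalPair _) (hT.continuous_piecewiseFn hagree)
  suffices hd : Dense {x | evalPair (g P) x ≤ piecewiseFn T g x} by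
    have := hd.closure_eq
    rw [hcl.closure_eq] at this
    exact eq_univ_iff_forall.1 this x
  rw [dense_iff_inter_open]
  intro U hU hU'
  obtain ⟨z, hzU, hgen⟩ := hT.exists_segGeneric hP hy hU hU'
  refine ⟨z, hzU, ?_⟩
  obtain ⟨Q, hQ, hzQ⟩ := hT.exists_cell z
  -- Comparing the affine functions at all later times on the line, not only at the current one, is
  -- what lets the inequality pass from cell to cell.
  have := hT.segment_induction hP hy hgen (fun Q t => ∀ τ ≥ t,
    evalPair (g P) (y + τ • (z - y)) ≤ evalPair (g Q) (y + τ • (z - y))) (fun _ _ => le_rfl)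
    (fun Q t t' h hC τ hτ => hC τ (h.trans hτ)) ?_ 1 ⟨zero_le_one, le_rfl⟩ Q hQ (by simpa) 1 le_rfl
  · simpa [hT.piecewiseFn_eq hagree hQ hzQ] using this
  · intro A B t t' ht' htt' ht1 hC hadj hA hA' hB τ hτ
    refine (hC τ hτ).trans ?_
    have h1 := hg.eval_sub hadj ⟨hA', hB⟩ (y + τ • (z - y))
    have h2 := (hT.unitNormal_spec hadj).2.2 _ ⟨hA', hB⟩ _ hA
    simp only [inner_neg_left, inner_add_right, inner_smul_right] at h2
    have h3 : 0 ≤ inner ℝ (unitNormal A B) (z - y) := by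
      by_contra h
      nlinarith
    have h4 : inner ℝ (unitNormal A B) (y + τ • (z - y) - (y + t • (z - y))) =
        (τ - t) * inner ℝ (unitNormal A B) (z - y) := by
      rw [add_sub_add_left_eq_sub, ← sub_smul, inner_smul_right]
    rw [h4] at h1
    have h5 := mul_nonneg (hs _ (hT.inter_mem_facets hadj)).le
      (mul_nonneg (sub_nonneg.2 hτ) h3)
    linarith

/-- The first crossing starts from an interior point of `P`, so it is transversal and its
contribution is strictly positive afterwards. -/
theorem evalPair_lt_of_segGeneric {s : Set (E d) → ℝ} (hs : ∀ F ∈ facets T, 0 < s F)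
    {g : Set (E d) → E d × ℝ} (hg : IsPotential T s g) {P Q : Set (E d)} (hP : P ∈ T) (hQ : Q ∈ T)
    (hne : Q ≠ P) {y z : E d} (hy : y ∈ interior P) (hz : z ∈ interior Q)
    (hgen : SegGeneric T y z) : evalPair (g P) z < evalPair (g Q) z := by
  have hev : ∀ᶠ t in 𝓝[<] (1 : ℝ), y + t • (z - y) ∈ Q := by
    have hc : Continuous fun t : ℝ => y + t • (z - y) := by fun_prop
    have h1 : Tendsto (fun t : ℝ => y + t • (z - y)) (𝓝 1) (𝓝 z) := by
      simpa using hc.tendsto 1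
    exact (h1.mono_left nhdsWithin_le_nhds).eventually (mem_interior_iff_mem_nhds.1 hz)
  -- Strictness holds only after the time of crossing, so `Q` must be reached at some `t₀ < 1` for
  -- the conclusion to cover `τ = 1`.
  obtain ⟨t₀, ht₀, ht₀I⟩ := (hev.and (Ioo_mem_nhdsLT zero_lt_one)).exists
  have := hT.segment_induction hP hy hgen (fun Q t => Q = P ∨ ∀ τ > t,
    evalPair (g P) (y + τ • (z - y)) < evalPair (g Q) (y + τ • (z - y))) (Or.inl rfl)
    (fun Q t t' h hC => hC.imp_right fun hC τ hτ => hC τ (h.trans_lt hτ)) ?_ t₀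
    ⟨ht₀I.1.le, ht₀I.2.le⟩ Q hQ ht₀
  · simpa using (this.resolve_left hne) 1 ht₀I.2
  · intro A B t t' ht' htt' ht1 hC hadj hA hA' hB
    refine Or.inr fun τ hτ => ?_
    have h1 := hg.eval_sub hadj ⟨hA', hB⟩ (y + τ • (z - y))
    have h4 : inner ℝ (unitNormal A B) (y + τ • (z - y) - (y + t • (z - y))) =
        (τ - t) * inner ℝ (unitNormal A B) (z - y) := by
      rw [add_sub_add_left_eq_sub, ← sub_smul, inner_smul_right]
    rw [h4] at h1
    have hspos := hs _ (hT.inter_mem_facets hadj)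
    rcases hC with rfl | hC
    · have h2 := inner_lt_of_mem_interior (neg_ne_zero.2 (hT.unitNormal_spec hadj).1.ne_zero)
        ((hT.unitNormal_spec hadj).2.2 _ ⟨hA', hB⟩) hy
      simp only [inner_neg_left, inner_add_right, inner_smul_right] at h2
      have h3 : 0 < inner ℝ (unitNormal A B) (z - y) := by
        by_contra h
        nlinarith
      have := mul_pos hspos (mul_pos (sub_pos.2 hτ) h3)
      linarith
    · have h2 := (hT.unitNormal_spec hadj).2.2 _ ⟨hA', hB⟩ _ hA
      simp only [inner_neg_left, inner_add_right, inner_smul_right] at h2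
      have h3 : 0 ≤ inner ℝ (unitNormal A B) (z - y) := by
        by_contra h
        nlinarith
      have := mul_nonneg hspos.le (mul_nonneg (sub_nonneg.2 hτ.le) h3)
      linarith [hC τ hτ]

theorem convexOn_piecewiseFn {s : Set (E d) → ℝ} (hs : ∀ F ∈ facets T, 0 < s F)
    {g : Set (E d) → E d × ℝ} (hg : IsPotential T s g) : ConvexOn ℝ univ (piecewiseFn T g) := by
  refine ⟨convex_univ, fun x _ y _ a b ha hb hab => ?_⟩
  obtain ⟨Q, hQ, hx⟩ := hT.exists_cell (a • x + b • y)
  rw [hT.piecewiseFn_eq (hg.agree hT) hQ hx, evalPair_combo _ _ _ hab, smul_eq_mul, smul_eq_mul]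
  gcongr <;> exact hT.evalPair_le_piecewiseFn hs hg hQ _

/-- If equality held at `x`, convexity would give `f ≤ g P` between `x` and any point of `P`. This
contradicts the strict inequality at a generic point `z ∉ P` on such a segment. -/
theorem evalPair_lt_piecewiseFn {s : Set (E d) → ℝ} (hs : ∀ F ∈ facets T, 0 < s F)
    {g : Set (E d) → E d × ℝ} (hg : IsPotential T s g) {P : Set (E d)} (hP : P ∈ T) {x : E d}
    (hx : x ∉ P) : evalPair (g P) x < piecewiseFn T g x := by
  have hagree := hg.agree hT
  refine (hT.evalPair_le_piecewiseFn hs hg hP x).lt_of_ne fun heq => ?_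
  obtain ⟨y, hy⟩ := hT.fullDim P hP
  have hcx : Tendsto (fun t : ℝ => x + t • (y - x)) (𝓝[>] 0) (𝓝 x) := by
    have hc : Continuous fun t : ℝ => x + t • (y - x) := by fun_prop
    have : Tendsto (fun t : ℝ => x + t • (y - x)) (𝓝 0) (𝓝 x) := by simpa using hc.tendsto 0
    exact this.mono_left nhdsWithin_le_nhds
  obtain ⟨t, htP, ht⟩ := ((hcx.eventually ((hT.isClosed hP).isOpen_compl.mem_nhds hx)).and
    (Ioo_mem_nhdsGT zero_lt_one)).exists
  have ht0 : t ≠ 0 := ht.1.ne'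
  -- The dilation from `x` that takes the chosen point of the segment to `y`. If `φ z` lies in the
  -- interior of `P`, then `z` lies between `x` and a point of `P`, which is an open condition on
  -- `z`.
  set φ : E d → E d := fun w => x + t⁻¹ • (w - x) with hφ
  have hφc : Continuous φ := by fun_prop
  set V := φ ⁻¹' interior P ∩ Pᶜ with hV
  have hVo : IsOpen V := (isOpen_interior.preimage hφc).inter (hT.isClosed hP).isOpen_compl
  have hxV : x + t • (y - x) ∈ V := by
    refine ⟨?_, htP⟩
    simpa [hφ, smul_smul, inv_mul_cancel₀ ht0] using hy
  obtain ⟨Q, hQ, hxQ⟩ := hT.exists_cell (x + t • (y - x))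
  rw [← hT.closure_interior hQ] at hxQ
  obtain ⟨z, ⟨hzV, hzQ⟩, hgen⟩ := hT.exists_segGeneric hP hy (hVo.inter isOpen_interior)
    (mem_closure_iff.1 hxQ V hVo hxV)
  have hne : Q ≠ P := by
    rintro rfl
    exact hzV.2 (interior_subset hzQ)
  have h1 := hT.evalPair_lt_of_segGeneric hs hg hP hQ hne hy hzQ hgen
  have h2 : z = (1 - t) • x + t • φ z := by
    simp only [hφ, smul_add, smul_smul, mul_inv_cancel₀ ht0]
    module
  have h3 := (hT.convexOn_piecewiseFn hs hg).2 (mem_univ x) (mem_univ (φ z))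
    (sub_nonneg.2 ht.2.le) ht.1.le (by ring)
  rw [← h2, smul_eq_mul, smul_eq_mul, ← heq,
    hT.piecewiseFn_eq hagree hP (interior_subset hzV.1), ← evalPair_combo _ _ _ (by ring), ← h2,
    hT.piecewiseFn_eq hagree hQ (interior_subset hzQ)] at h3
  linarith

end IsTiling

/-! ### The complex of graphs over the cells -/

/-- The complex of the graphs over the cells of the affine functions attached to them. -/
noncomputable def graphComplex (T : Set (Set (E d))) (g : Set (E d) → E d × ℝ) :
    Set (Set (E' d)) := (fun P => graphOver (g P) P) '' T

theorem continuous_fst_E' : Continuous fun p : E' d => p.fst := by fun_prop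

theorem continuous_snd_E' : Continuous fun p : E' d => p.snd := by fun_prop

namespace IsTiling

variable (hT : IsTiling T)
include hT

omit hT in
theorem graphOver_inter_graphOver {g : Set (E d) → E d × ℝ} (hg : Agree T g) {P Q : Set (E d)}
    (hP : P ∈ T) (hQ : Q ∈ T) :
    graphOver (g P) P ∩ graphOver (g Q) Q = graphOver (g P) (P ∩ Q) :=
  graphOver_inter fun x hx => hg P hP Q hQ x hx.1 hx.2

theorem mem_sUnion_graphComplex {g : Set (E d) → E d × ℝ} (hg : Agree T g) {p : E' d} :
    p ∈ ⋃₀ graphComplex T g ↔ p.snd = piecewiseFn T g p.fst := by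
  constructor
  · rintro ⟨_, ⟨P, hP, rfl⟩, hp⟩
    obtain ⟨h1, h2⟩ := mem_graphOver.1 hp
    rw [h2, hT.piecewiseFn_eq hg hP h1]
  · intro h
    obtain ⟨P, hP, hp⟩ := hT.exists_cell p.fst
    refine ⟨_, ⟨P, hP, rfl⟩, mem_graphOver.2 ⟨hp, ?_⟩⟩
    rw [h, hT.piecewiseFn_eq hg hP hp]

omit hT in
theorem proj_image_graphComplex (g : Set (E d) → E d × ℝ) : proj '' graphComplex T g = T := by
  rw [graphComplex, image_image]
  simp [proj_graphOver]

theorem isLocallyFinite_graphComplex (g : Set (E d) → E d × ℝ) :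
    IsLocallyFinite (graphComplex T g) := by
  have h1 : LocallyFinite fun A : graphComplex T g =>
      (⟨proj A, by
        obtain ⟨P, hP, h⟩ := A.2
        rw [← h, proj_graphOver]; exact hP⟩ : T).1 := by
    refine hT.locallyFinite.comp_injective (g := fun A : graphComplex T g => (⟨proj A, by
        obtain ⟨P, hP, h⟩ := A.2
        rw [← h, proj_graphOver]; exact hP⟩ : T)) ?_
    rintro ⟨_, P, hP, rfl⟩ ⟨_, Q, hQ, rfl⟩ h
    simp only [Subtype.mk.injEq, proj_graphOver] at h
    simp [h]
  exact (h1.preimage_continuous continuous_fst_E').subset fun A p hp => ⟨p, hp, rfl⟩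

/-- The union of the graphs is homeomorphic to the space by projection. -/
noncomputable def graphHomeomorph {g : Set (E d) → E d × ℝ} (hg : Agree T g) :
    ⋃₀ graphComplex T g ≃ₜ E d where
  toFun p := p.1.fst
  invFun x := ⟨WithLp.toLp 2 (x, piecewiseFn T g x), (hT.mem_sUnion_graphComplex hg).2 rfl⟩
  left_inv p := Subtype.ext (E'_ext rfl ((hT.mem_sUnion_graphComplex hg).1 p.2).symm)
  right_inv _ := rfl
  continuous_toFun := continuous_fst_E'.comp continuous_subtype_val
  continuous_invFun := by
    have := hT.continuous_piecewiseFn hg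
    fun_prop

theorem isGeneratrix_graphComplex {g : Set (E d) → E d × ℝ} (hg : Agree T g) :
    IsGeneratrix T (graphComplex T g) where
  isManifold :=
    { polytope := by
        rintro _ ⟨P, hP, rfl⟩
        exact isPolytope_graphOver _ (hT.polytope P hP)
      nonempty := by
        rintro _ ⟨P, hP, rfl⟩
        exact (hT.nonempty hP).image _
      dim_eq := by
        rintro _ ⟨P, hP, rfl⟩
        rw [dim_graphOver, hT.dim_eq hP]
      faceToFace := by
        rintro _ ⟨P, hP, rfl⟩ _ ⟨Q, hQ, rfl⟩ hne hmeet
        have hPQ : P ≠ Q := fun h => hne (by rw [h])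
        have h1 := graphOver_inter_graphOver hg hP hQ
        have h2 := graphOver_inter_graphOver hg hQ hP
        rw [inter_comm, inter_comm Q P] at h2
        simp only at hmeet ⊢
        rw [h1] at hmeet
        obtain ⟨h3, h4⟩ := hT.faceToFace P hP Q hQ hPQ (image_nonempty.1 hmeet)
        refine ⟨?_, ?_⟩
        · rw [h1]; exact isFace_graphOver _ h3
        · rw [h2]; exact isFace_graphOver _ h4
      locallyFinite := hT.isLocallyFinite_graphComplex g
      manifold := ⟨(hT.graphHomeomorph hg).toOpenPartialHomeomorph.singletonChartedSpace rfl⟩ }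
  injOn p hp q hq h := by
    have h1 := (hT.mem_sUnion_graphComplex hg).1 hp
    have h2 := (hT.mem_sUnion_graphComplex hg).1 hq
    refine E'_ext h ?_
    rw [h1, h2]
    exact congrArg _ h
  proj_eq := proj_image_graphComplex g

theorem hasNormalIncrements_graphComplex {s : Set (E d) → ℝ} {g : Set (E d) → E d × ℝ}
    (hg : IsPotential T s g) : HasNormalIncrements T (graphComplex T g) s := by
  rintro _ ⟨P, hP, rfl⟩ _ ⟨Q, hQ, rfl⟩ hadj N M hN hM hN1 hM1
  simp only [proj_graphOver] at hadj ⊢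
  rw [hN.eq_graphNormal (hT.vectorSpan_eq_top hP) (hT.nonempty hP) hN1,
    hM.eq_graphNormal (hT.vectorSpan_eq_top hQ) (hT.nonempty hQ) hM1]
  obtain ⟨x, hx⟩ := hadj.2.2.2.1
  have h1 := congrArg Prod.fst (hg P Q hadj x hx)
  refine E'_ext ?_ ?_
  · exact h1
  · simp [embed]

/-- The convex set is the epigraph of the piecewise affine function. The hyperplane that extends the
graph over `P` supports it, and touches it over `P` only by the strict inequality. -/
theorem boundsConvexPolyhedron_graphComplex {s : Set (E d) → ℝ} (hs : ∀ F ∈ facets T, 0 < s F)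
    {g : Set (E d) → E d × ℝ} (hg : IsPotential T s g) :
    BoundsConvexPolyhedron (graphComplex T g) := by
  have hagree := hg.agree hT
  have hf : Continuous fun p : E' d => piecewiseFn T g p.fst :=
    (hT.continuous_piecewiseFn hagree).comp continuous_fst_E'
  have hconv := (hT.convexOn_piecewiseFn hs hg).2
  have hcv : Convex ℝ {p : E' d | piecewiseFn T g p.fst ≤ p.snd} := by
    intro p hp q hq a b ha hb hab
    have h1 := hconv (mem_univ p.fst) (mem_univ q.fst) ha hb hab
    have h2 : (a • p + b • q).snd = a * p.snd + b * q.snd := rfl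
    have h3 : (a • p + b • q).fst = a • p.fst + b • q.fst := rfl
    rw [mem_ofPred_eq] at hp hq ⊢
    rw [h2, h3]
    refine h1.trans ?_
    rw [smul_eq_mul, smul_eq_mul]
    gcongr
  have hopen : {p : E' d | piecewiseFn T g p.fst < p.snd} ⊆
      interior {p : E' d | piecewiseFn T g p.fst ≤ p.snd} :=
    interior_maximal (fun p hp => (show piecewiseFn T g p.fst < p.snd from hp).le)
      (isOpen_lt hf continuous_snd_E')
  refine ⟨{p | piecewiseFn T g p.fst ≤ p.snd}, hcv, isClosed_le hf continuous_snd_E', ?_, ?_, ?_⟩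
  · refine ⟨WithLp.toLp 2 (0, piecewiseFn T g 0 + 1), hopen ?_⟩
    change piecewiseFn T g 0 < piecewiseFn T g 0 + 1
    linarith
  · ext p
    rw [hT.mem_sUnion_graphComplex hagree]
    constructor
    · exact fun hp => (frontier_le_subset_eq hf continuous_snd_E' hp).symm
    · intro hp
      refine ⟨subset_closure hp.ge, fun hint => ?_⟩
      have hc : Continuous fun t : ℝ => p + t • (n₀ : E' d) := by fun_prop
      have h1 : Tendsto (fun t : ℝ => p + t • (n₀ : E' d)) (𝓝[>] 0) (𝓝 p) := by
        have : Tendsto (fun t : ℝ => p + t • (n₀ : E' d)) (𝓝 0) (𝓝 p) := by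
          simpa using hc.tendsto 0
        exact this.mono_left nhdsWithin_le_nhds
      obtain ⟨t, ht, ht0⟩ := ((h1.eventually (mem_interior_iff_mem_nhds.1 hint)).and
        self_mem_nhdsWithin).exists
      have h2 : piecewiseFn T g (p + t • (n₀ : E' d)).fst ≤ (p + t • (n₀ : E' d)).snd := ht
      have h3 : (p + t • (n₀ : E' d)).fst = p.fst := by simp [n₀]
      have h4 : (p + t • (n₀ : E' d)).snd = p.snd - t := by simp [n₀, sub_eq_add_neg]
      rw [h3, h4, hp] at h2
      have : 0 < t := ht0
      linarith
  · rintro _ ⟨P, hP, rfl⟩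
    refine isFace_of_inner (a := graphNormal (g P)) (c := -(g P).2) ((hT.nonempty hP).image _)
      (fun p hp => ?_) ?_
    · have := hT.evalPair_le_piecewiseFn hs hg hP p.fst
      rw [evalPair] at this
      rw [mem_ofPred_eq] at hp
      rw [inner_E', graphNormal_fst, graphNormal_snd]
      linarith
    · ext p
      rw [mem_graphOver]
      constructor
      · rintro ⟨h1, h2⟩
        refine ⟨?_, ?_⟩
        · rw [mem_ofPred_eq, h2, hT.piecewiseFn_eq hagree hP h1]
        · rw [inner_E', graphNormal_fst, graphNormal_snd, h2, evalPair]
          ring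
      · rintro ⟨h1, h2⟩
        rw [mem_ofPred_eq] at h1
        rw [inner_E', graphNormal_fst, graphNormal_snd] at h2
        have h3 : p.snd = evalPair (g P) p.fst := by rw [evalPair]; linarith
        refine ⟨?_, h3⟩
        by_contra hx
        have := hT.evalPair_lt_piecewiseFn hs hg hP hx
        linarith

end IsTiling

/-! ### Lifts along chains -/

/-- A normal and one point determine the hyperplane. This is the source of the uniqueness of lifts.
-/
theorem eq_graphOver_of_isNormal {g : E d × ℝ} {B : Set (E' d)} (hN : IsNormal B (graphNormal g))
    {q : E' d} (hq : q ∈ B) (hqg : q.snd = evalPair g q.fst) : B = graphOver g (proj B) := by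
  have key : ∀ b ∈ B, b.snd = evalPair g b.fst := fun b hb => by
    have := hN.2 b hb q hq
    rw [inner_sub_right, inner_E', inner_E', graphNormal_fst, graphNormal_snd] at this
    rw [evalPair] at hqg ⊢
    linarith
  ext p
  rw [mem_graphOver]
  constructor
  · exact fun hp => ⟨⟨p, hp, rfl⟩, key p hp⟩
  · rintro ⟨⟨b, hb, hbp⟩, hp⟩
    have hbp : b.fst = p.fst := hbp
    have h1 := key b hb
    rw [hbp, ← hp] at h1
    rwa [← E'_ext hbp h1]

theorem IsPotential.graphNormal_add {s : Set (E d) → ℝ} {g : Set (E d) → E d × ℝ}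
    (hg : IsPotential T s g) {P Q : Set (E d)} (h : Adjacent T P Q) :
    graphNormal (g P) + embed (s (P ∩ Q) • unitNormal P Q) = graphNormal (g Q) := by
  obtain ⟨x, hx⟩ := h.2.2.2.1
  have h1 : (g Q).1 - (g P).1 = s (P ∩ Q) • unitNormal P Q := congrArg Prod.fst (hg P Q h x hx)
  refine E'_ext ?_ ?_
  · change (g P).1 + s (P ∩ Q) • unitNormal P Q = (g Q).1
    rw [← h1, add_sub_cancel]
  · simp [embed]

namespace IsTiling

variable (hT : IsTiling T)
include hT

/-- By induction, the prescribed normal of the next lift is that of the graph of `g Q`, and the lift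
passes through a point over `P ∩ Q`, where `g P` and `g Q` agree. Nothing but the last cell of the
chain enters the result. -/
theorem isChainLift_eq {s : Set (E d) → ℝ} {g : Set (E d) → E d × ℝ} (hg : IsPotential T s g)
    {P₀ : Set (E d)} (hP₀ : P₀ ∈ T) (h0 : g P₀ = 0) {c : List (Set (E d))} {A : Set (E' d)}
    {N : E' d} (h : IsChainLift T s P₀ c A N) :
    ∃ P c', c = P :: c' ∧ P ∈ T ∧ A = graphOver (g P) P ∧ N = graphNormal (g P) := by
  induction h with
  | base =>
    refine ⟨P₀, [], rfl, hP₀, ?_, ?_⟩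
    · rw [h0, graphOver_zero]
    · rw [h0]; rfl
  | @step c P Q A B N hc hadj hup hN ih =>
    obtain ⟨P', c', h1, -, hA, rfl⟩ := ih
    obtain ⟨rfl, rfl⟩ := List.cons.inj h1
    rw [hg.graphNormal_add hadj] at hN ⊢
    refine ⟨Q, _, rfl, hadj.2.1, ?_, rfl⟩
    obtain ⟨x, hx⟩ := hadj.2.2.2.1
    obtain ⟨⟨-, -, hB⟩, -, -, hAB⟩ := hup
    rw [← hAB] at hx
    obtain ⟨q, ⟨hqA, hqB⟩, hqx⟩ := hx
    rw [hA, mem_graphOver] at hqA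
    have hqQ : q.fst ∈ Q := hB ▸ ⟨q, hqB, rfl⟩
    have h2 := eq_graphOver_of_isNormal hN hqB
      (hqA.2.trans (hg.agree hT P hadj.1 Q hadj.2.1 _ hqA.1 hqQ))
    rwa [hB] at h2

theorem isLiftUpTo_graphOver {g : Set (E d) → E d × ℝ} (hg : Agree T g) {P Q : Set (E d)}
    (h : Adjacent T P Q) : IsLiftUpTo P (graphOver (g P) P) Q (graphOver (g Q) Q) := by
  have h1 := graphOver_inter_graphOver hg h.1 h.2.1
  have h2 := graphOver_inter_graphOver hg h.2.1 h.1
  rw [inter_comm, inter_comm Q P] at h2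
  obtain ⟨h3, h4⟩ := hT.faceToFace P h.1 Q h.2.1 h.2.2.1 h.2.2.2.1
  refine ⟨⟨isPolytope_graphOver _ (hT.polytope Q h.2.1), dim_graphOver _ _, proj_graphOver _ _⟩,
    ?_, ?_, ?_⟩
  · rw [h1]; exact isFace_graphOver _ h3
  · rw [h2]; exact isFace_graphOver _ h4
  · rw [h1, proj_graphOver]

theorem isChainLift_step {s : Set (E d) → ℝ} {g : Set (E d) → E d × ℝ} (hg : IsPotential T s g)
    {P₀ P Q : Set (E d)} {c : List (Set (E d))}
    (hc : IsChainLift T s P₀ (P :: c) (graphOver (g P) P) (graphNormal (g P)))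
    (h : Adjacent T P Q) :
    IsChainLift T s P₀ (Q :: P :: c) (graphOver (g Q) Q) (graphNormal (g Q)) := by
  have := hc.step h (hT.isLiftUpTo_graphOver (hg.agree hT) h)
  rw [hg.graphNormal_add h] at this
  exact this (isNormal_graphOver _ _)

omit hT in
theorem isChainLift_base (s : Set (E d) → ℝ) {g : Set (E d) → E d × ℝ} {P₀ : Set (E d)}
    (h0 : g P₀ = 0) :
    IsChainLift T s P₀ [P₀] (graphOver (g P₀) P₀) (graphNormal (g P₀)) := by
  rw [h0, graphOver_zero]
  exact .base

theorem existsUnique_isChainLift {s : Set (E d) → ℝ} {g : Set (E d) → E d × ℝ}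
    (hg : IsPotential T s g) {P₀ : Set (E d)} (hP₀ : P₀ ∈ T) (h0 : g P₀ = 0)
    {c : List (Set (E d))} (hc : IsChainFrom T P₀ c) : ∃! A, ∃ N, IsChainLift T s P₀ c A N := by
  have key : ∀ (c : List (Set (E d))) (P : Set (E d)), IsChainFrom T P₀ (P :: c) →
      IsChainLift T s P₀ (P :: c) (graphOver (g P) P) (graphNormal (g P)) := by
    intro c
    induction c with
    | nil =>
      rintro P ⟨-, h⟩
      simp only [List.getLast?_singleton, Option.some.injEq] at h
      subst h
      exact isChainLift_base s h0
    | cons Q c ih =>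
      rintro P ⟨h1, h2⟩
      rw [List.isChain_cons_cons] at h1
      rw [List.getLast?_cons_cons] at h2
      exact hT.isChainLift_step hg (ih Q ⟨h1.2, h2⟩) h1.1
  cases c with
  | nil => simp [IsChainFrom] at hc
  | cons P c =>
    refine ⟨_, ⟨_, key c P hc⟩, ?_⟩
    rintro A ⟨N, hA⟩
    obtain ⟨P', c', h1, -, rfl, -⟩ := hT.isChainLift_eq hg hP₀ h0 hA
    rw [(List.cons.inj h1).1]

theorem exists_isChainLift {s : Set (E d) → ℝ} {g : Set (E d) → E d × ℝ}
    (hg : IsPotential T s g) {P₀ P : Set (E d)} (hP₀ : P₀ ∈ T) (h0 : g P₀ = 0) (hP : P ∈ T) :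
    ∃ c, IsChainLift T s P₀ (P :: c) (graphOver (g P) P) (graphNormal (g P)) := by
  have h := hT.connected hP₀ hP
  induction h with
  | refl => exact ⟨[], isChainLift_base s h0⟩
  | tail _ h ih =>
    obtain ⟨c, hc⟩ := ih h.1
    exact ⟨_, hT.isChainLift_step hg hc h⟩

theorem liftedComplex_eq {s : Set (E d) → ℝ} {g : Set (E d) → E d × ℝ}
    (hg : IsPotential T s g) {P₀ : Set (E d)} (hP₀ : P₀ ∈ T) (h0 : g P₀ = 0) :
    liftedComplex T s P₀ = graphComplex T g := by
  ext A
  constructor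
  · rintro ⟨c, N, h⟩
    obtain ⟨P, c', -, hP, rfl, -⟩ := hT.isChainLift_eq hg hP₀ h0 h
    exact ⟨P, hP, rfl⟩
  · rintro ⟨P, hP, rfl⟩
    obtain ⟨c, hc⟩ := hT.exists_isChainLift hg hP₀ h0 hP
    exact ⟨_, _, hc⟩

theorem liftAdjacent_graphOver {s : Set (E d) → ℝ} {g : Set (E d) → E d × ℝ}
    (hg : IsPotential T s g) {P₀ P Q : Set (E d)} (hP₀ : P₀ ∈ T) (h0 : g P₀ = 0) :
    LiftAdjacent T s P₀ (graphOver (g P) P) (graphOver (g Q) Q) ↔ Adjacent T P Q := by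
  have key : ∀ {P Q c R N M}, IsChainLift T s P₀ c (graphOver (g P) P) N →
      IsChainLift T s P₀ (R :: c) (graphOver (g Q) Q) M → Adjacent T P Q := by
    intro P Q c R N M h1 h2
    obtain ⟨P', c', rfl, -, hA, -⟩ := hT.isChainLift_eq hg hP₀ h0 h1
    obtain ⟨R', c'', h3, -, hB, -⟩ := hT.isChainLift_eq hg hP₀ h0 h2
    obtain ⟨rfl, rfl⟩ := List.cons.inj h3
    have hA := congrArg proj hA
    have hB := congrArg proj hB
    rw [proj_graphOver, proj_graphOver] at hA hB
    subst hA hB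
    cases h2 with
    | step _ h _ _ => exact h
  constructor
  · rintro ⟨c, R, N, M, ⟨h1, h2⟩ | ⟨h1, h2⟩⟩
    · exact key h1 h2
    · exact (key h1 h2).symm
  · intro h
    obtain ⟨c, hc⟩ := hT.exists_isChainLift hg hP₀ h0 h.1
    exact ⟨_, _, _, _, Or.inl ⟨hc, hT.isChainLift_step hg hc h⟩⟩

theorem liftAdjacent_iff {s : Set (E d) → ℝ} {g : Set (E d) → E d × ℝ}
    (hg : IsPotential T s g) {P₀ : Set (E d)} (hP₀ : P₀ ∈ T) (h0 : g P₀ = 0) {A B : Set (E' d)}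
    (hA : A ∈ graphComplex T g) (hB : B ∈ graphComplex T g) :
    LiftAdjacent T s P₀ A B ↔ A ≠ B ∧ (A ∩ B).Nonempty ∧ dim (A ∩ B) + 1 = d := by
  obtain ⟨P, hP, rfl⟩ := hA
  obtain ⟨Q, hQ, rfl⟩ := hB
  simp only
  rw [hT.liftAdjacent_graphOver hg hP₀ h0, graphOver_inter_graphOver (hg.agree hT) hP hQ,
    dim_graphOver]
  have : graphOver (g P) P ≠ graphOver (g Q) Q ↔ P ≠ Q := by
    refine not_congr ⟨fun h => ?_, fun h => by rw [h]⟩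
    have := congrArg proj h
    rwa [proj_graphOver, proj_graphOver] at this
  rw [this, show (graphOver (g P) (P ∩ Q)).Nonempty ↔ (P ∩ Q).Nonempty from image_nonempty]
  exact ⟨fun h => h.2.2, fun h => ⟨hP, hQ, h⟩⟩

/-- A geometric common face projects to a common face of two cells, and a chain of adjacent cells
around that face lifts to the required sequence. Conversely, `K` lies in the last member and
face-to-face position makes it a face there. -/
theorem liftCommonFace_iff {s : Set (E d) → ℝ} {g : Set (E d) → E d × ℝ}
    (hg : IsPotential T s g) {P₀ : Set (E d)} (hP₀ : P₀ ∈ T) (h0 : g P₀ = 0) {A B : Set (E' d)}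
    (hA : A ∈ graphComplex T g) (hB : B ∈ graphComplex T g) (K : Set (E' d)) :
    LiftCommonFace T s P₀ A B K ↔ IsFace A K ∧ IsFace B K := by
  have hagree := hg.agree hT
  obtain ⟨P, hP, rfl⟩ := hA
  obtain ⟨Q, hQ, rfl⟩ := hB
  refine and_congr_right fun hK => ?_
  obtain ⟨h1, h2⟩ := isFace_of_graphOver hK
  constructor
  · intro h
    have hKB : K ⊆ graphOver (g Q) Q := by
      rcases h.cases_tail with h | ⟨_, -, h⟩
      · simp only at h
        rw [h]; exact hK.subset
      · exact h.2.trans inter_subset_right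
    have hKQ : proj K ⊆ Q := by
      rintro _ ⟨p, hp, rfl⟩
      exact (mem_graphOver.1 (hKB hp)).1
    have h3 := isFace_graphOver (g Q) (hT.face_of_subset hP hQ h1 hKQ)
    rwa [← graphOver_congr fun x hx => hagree P hP Q hQ x (h1.subset hx) (hKQ hx), ← h2] at h3
  · intro h
    obtain ⟨h3, -⟩ := isFace_of_graphOver h
    refine (hT.face_connected hP hQ h1 h3.subset).lift (fun R => graphOver (g R) R) ?_
    rintro X Y ⟨hadj, hX, hY⟩
    have hsub : ∀ X ∈ T, proj K ⊆ X → K ⊆ graphOver (g X) X := by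
      intro X hX hKX p hp
      have h4 := hKX ⟨p, hp, rfl⟩
      have h5 := mem_graphOver.1 (hK.subset hp)
      exact mem_graphOver.2 ⟨h4, h5.2.trans (hagree P hP X hX _ h5.1 h4)⟩
    exact ⟨(hT.liftAdjacent_graphOver hg hP₀ h0).2 hadj,
      subset_inter (hsub X hadj.1 hX) (hsub Y hadj.2.1 hY)⟩

end IsTiling

/-! ### Normal increments of a generatrix -/

theorem finrank_E' (d : ℕ) : Module.finrank ℝ (E' d) = d + 1 := by
  rw [(WithLp.linearEquiv 2 ℝ (E d × ℝ)).finrank_eq]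
  simp

/-- A normal to a set over a cell is not horizontal. -/
theorem IsTiling.snd_ne_zero (hT : IsTiling T) {A : Set (E' d)} (hA : proj A ∈ T) {N : E' d}
    (hN : IsNormal A N) : N.snd ≠ 0 := by
  intro h
  obtain ⟨x, hx⟩ := hT.nonempty hA
  have h1 : ∀ y ∈ proj A, inner ℝ N.fst y = inner ℝ N.fst x := by
    obtain ⟨q, hq, rfl⟩ := hx
    rintro _ ⟨p, hp, rfl⟩
    have := hN.2 p hp q hq
    rw [inner_sub_right, inner_E', inner_E', h] at this
    simp only
    linarith
  have h2 : inner ℝ N.fst N.fst = 0 :=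
    inner_eq_zero_of_mem_vectorSpan h1 (by rw [hT.vectorSpan_eq_top hA]; trivial)
  exact hN.1 (E'_ext (inner_self_eq_zero.1 h2) h)

theorem graphNormal_of_normal {N : E' d} (h : N.snd ≠ 0) (c : ℝ) :
    graphNormal (-N.snd⁻¹ • N.fst, c) = -N.snd⁻¹ • N := by
  refine E'_ext rfl ?_
  change -1 = -N.snd⁻¹ * N.snd
  rw [neg_mul, inv_mul_cancel₀ h]

/-- A set of dimension `d` in dimension `d + 1` has a normal. It is not horizontal because the
projection is full-dimensional, so it can be rescaled to last coordinate `-1`. -/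
theorem IsTiling.exists_eq_graphOver (hT : IsTiling T) {A : Set (E' d)} (hA : proj A ∈ T)
    (hdim : dim A = d) : ∃ γ, A = graphOver γ (proj A) := by
  have hne : (vectorSpan ℝ A)ᗮ ≠ ⊥ := by
    intro h
    have h1 := Submodule.finrank_add_finrank_orthogonal (vectorSpan ℝ A)
    rw [h, finrank_bot, finrank_E'] at h1
    rw [dim] at hdim
    omega
  obtain ⟨N, hN, hN0⟩ := Submodule.exists_mem_ne_zero_of_ne_bot hne
  have hN' : IsNormal A N := ⟨hN0, fun x hx y hy =>
    Submodule.inner_left_of_mem_orthogonal (vsub_mem_vectorSpan ℝ hx hy) hN⟩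
  have hs := hT.snd_ne_zero hA hN'
  obtain ⟨x, q, hq, -⟩ := hT.nonempty hA
  refine ⟨(-N.snd⁻¹ • N.fst, q.snd - inner ℝ (-N.snd⁻¹ • N.fst) q.fst),
    eq_graphOver_of_isNormal ?_ hq (by simp [evalPair])⟩
  rw [graphNormal_of_normal hs]
  refine ⟨smul_ne_zero (neg_ne_zero.2 (inv_ne_zero hs)) hN0, fun x hx y hy => ?_⟩
  rw [real_inner_smul_left, hN'.2 x hx y hy, mul_zero]

/-- Each cell lifts to a graph, and injectivity of the projection makes the heights over a common
point equal. -/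
theorem IsGeneratrix.exists_eq_graphComplex (hT : IsTiling T) {G : Set (Set (E' d))}
    (hG : IsGeneratrix T G) : ∃ g, Agree T g ∧ G = graphComplex T g := by
  have hproj : ∀ A ∈ G, proj A ∈ T := fun A hA => hG.proj_eq ▸ ⟨A, hA, rfl⟩
  have hex : ∀ P, ∃ γ : E d × ℝ, P ∈ T → graphOver γ P ∈ G := fun P => by
    by_cases hP : P ∈ T
    · obtain ⟨A, hA, rfl⟩ : P ∈ proj '' G := hG.proj_eq ▸ hP
      obtain ⟨γ, hγ⟩ := hT.exists_eq_graphOver hP (hG.isManifold.dim_eq A hA)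
      exact ⟨γ, fun _ => hγ ▸ hA⟩
    · exact ⟨0, fun h => absurd h hP⟩
  choose g hg using hex
  refine ⟨g, fun P hP Q hQ x hxP hxQ => ?_, subset_antisymm (fun A hA => ?_) ?_⟩
  · have := hG.injOn ⟨_, hg P hP, x, hxP, rfl⟩ ⟨_, hg Q hQ, x, hxQ, rfl⟩ rfl
    exact congrArg WithLp.snd this
  · refine ⟨proj A, hproj A hA, ?_⟩
    obtain ⟨γ, hγ⟩ := hT.exists_eq_graphOver (hproj A hA) (hG.isManifold.dim_eq A hA)
    rw [hγ, proj_graphOver]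
    refine graphOver_congr fun x hx => ?_
    have hx' : liftMap γ x ∈ A := by
      rw [hγ]; exact ⟨x, hx, rfl⟩
    have := hG.injOn ⟨_, hg _ (hproj A hA), x, hx, rfl⟩ ⟨A, hA, hx'⟩ rfl
    exact congrArg WithLp.snd this
  · rintro _ ⟨P, hP, rfl⟩
    exact hg P hP

/-! ### Recovering the scaling from the affine functions -/

theorem IsPotential.zeroTorsion (hT : IsTiling T) {s : Set (E d) → ℝ} {g : Set (E d) → E d × ℝ}
    (hg : IsPotential T s g) : ZeroTorsion T s := by
  refine hT.zeroTorsion_of_increments (h := fun P => (g P).1) fun F hF ν hν => ?_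
  have hadj := hT.adjacent_side hF hν
  obtain ⟨x, hx⟩ := hadj.2.2.2.1
  have h1 := congrArg Prod.fst (hg _ _ hadj x hx)
  rw [hT.side_inter hF hν, hT.unitNormal_side hF hν] at h1
  exact h1.symm

theorem IsPotential.neg {s : Set (E d) → ℝ} {g : Set (E d) → E d × ℝ} (hg : IsPotential T s g) :
    IsPotential T (-s) (-g) := fun P Q h x hx => by
  rw [Pi.neg_apply, Pi.neg_apply, Pi.neg_apply, neg_smul, ← hg P Q h x hx]
  abel

/-- The difference `g Q - g P` vanishes on `P ∩ Q`, so its gradient is a multiple of the normal.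
Exchanging `P` and `Q` reverses both gradient difference and normal, so the coefficient depends on
the hyperface alone. -/
theorem Agree.exists_isPotential (hT : IsTiling T) {g : Set (E d) → E d × ℝ} (hg : Agree T g) :
    ∃ s, IsPotential T s g := by
  refine ⟨fun F => inner ℝ (facetNormal F)
    ((g (side T F (facetNormal F))).1 - (g (side T F (-facetNormal F))).1), ?_⟩
  intro P Q h x hx
  have hF := hT.inter_mem_facets h
  set F := P ∩ Q with hFdef
  set n := unitNormal P Q
  obtain ⟨hn, hQ, hP⟩ := hT.unitNormal_spec h
  have hQ' : Q = side T F n := hT.eq_side hF hn h.2.1 inter_subset_right hQ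
  have hP' : P = side T F (-n) := hT.eq_side hF hn.neg h.1 inter_subset_left hP
  set w := (g Q).1 - (g P).1 with hw
  have h1 : ∀ y ∈ F, inner ℝ w y = (g P).2 - (g Q).2 := fun y hy => by
    have := hg P h.1 Q h.2.1 y hy.1 hy.2
    rw [evalPair, evalPair] at this
    rw [hw, inner_sub_left]
    linarith
  have h2 : w = inner ℝ n w • n :=
    hn.eq_smul (dim_of_mem_facets hF) fun v hv => inner_eq_zero_of_mem_vectorSpan h1 hv
  have h3 : inner ℝ (facetNormal F)
      ((g (side T F (facetNormal F))).1 - (g (side T F (-facetNormal F))).1) = inner ℝ n w := by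
    rcases hn.eq_or_eq_neg (dim_of_mem_facets hF) (facetNormal_spec hF) with h4 | h4
    · rw [h4, ← hQ', ← hP']
    · rw [h4, neg_neg, ← hQ', ← hP', ← neg_sub (g Q).1, inner_neg_neg]
  simp only
  rw [h3]
  refine Prod.ext h2 ?_
  change (g Q).2 - (g P).2 = inner ℝ n w * -inner ℝ n x
  have h5 := h1 x hx
  rw [h2, real_inner_smul_left] at h5
  linarith

/-- The affine function of a cell supports the piecewise affine function, from below or from above,
and touches it on the cell only. -/
theorem IsTiling.lt_or_lt_of_boundsConvexPolyhedron (hT : IsTiling T) {g : Set (E d) → E d × ℝ}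
    (hg : Agree T g) (hC : BoundsConvexPolyhedron (graphComplex T g)) {P : Set (E d)}
    (hP : P ∈ T) : (∀ x ∉ P, evalPair (g P) x < piecewiseFn T g x) ∨
      (∀ x ∉ P, piecewiseFn T g x < evalPair (g P) x) := by
  obtain ⟨C, -, hCcl, ⟨p₀, hp₀⟩, hfr, hface⟩ := hC
  obtain ⟨a, c, hle, heq⟩ := (hface _ ⟨P, hP, rfl⟩).exists_inner
  simp only at heq
  have hval : ∀ p ∈ graphOver (g P) P, inner ℝ a p = c := fun p hp => by
    rw [heq] at hp
    exact hp.2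
  -- If the functional were zero, the whole of `C` would be the graph over `P`, which has no
  -- interior point.
  have ha : a ≠ 0 := by
    rintro rfl
    obtain ⟨x, hx⟩ := hT.nonempty hP
    have hc := hval _ ⟨x, hx, rfl⟩
    rw [inner_zero_left] at hc
    have hCA : C ⊆ graphOver (g P) P := fun p hp => by
      rw [heq]
      exact ⟨hp, by rw [inner_zero_left, hc]⟩
    have hcont : Continuous fun t : ℝ => p₀ + t • (n₀ : E' d) := by fun_prop
    have h1 : Tendsto (fun t : ℝ => p₀ + t • (n₀ : E' d)) (𝓝[>] 0) (𝓝 p₀) := by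
      have : Tendsto (fun t : ℝ => p₀ + t • (n₀ : E' d)) (𝓝 0) (𝓝 p₀) := by
        simpa using hcont.tendsto 0
      exact this.mono_left nhdsWithin_le_nhds
    obtain ⟨t, ht, ht0⟩ := ((h1.eventually (mem_interior_iff_mem_nhds.1 hp₀)).and
      self_mem_nhdsWithin).exists
    have h2 := (mem_graphOver.1 (hCA ht)).2
    have h3 : (p₀ + t • (n₀ : E' d)).fst = p₀.fst := by simp [n₀]
    have h4 : (p₀ + t • (n₀ : E' d)).snd = p₀.snd - t := by simp [n₀, sub_eq_add_neg]
    rw [h3, h4, (mem_graphOver.1 (hCA (interior_subset hp₀))).2] at h2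
    have : 0 < t := ht0
    linarith
  have hN : IsNormal (graphOver (g P) P) a := ⟨ha, fun x hx y hy => by
    rw [inner_sub_right, hval x hx, hval y hy, sub_self]⟩
  have hs : a.snd ≠ 0 := hT.snd_ne_zero (by rw [proj_graphOver]; exact hP) hN
  have hN' : IsNormal (graphOver (g P) P) (-a.snd⁻¹ • a) :=
    ⟨smul_ne_zero (neg_ne_zero.2 (inv_ne_zero hs)) ha, fun x hx y hy => by
      rw [real_inner_smul_left, hN.2 x hx y hy, mul_zero]⟩
  -- The supporting hyperplane of the face is thus the graph of `g P`. The sign of `a.snd` tells on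
  -- which side of it `C` lies.
  have hag : -a.snd⁻¹ • a = graphNormal (g P) :=
    hN'.eq_graphNormal (hT.vectorSpan_eq_top hP) (hT.nonempty hP)
      (by rw [← graphNormal_of_normal hs 0, graphNormal_snd])
  have ha1 : a.fst = -a.snd • (g P).1 := by
    have h1 : -a.snd⁻¹ • a.fst = (g P).1 := congrArg WithLp.fst hag
    rw [← h1, smul_smul, neg_mul_neg, mul_inv_cancel₀ hs, one_smul]
  have hin : ∀ p : E' d, inner ℝ a p = -a.snd * (evalPair (g P) p.fst - p.snd - (g P).2) := by
    intro p
    rw [inner_E', ha1, real_inner_smul_left, evalPair]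
    ring
  have hc : c = -a.snd * -(g P).2 := by
    obtain ⟨x, hx⟩ := hT.nonempty hP
    have := hval _ ⟨x, hx, rfl⟩
    rw [hin, liftMap_fst, liftMap_snd] at this
    rw [← this]
    ring
  have key : ∀ x ∉ P, -a.snd * (evalPair (g P) x - piecewiseFn T g x) < 0 := by
    intro x hx
    set p : E' d := WithLp.toLp 2 (x, piecewiseFn T g x) with hp
    have hpC : p ∈ C := by
      apply hCcl.frontier_subset
      rw [hfr]
      exact (hT.mem_sUnion_graphComplex hg).2 rfl
    have hne : inner ℝ a p ≠ c := fun h => by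
      have : p ∈ graphOver (g P) P := by
        rw [heq]
        exact ⟨hpC, h⟩
      exact hx (mem_graphOver.1 this).1
    have h1 := (hle p hpC).lt_of_ne hne
    rw [hin, hc] at h1
    change -a.snd * (evalPair (g P) x - piecewiseFn T g x - (g P).2) < _ at h1
    linarith
  rcases hs.lt_or_gt with h | h
  · refine Or.inl fun x hx => ?_
    have h1 := key x hx
    by_contra h2
    nlinarith
  · refine Or.inr fun x hx => ?_
    have h1 := key x hx
    by_contra h2
    nlinarith

/-- At an interior point of `Q`, which lies off `P`, the piecewise affine function minus `g P`
equals `s (P ∩ Q)` times a positive number. -/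
theorem IsTiling.facet_pos_iff (hT : IsTiling T) {s : Set (E d) → ℝ} {g : Set (E d) → E d × ℝ}
    (hg : IsPotential T s g) {P Q : Set (E d)} (h : Adjacent T P Q) :
    ((∀ x ∉ P, evalPair (g P) x < piecewiseFn T g x) → 0 < s (P ∩ Q)) ∧
      ((∀ x ∉ P, piecewiseFn T g x < evalPair (g P) x) → s (P ∩ Q) < 0) := by
  obtain ⟨x, hx⟩ := h.2.2.2.1
  obtain ⟨q, hq⟩ := hT.fullDim Q h.2.1
  have hqP : q ∉ P := fun hqP => h.2.2.1 (hT.eq_of_mem_interior h.2.1 h.1 hq hqP).symm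
  have h1 := hg.eval_sub h hx q
  have h2 := hT.inner_unitNormal_pos h hx hq
  have h3 := hT.piecewiseFn_eq (hg.agree hT) h.2.1 (interior_subset hq)
  constructor
  · intro h4
    have := h4 q hqP
    exact pos_of_mul_pos_left (b := inner ℝ (unitNormal P Q) (q - x)) (by linarith) h2.le
  · intro h4
    have := h4 q hqP
    by_contra h5
    nlinarith [mul_nonneg (not_lt.1 h5) h2.le]

/-- The sign of `s` on a hyperface is read off equally from both of its cells. Hence adjacent cells
are both supporting from below or both from above, and by connectedness all cells behave like `P₀`.
-/
theorem IsTiling.exists_canonicalScaling (hT : IsTiling T) {s : Set (E d) → ℝ}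
    {g : Set (E d) → E d × ℝ} (hg : IsPotential T s g)
    (hC : BoundsConvexPolyhedron (graphComplex T g)) :
    IsCanonicalScaling T s ∨ IsCanonicalScaling T (-s) := by
  have hcases := fun {P} (hP : P ∈ T) => hT.lt_or_lt_of_boundsConvexPolyhedron (hg.agree hT) hC hP
  have hfacet : ∀ F ∈ facets T, ∃ P Q, Adjacent T P Q ∧ P ∩ Q = F := fun F hF =>
    ⟨_, _, hT.adjacent_side hF (facetNormal_spec hF), hT.side_inter hF (facetNormal_spec hF)⟩
  obtain ⟨P₀, hP₀, -⟩ := hT.exists_cell 0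
  rcases hcases hP₀ with h | h
  · refine Or.inl ⟨fun F hF => ?_, hg.zeroTorsion hT⟩
    obtain ⟨P, Q, hadj, rfl⟩ := hfacet F hF
    refine (hT.facet_pos_iff hg hadj).1 ?_
    have hconn := hT.connected hP₀ hadj.1
    clear hF hadj
    induction hconn with
    | refl => exact h
    | tail _ hadj ih =>
      refine (hcases hadj.2.1).resolve_right fun h' => ?_
      have h1 := (hT.facet_pos_iff hg hadj).1 ih
      have h2 := (hT.facet_pos_iff hg hadj.symm).2 h'
      rw [inter_comm] at h2
      exact lt_asymm h1 h2
  · refine Or.inr ⟨fun F hF => ?_, hg.neg.zeroTorsion hT⟩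
    obtain ⟨P, Q, hadj, rfl⟩ := hfacet F hF
    refine neg_pos.2 ((hT.facet_pos_iff hg hadj).2 ?_)
    have hconn := hT.connected hP₀ hadj.1
    clear hF hadj
    induction hconn with
    | refl => exact h
    | tail _ hadj ih =>
      refine (hcases hadj.2.1).resolve_left fun h' => ?_
      have h1 := (hT.facet_pos_iff hg hadj).2 ih
      have h2 := (hT.facet_pos_iff hg hadj.symm).1 h'
      rw [inter_comm] at h2
      exact lt_asymm h1 h2

end Gen

/-! ### The main theorem -/

theorem mainTheorem3 (d : ℕ) (T : Set (Set (Gen.E d))) (hT : Gen.IsTiling T) :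
    -- the complex built from a canonical scaling is well defined, its incidences are the
    -- geometric ones, and it is a generatrix (which bounds a convex polyhedron)
    (∀ s : Set (Gen.E d) → ℝ, Gen.IsCanonicalScaling T s → ∀ P₀ ∈ T,
      (∀ c, Gen.IsChainFrom T P₀ c → ∃! A, ∃ N, Gen.IsChainLift T s P₀ c A N) ∧
      (∀ A ∈ Gen.liftedComplex T s P₀, ∀ B ∈ Gen.liftedComplex T s P₀,
        (Gen.LiftAdjacent T s P₀ A B ↔
          A ≠ B ∧ (A ∩ B).Nonempty ∧ Gen.dim (A ∩ B) + 1 = d) ∧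
        ∀ K, Gen.LiftCommonFace T s P₀ A B K ↔ Gen.IsFace A K ∧ Gen.IsFace B K) ∧
      Gen.IsGeneratrix T (Gen.liftedComplex T s P₀) ∧
      Gen.HasNormalIncrements T (Gen.liftedComplex T s P₀) s ∧
      Gen.BoundsConvexPolyhedron (Gen.liftedComplex T s P₀)) ∧
    -- the normal increments of a generatrix give a scaling with zero torsion, which is a
    -- canonical (that is, also positive) one, up to a common sign, if the generatrix bounds a
    -- convex polyhedron
    (∀ G : Set (Set (Gen.E' d)), Gen.IsGeneratrix T G →
      (∃ s : Set (Gen.E d) → ℝ, Gen.ZeroTorsion T s ∧ Gen.HasNormalIncrements T G s) ∧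
      (Gen.BoundsConvexPolyhedron G → ∃ s : Set (Gen.E d) → ℝ, Gen.IsCanonicalScaling T s ∧
        (Gen.HasNormalIncrements T G s ∨ Gen.HasNormalIncrements T G (-s)))) := by
  refine ⟨fun s hs P₀ hP₀ => ?_, fun G hG => ?_⟩
  · obtain ⟨g, h0, hg⟩ := hT.exists_potential hs.2 hP₀
    have hg : Gen.IsPotential T s g := hg
    rw [hT.liftedComplex_eq hg hP₀ h0]
    exact ⟨fun c hc => hT.existsUnique_isChainLift hg hP₀ h0 hc,
      fun A hA B hB => ⟨hT.liftAdjacent_iff hg hP₀ h0 hA hB,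
        hT.liftCommonFace_iff hg hP₀ h0 hA hB⟩,
      hT.isGeneratrix_graphComplex (hg.agree hT), hT.hasNormalIncrements_graphComplex hg,
      hT.boundsConvexPolyhedron_graphComplex hs.1 hg⟩
  · obtain ⟨g, hagree, rfl⟩ := hG.exists_eq_graphComplex hT
    obtain ⟨s, hg⟩ := hagree.exists_isPotential hT
    have hinc := hT.hasNormalIncrements_graphComplex hg
    refine ⟨⟨s, hg.zeroTorsion hT, hinc⟩, fun hC => ?_⟩
    rcases hT.exists_canonicalScaling hg hC with h | h
    · exact ⟨s, h, Or.inl hinc⟩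
    · exact ⟨-s, h, Or.inr (by rwa [neg_neg])⟩
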